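/- All rings are commutative, unital and nonzero. Let $A\subseteq B$ be rings (with the same identity), $X$ an indeterminate, and $R=A+XB[X]$, the subring of $B[X]$ of all polynomials whose constant term lies in $A$. "One-dimensional" means of Krull dimension exactly $1$. Terminology. A ring is *von Neumann regular* if it is reduced and of Krull dimension $0$, and *semi-quasilocal* if it has only finitely many maximal ideals. The extension $A\subseteq B$ is *unibranched* if for each prime ideal $P$ of $A$ there is exactly one prime ideal $Q$ of $B$ with $Q\cap A=P$. An integral domain $D$ with quotient field $K$ is a *PVD* if for every prime ideal $P$ of $D$ and all $x,y\in K$ with $xy\in P$ one has $x\in P$ or $y\in P$; it is *Mori* if it satisfies the ascending chain condition on divisorial ideals, i.e. on nonzero ideals $I$ with $D:(D:I)=I$, where $D:J=\{x\in K\mid xJ\subseteq D\}$; a *DVR* is a Noetherian valuation domain that is not a field. A ring $T$ is a *PVR* if it has a maximal ideal $M$ such that $aM$ and $bT$ are comparable under inclusion for all $a,b\in T$, and an *LPVR* if $T_M$ is a PVR for each maximal ideal $M$. A ring $T$ is *divided* if $P\subsetneq aT$ for each prime ideal $P$ and each $a\in T\setminus P$, and *locally divided* if $T_M$ is divided for each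 maximal ideal $M$. A ring *satisfies $(*)$* if every ideal whose radical is prime is primary. It is *strongly Laskerian* if every proper ideal is a finite intersection of primary ideals and every primary ideal contains a power of its radical; *Bézout* if every finitely generated ideal is principal; *arithmetical* if for each maximal ideal $M$ the ideals of the localization at $M$ form a chain. An ideal $I$ is *$n$-absorbing* if whenever $a_1\cdots a_{n+1}\in I$, the product of some $n$ of the $a_i$ (omitting one index) lies in $I$. A ring is *finite-absorbing* if each proper ideal is $n$-absorbing for some positive integer $n$ (depending on the ideal); a *TAF-ring* if each proper ideal is a finite product of $2$-absorbing ideals; an *FAF-ring* if for some fixed positive integer $n$ each proper ideal is a finite product of $n$-absorbing ideals; a *general ZPI-ring* if each proper ideal is a finite product of prime ideals. Then the following hold. 1. $R$ is a one-dimensional reduced ring if and only if both $A$ and $B$ are von Neumann regular. 2. The following are equivalent: (a) $R_M$ is a Mori PVD for each maximal ideal $M$ of $R$; (b) $R_M$ is a one-dimensional domain for each maximal ideal $M$ of $R$; (c) $R$ satisfies $(*)$; (d) $R$ is a one-dimensional LPVR; (e) $R$ is a one-dimensional locally divided ring; (f) $A\subseteq B$ is a unibranched extension of von Neumann regular rings.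 3. $R$ is a one-dimensional strongly Laskerian reduced ring if and only if both $A$ and $B$ are semi-quasilocal von Neumann regular rings. 4. The following are equivalent: (a) $R$ is a one-dimensional Bézout ring; (b) $R_M$ is a DVR for each maximal ideal $M$ of $R$; (c) $R$ is a one-dimensional arithmetical ring; (d) $A=B$ is a von Neumann regular ring. 5. The following are equivalent: (a) $R$ is a TAF-ring; (b) $R$ is an FAF-ring; (c) $R$ is strongly Laskerian and locally divided; (d) $R$ is finite-absorbing and locally divided; (e) $A\subseteq B$ is a unibranched extension of semi-quasilocal von Neumann regular rings; (e') $A\subseteq B$ is a unibranched extension of Artinian reduced rings; (f) there exist fields $F_1,\dots,F_n$ and $L_1,\dots,L_n$ with $A\cong\prod_{i=1}^n F_i$, $B\cong\prod_{i=1}^n L_i$ and $F_i\subseteq L_i$ for each $i$; (f') there exist fields $F_i\subseteq L_i$ $(1\le i\le n)$ and an isomorphism $B\cong\prod_{i=1}^n L_i$ that maps $A$ onto $\prod_{i=1}^n F_i$. 6. The following are equivalent: (a) $R$ is a general ZPI-ring; (b) $R$ is a strongly Laskerian Bézout ring; (c) $R$ is a TAF-ring and $A=B$; (d) $A=B$ is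 a semi-quasilocal von Neumann regular ring. -/

import Mathlib

open Polynomial

universe u

/-- The subring `A + X B[X]` of `B[X]`, for a subring `A` of `B`: all polynomials over `B` whose
constant coefficient lies in `A`. -/
noncomputable def subringAddXMul {B : Type*} [CommRing B] (A : Subring B) : Subring B[X] :=
  A.comap Polynomial.constantCoeff

/-- The elements of `subringAddXMul A` are exactly the sums `a + X g` with `a ∈ A`, `g ∈ B[X]`. -/
theorem mem_subringAddXMul_iff {B : Type*} [CommRing B] (A : Subring B) (f : B[X]) :
    f ∈ subringAddXMul A ↔ ∃ a ∈ A, ∃ g : B[X], f = C a + X * g := by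
  constructor
  · intro hf
    refine ⟨f.coeff 0, hf, f.divX, ?_⟩
    rw [add_comm]
    exact (Polynomial.X_mul_divX_add f).symm
  · rintro ⟨a, ha, g, rfl⟩
    simpa [subringAddXMul, Subring.mem_comap, Polynomial.constantCoeff_apply] using ha

/-- A von Neumann regular ring: reduced and of Krull dimension zero. -/
def IsVNRegular (R : Type*) [CommRing R] : Prop :=
  IsReduced R ∧ ringKrullDim R = 0

/-- A semi-quasilocal ring: only finitely many maximal ideals. -/
def IsSemiQuasilocal (R : Type*) [CommRing R] : Prop :=
  {M : Ideal R | M.IsMaximal}.Finite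

/-- The extension `A ⊆ B` is unibranched: over each prime ideal of `A` lies exactly one prime ideal
of `B`. -/
def IsUnibranched {B : Type*} [CommRing B] (A : Subring B) : Prop :=
  ∀ P : Ideal A, P.IsPrime → ∃! Q : Ideal B, Q.IsPrime ∧ Q.comap A.subtype = P

/-- A pseudo-valuation domain: an integral domain `R` with quotient field `K` such that every prime
ideal `P` of `R` is strongly prime, i.e. `x y ∈ P` with `x, y ∈ K` implies `x ∈ P` or `y ∈ P`. -/
def IsPVD (R : Type*) [CommRing R] : Prop :=
  IsDomain R ∧ ∀ P : Ideal R, P.IsPrime → ∀ x y : FractionRing R,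
    x * y ∈ IsLocalization.coeSubmodule (FractionRing R) P →
      x ∈ IsLocalization.coeSubmodule (FractionRing R) P ∨
      y ∈ IsLocalization.coeSubmodule (FractionRing R) P

/-- A divisorial ideal: a nonzero ideal `I` with `R : (R : I) = I`, where for `R`-submodules `J, J'`
of the quotient field `K` the quotient `J / J'` is `J : J' = {x ∈ K | x J' ⊆ J}`, and `1` is the
submodule `R` of `K`. -/
def IsDivisorialIdeal {R : Type*} [CommRing R] (I : Ideal R) : Prop :=
  I ≠ ⊥ ∧
    (1 : Submodule R (FractionRing R)) /
        ((1 : Submodule R (FractionRing R)) / IsLocalization.coeSubmodule (FractionRing R) I) =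
      IsLocalization.coeSubmodule (FractionRing R) I

/-- A Mori domain: an integral domain with the ascending chain condition on divisorial ideals. -/
def IsMoriDomain (R : Type*) [CommRing R] : Prop :=
  IsDomain R ∧ ∀ I : ℕ →o Ideal R, (∀ n, IsDivisorialIdeal (I n)) → ∃ n, ∀ m, n ≤ m → I m = I n

/-- A DVR: a Noetherian valuation domain that is not a field. -/
def IsDVR (R : Type*) [CommRing R] : Prop :=
  ∃ _ : IsDomain R, IsDiscreteValuationRing R

/-- Every ideal whose radical is prime is primary. -/
def SatisfiesStar (R : Type*) [CommRing R] : Prop :=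
  ∀ I : Ideal R, I.radical.IsPrime → I.IsPrimary

/-- A pseudo-valuation ring: some maximal ideal `M` is strongly prime, i.e. `a M` and `b R` are
comparable for all elements `a, b`. -/
def IsPVR (R : Type*) [CommRing R] : Prop :=
  ∃ M : Ideal R, M.IsMaximal ∧ ∀ a b : R,
    Ideal.span {a} * M ≤ Ideal.span {b} ∨ Ideal.span {b} ≤ Ideal.span {a} * M

/-- A locally pseudo-valuation ring. -/
def IsLPVR (R : Type*) [CommRing R] : Prop :=
  ∀ (M : Ideal R) [M.IsMaximal], IsPVR (Localization.AtPrime M)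

/-- A divided ring: each prime ideal is properly contained in every principal ideal generated by an
element outside of it. -/
def IsDividedRing (R : Type*) [CommRing R] : Prop :=
  ∀ P : Ideal R, P.IsPrime → ∀ a : R, a ∉ P → P < Ideal.span {a}

/-- A locally divided ring. -/
def IsLocallyDivided (R : Type*) [CommRing R] : Prop :=
  ∀ (M : Ideal R) [M.IsMaximal], IsDividedRing (Localization.AtPrime M)

/-- A strongly Laskerian ring: every ideal is a finite intersection of primary ideals, and every
primary ideal contains a power of its radical. -/
def IsStronglyLaskerian (R : Type*) [CommRing R] : Prop :=
  IsLasker R R ∧ ∀ Q : Ideal R, Q.IsPrimary → ∃ n : ℕ, Q.radical ^ n ≤ Q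

/-- An arithmetical ring: the ideals of each localization at a maximal ideal form a chain. -/
def IsArithmeticalRing (R : Type*) [CommRing R] : Prop :=
  ∀ (M : Ideal R) [M.IsMaximal], ∀ I J : Ideal (Localization.AtPrime M), I ≤ J ∨ J ≤ I

/-- An `n`-absorbing ideal: whenever a product of `n + 1` elements lies in `I`, the product of some
`n` of them (omitting one index) lies in `I`. -/
def IsNAbsorbing {R : Type*} [CommRing R] (n : ℕ) (I : Ideal R) : Prop :=
  ∀ a : Fin (n + 1) → R, ∏ i, a i ∈ I → ∃ i, ∏ j ∈ Finset.univ.erase i, a j ∈ I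

/-- A finite-absorbing ring: each proper ideal is `n`-absorbing for some positive integer `n`. -/
def IsFiniteAbsorbing (R : Type*) [CommRing R] : Prop :=
  ∀ I : Ideal R, I ≠ ⊤ → ∃ n : ℕ, 0 < n ∧ IsNAbsorbing n I

/-- Every proper ideal is a finite product of ideals with the property `p`. -/
def ProperIdealsFactor (R : Type*) [CommRing R] (p : Ideal R → Prop) : Prop :=
  ∀ I : Ideal R, I ≠ ⊤ → ∃ s : Multiset (Ideal R), (∀ J ∈ s, p J) ∧ s.prod = I

/-- A general ZPI-ring: each proper ideal is a finite product of prime ideals. -/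
def IsGeneralZPI (R : Type*) [CommRing R] : Prop :=
  ProperIdealsFactor R fun J => J.IsPrime

/-- A TAF-ring: each proper ideal is a finite product of 2-absorbing ideals. -/
def IsTAFRing (R : Type*) [CommRing R] : Prop :=
  ProperIdealsFactor R (IsNAbsorbing 2)

/-- An FAF-ring: for some positive integer `n`, each proper ideal is a finite product of
`n`-absorbing ideals. -/
def IsFAFRing (R : Type*) [CommRing R] : Prop :=
  ∃ n : ℕ, 0 < n ∧ ProperIdealsFactor R (IsNAbsorbing n)

/-! Everything passes through one condition, `IsLocallyFieldExtension`: A is zero-dimensional and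
each element of a prime P of B is killed by an element of A outside P. By
`isLocallyFieldExtension_iff` this means that A ⊆ B is a unibranched extension of von Neumann
regular rings.

The primes of R containing X are the p + XB[X] (`overIdeal`) with p a prime of A. Those without X
are contracted from primes of B[X] (`lowIdeal`), among them Q[X] ∩ R (`starIdeal`) for Q a prime of
B. Since X is regular, p + XB[X] is never minimal, and Q[X] ∩ R lies strictly below (Q ∩ A) + XB[X].
Hence R is one-dimensional exactly when A and B are zero-dimensional.

To reach the central condition, localize at M = m + XB[X]. If no nonmaximal prime of a localization
contains X, then A is zero-dimensional. If the nonmaximal primes of R_M that miss X lie in (X²),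
then for b ∈ Q some s ∉ M has sXb = X²r, and the coefficient of X gives s(0)b = 0. In a divided ring
this holds because X² avoids such a prime. For one-dimensional domains, Mori PVDs and divided
finite-absorbing rings the nonmaximal primes vanish. The FAF case is the hardest:
`ProperIdealsFactor.prime_le_span_pow` places a nonmaximal prime of a local ring in all powers of a
regular nonunit. Condition (*) is instead tested on the explicit ideals `coeffIdeal`.

Conversely, under the central condition each maximal ideal of R is contracted from a nonzero prime
of L[X], with L a residue field of B. The corresponding discrete valuation descends to R_M
(`IsPseudoValuation`) and makes it a one-dimensional Mori PVD, and a DVR if A = B.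

For the finiteness statements, B[X] is Noetherian when B is Artinian, though R need not be, and
Artin–Rees in B[X] yields primary decompositions in R. In the unibranched case R splits into rings F
+ XL[X], where every nonzero proper ideal is a product of primes, copies of (X) and at most one
ideal between M² and M. In the other direction, an absorbing ideal of a von Neumann regular ring
lies under only finitely many maximal ideals. Finally, A = B follows from comparing Xb with X in
R_M, or from factoring (X) into primes. -/

/-! ### Absorbing ideals and the Choi–Walker theorem -/

section Absorbing

variable {R : Type*} [CommRing R]

theorem multiset_exists_cons {α : Type*} {s : Multiset α} {n : ℕ} (hs : s.card = n + 1) :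
    ∃ a t, s = a ::ₘ t ∧ t.card = n := by
  obtain ⟨a, ha⟩ := Multiset.card_pos_iff_exists_mem.1 (by omega : 0 < s.card)
  obtain ⟨t, rfl⟩ := Multiset.exists_cons_of_mem ha
  exact ⟨a, t, rfl, by simpa using hs⟩

theorem multiset_prod_mem_pow {P : Ideal R} {t : Multiset R} (h : ∀ a ∈ t, a ∈ P) :
    t.prod ∈ P ^ t.card := by
  induction t using Multiset.induction_on with
  | empty => simp
  | cons a t ih =>
    rw [Multiset.prod_cons, Multiset.card_cons, pow_succ']
    exact Ideal.mul_mem_mul (h a (by simp)) (ih fun b hb => h b (by simp [hb]))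

/-- Multisets allow factors to be merged, dropped and exchanged without reindexing `Fin (n + 1)`. -/
theorem isNAbsorbing_iff_multiset [DecidableEq R] {n : ℕ} {I : Ideal R} :
    IsNAbsorbing n I ↔ ∀ s : Multiset R, s.card = n + 1 → s.prod ∈ I →
      ∃ a ∈ s, (s.erase a).prod ∈ I := by
  have key : ∀ (a : Fin (n + 1) → R) (i : Fin (n + 1)),
      ((Finset.univ.val.map a).erase (a i)).prod = ∏ j ∈ Finset.univ.erase i, a j := by
    intro a i
    rw [← Multiset.map_erase_of_mem _ _ (Finset.mem_univ i)]
    rfl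
  constructor
  · intro h s hs hI
    obtain ⟨a, rfl⟩ : ∃ a : Fin (n + 1) → R, s = Finset.univ.val.map a := by
      induction s using Quotient.inductionOn with
      | h l =>
        have hl : l.length = n + 1 := hs
        refine ⟨fun i => l.get (i.cast hl.symm), ?_⟩
        simp only [Fin.univ_val_map]
        refine congrArg _ (List.ext_getElem (by simp [hl]) fun i _ _ => ?_)
        rw [List.getElem_ofFn]
        simp
    obtain ⟨i, hi⟩ := h a hI
    exact ⟨a i, Multiset.mem_map_of_mem _ (Finset.mem_univ i), by rwa [key]⟩
  · intro h a ha
    obtain ⟨x, hx, hI⟩ := h (Finset.univ.val.map a) (by simp) ha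
    obtain ⟨i, -, rfl⟩ := Multiset.mem_map.1 hx
    exact ⟨i, by rwa [key] at hI⟩

/-- Merging two factors reduces their number by one. If the merged factor is the one that may be
dropped, dropping just one of its two parts is also allowed. -/
theorem IsNAbsorbing.succ {n : ℕ} {I : Ideal R} (h : IsNAbsorbing n I) :
    IsNAbsorbing (n + 1) I := by
  classical
  rw [isNAbsorbing_iff_multiset] at h ⊢
  intro s hs hI
  obtain ⟨a, t, rfl, ht⟩ := multiset_exists_cons hs
  obtain ⟨b, t, rfl, ht'⟩ := multiset_exists_cons ht
  obtain ⟨c, hc, hcI⟩ := h ((a * b) ::ₘ t) (by simp [ht']) (by simpa [mul_assoc] using hI)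
  by_cases hab : c = a * b
  · subst hab
    refine ⟨a, by simp, ?_⟩
    rw [Multiset.erase_cons_head] at hcI ⊢
    rw [Multiset.prod_cons]
    exact I.mul_mem_left _ hcI
  · have hct : c ∈ t := by simpa [hab] using hc
    obtain ⟨t, rfl⟩ := Multiset.exists_cons_of_mem hct
    refine ⟨c, by simp, ?_⟩
    rw [Multiset.erase_cons_tail _ (Ne.symm hab), Multiset.erase_cons_head] at hcI
    rw [Multiset.cons_swap b c, Multiset.cons_swap a c, Multiset.erase_cons_head]
    simpa [mul_assoc] using hcI

theorem IsNAbsorbing.mono {n m : ℕ} {I : Ideal R} (h : IsNAbsorbing n I) (hnm : n ≤ m) :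
    IsNAbsorbing m I := by
  induction m, hnm using Nat.le_induction with
  | base => exact h
  | succ m _ ih => exact ih.succ

theorem IsNAbsorbing.exists_le_card_eq {n : ℕ} {I : Ideal R} (h : IsNAbsorbing n I)
    (s : Multiset R) (hs : n ≤ s.card) (hI : s.prod ∈ I) :
    ∃ u ≤ s, u.card = n ∧ u.prod ∈ I := by
  classical
  obtain ⟨k, hk⟩ := Nat.exists_eq_add_of_le hs
  induction k generalizing s with
  | zero => exact ⟨s, le_rfl, by simpa using hk, hI⟩
  | succ k ih =>
    obtain ⟨a, ha, haI⟩ := isNAbsorbing_iff_multiset.1 (h.mono (Nat.le_add_right n k)) s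
      (by omega) hI
    have hc : (s.erase a).card = n + k := by
      have := Multiset.card_erase_add_one ha
      omega
    obtain ⟨u, hu, hun, huI⟩ := ih (s.erase a) (by omega) haI hc
    exact ⟨u, hu.trans (Multiset.erase_le _ _), hun, huI⟩

/-- Some n factors already have product in I and some m factors have product in J. Their union
misses at least one of the n + m + 1 factors, and that one can be dropped. -/
theorem IsNAbsorbing.inf {n m : ℕ} {I J : Ideal R} (hI : IsNAbsorbing n I)
    (hJ : IsNAbsorbing m J) : IsNAbsorbing (n + m) (I ⊓ J) := by
  classical
  rw [isNAbsorbing_iff_multiset]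
  intro s hs hIJ
  obtain ⟨u, hu, huc, huI⟩ := hI.exists_le_card_eq s (by omega) hIJ.1
  obtain ⟨v, hv, hvc, hvJ⟩ := hJ.exists_le_card_eq s (by omega) hIJ.2
  have hlt : u ∪ v < s := by
    refine lt_of_le_of_ne (Multiset.union_le hu hv) fun h => ?_
    have := Multiset.card_le_card (Multiset.union_le_add u v)
    rw [h, Multiset.card_add] at this
    omega
  obtain ⟨a, ha⟩ := Multiset.lt_iff_cons_le.1 hlt
  have has : a ∈ s := Multiset.mem_of_le ha (Multiset.mem_cons_self _ _)
  have hle : u ∪ v ≤ s.erase a := by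
    rw [← Multiset.cons_le_cons_iff a, Multiset.cons_erase has]
    exact ha
  refine ⟨a, has, ?_, ?_⟩
  · exact I.mem_of_dvd (Multiset.prod_dvd_prod_of_le (Multiset.le_union_left.trans hle)) huI
  · exact J.mem_of_dvd (Multiset.prod_dvd_prod_of_le (Multiset.le_union_right.trans hle)) hvJ

theorem isNAbsorbing_top (n : ℕ) : IsNAbsorbing n (⊤ : Ideal R) := fun _ _ => ⟨0, trivial⟩

theorem IsNAbsorbing.pow_mem {n : ℕ} {I : Ideal R} (h : IsNAbsorbing n I) {x : R} {N : ℕ}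
    (hx : x ^ N ∈ I) : x ^ n ∈ I := by
  rcases le_total n N with hN | hN
  · obtain ⟨u, hu, huc, huI⟩ := h.exists_le_card_eq (Multiset.replicate N x) (by simpa)
      (by simpa using hx)
    obtain ⟨k, -, rfl⟩ := Multiset.le_replicate_iff.1 hu
    simp at huc
    simpa [huc] using huI
  · exact I.pow_mem_of_pow_mem hx hN

/-- Cancelling high powers of an element that is not nilpotent modulo an absorbing ideal. -/
theorem IsNAbsorbing.pow_pred_mul_mem {n : ℕ} {I : Ideal R} (h : IsNAbsorbing n I) {y t : R}
    (hy : y ^ n ∉ I) {k : ℕ} (hk : y ^ k * t ∈ I) : y ^ (n - 1) * t ∈ I := by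
  rcases lt_or_ge k n with hkn | hkn
  · obtain ⟨j, hj⟩ := Nat.exists_eq_add_of_le (show k ≤ n - 1 by omega)
    rw [hj, pow_add, mul_comm (y ^ k), mul_assoc]
    exact I.mul_mem_left _ hk
  · obtain ⟨u, hu, huc, huI⟩ := h.exists_le_card_eq (t ::ₘ Multiset.replicate k y) (by simp; omega)
      (by simpa [mul_comm] using hk)
    -- A subfamily without t would put y ^ n into I, so t occurs and is accompanied by n - 1 copies
    -- of y.
    by_cases ht : t ∈ u
    · obtain ⟨v, rfl⟩ := Multiset.exists_cons_of_mem ht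
      rw [Multiset.cons_le_cons_iff] at hu
      obtain ⟨j, -, rfl⟩ := Multiset.le_replicate_iff.1 hu
      simp only [Multiset.card_cons, Multiset.card_replicate] at huc
      simpa [← huc, mul_comm] using huI
    · obtain ⟨j, -, rfl⟩ := Multiset.le_replicate_iff.1 ((Multiset.le_cons_of_notMem ht).1 hu)
      simp only [Multiset.card_replicate] at huc
      subst huc
      exact absurd (by simpa using huI) hy

theorem IsPrimary.isNAbsorbing {Q : Ideal R} (hQ : Q.IsPrimary) {n : ℕ} (hn : Q.radical ^ n ≤ Q) :
    IsNAbsorbing n Q := by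
  classical
  rw [isNAbsorbing_iff_multiset]
  intro s hs hQs
  by_cases hall : ∀ a ∈ s, a ∈ Q.radical
  · obtain ⟨a, t, rfl, ht⟩ := multiset_exists_cons hs
    refine ⟨a, by simp, hn ?_⟩
    rw [Multiset.erase_cons_head, ← ht]
    exact multiset_prod_mem_pow fun x hx => hall x (Multiset.mem_cons_of_mem hx)
  · push Not at hall
    obtain ⟨a, ha, har⟩ := hall
    obtain ⟨t, rfl⟩ := Multiset.exists_cons_of_mem ha
    refine ⟨a, by simp, ?_⟩
    rw [Multiset.erase_cons_head]
    rw [Multiset.prod_cons, mul_comm] at hQs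
    exact ((Ideal.isPrimary_iff.1 hQ).2 hQs).resolve_right har

/-- **Choi–Walker**: an `n`-absorbing ideal contains the product of any `n` elements of its
radical. -/
theorem IsNAbsorbing.prod_mem_of_mem_radical {n : ℕ} {I : Ideal R} (h : IsNAbsorbing n I)
    {s : Multiset R} (hs : s.card = n) (hrad : ∀ a ∈ s, a ∈ I.radical) : s.prod ∈ I := by
  classical
  by_contra hsI
  obtain ⟨k, x, rfl⟩ : ∃ (k : ℕ) (x : Fin k → R), s = Finset.univ.val.map x := by
    induction s using Quotient.inductionOn with
    | h l => exact ⟨l.length, l.get, by simp [Fin.univ_val_map]⟩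
  have hfg : ∃ K, (Ideal.span (Set.range x)) ^ K ≤ I := by
    have hle : Ideal.span (Set.range x) ≤ I.radical := by
      rw [Ideal.span_le]
      rintro _ ⟨i, rfl⟩
      exact hrad _ (Multiset.mem_map_of_mem _ (Finset.mem_univ i))
    obtain ⟨K, hK⟩ := Ideal.exists_pow_le_of_le_radical_of_fg hle
      ((Submodule.fg_span (Set.finite_range x)))
    exact ⟨K, hK⟩
  obtain ⟨K, hK⟩ := hfg
  have hxs : ∀ i, x i ∈ Ideal.span (Set.range x) := fun i => Ideal.subset_span ⟨i, rfl⟩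
  -- The finitely generated ideal of the x i has a power inside I, so monomials outside I have
  -- bounded degree and the extremal choices below exist.
  have hbound : ∀ t : Multiset (Fin k), (t.map x).prod ∉ I → t.card ≤ K := by
    intro t ht
    by_contra hlt
    push Not at hlt
    refine ht (hK (Ideal.pow_le_pow_right hlt.le ?_))
    have := multiset_prod_mem_pow (P := Ideal.span (Set.range x)) (t := t.map x) (by simp [hxs])
    simpa using this
  -- the longest monomials outside `I`
  let p : ℕ → Prop := fun d => ∃ t : Multiset (Fin k), t.card = d ∧ (t.map x).prod ∉ I
  have hp : ∃ d, n ≤ d ∧ p d ∧ ∀ d', d < d' → ¬ p d' := by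
    have hpn : p n := ⟨Finset.univ.val, by simpa using hs, hsI⟩
    have hpK : ∀ d, p d → d ≤ K := by
      rintro _ ⟨t, rfl, ht⟩
      exact hbound t ht
    have hn := hpK n hpn
    refine ⟨Nat.findGreatest p K, Nat.le_findGreatest hn hpn, Nat.findGreatest_spec hn hpn, ?_⟩
    intro d' hd' hpd'
    exact absurd (Nat.le_findGreatest (hpK _ hpd') hpd') (by omega)
  obtain ⟨d, hnd, hpd, hmax⟩ := hp
  -- among these, one with the largest sum of indices
  let q : ℕ → Prop := fun w => ∃ t : Multiset (Fin k), t.card = d ∧ (t.map x).prod ∉ I ∧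
    (t.map Fin.val).sum = w
  have hq : ∃ w, q w ∧ ∀ w', w < w' → ¬ q w' := by
    obtain ⟨t, htd, htI⟩ := hpd
    have hqK : ∀ w, q w → w ≤ d * k := by
      rintro _ ⟨t, rfl, -, rfl⟩
      have := Multiset.sum_le_card_nsmul (t.map Fin.val) k (by
        intro y hy
        obtain ⟨i, -, rfl⟩ := Multiset.mem_map.1 hy
        exact i.2.le)
      simpa using this
    have hqt : q _ := ⟨t, htd, htI, rfl⟩
    refine ⟨Nat.findGreatest q (d * k), Nat.findGreatest_spec (hqK _ hqt) hqt, ?_⟩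
    intro w' hw' hqw'
    exact absurd (Nat.le_findGreatest (hqK _ hqw') hqw') (by omega)
  obtain ⟨w, ⟨t, htd, htI, htw⟩, hwmax⟩ := hq
  have hc : ∀ i, x i * (t.map x).prod ∈ I := by
    intro i
    by_contra hi
    exact hmax (d + 1) (by omega) ⟨i ::ₘ t, by simp [htd], by simpa using hi⟩
  have hswap : ∀ i ∈ t, ∀ j, i < j → x j * ((t.erase i).map x).prod ∈ I := by
    intro i hi j hij
    by_contra hj
    obtain ⟨v, rfl⟩ := Multiset.exists_cons_of_mem hi
    rw [Multiset.erase_cons_head] at hj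
    simp only [Multiset.map_cons, Multiset.sum_cons, Multiset.card_cons] at htw htd
    refine hwmax (j + (v.map Fin.val).sum) ?_ ⟨j ::ₘ v, by simp [htd], by simpa using hj, by simp⟩
    have : (i : ℕ) < j := hij
    omega
  have hself : ∀ i ∈ t, x i * ((t.erase i).map x).prod ∉ I := by
    intro i hi
    rw [← Multiset.prod_cons, ← Multiset.map_cons, Multiset.cons_erase hi]
    exact htI
  -- A sum y of certain x j is built index by index, so that y :: t violates absorption: x j is
  -- added exactly when the current y fails at j. By `hswap` this leaves smaller indices intact, and
  -- by `hself` it repairs j.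
  have hy : ∀ m ≤ k, ∃ y : R, y * (t.map x).prod ∈ I ∧
      ∀ i ∈ t, (i : ℕ) < m → y * ((t.erase i).map x).prod ∉ I := by
    intro m
    induction m with
    | zero => exact fun _ => ⟨0, by simp, by simp⟩
    | succ m ih =>
      intro hm
      obtain ⟨y, hyI, hy⟩ := ih (by omega)
      by_cases hgood : ∀ i ∈ t, (i : ℕ) = m → y * ((t.erase i).map x).prod ∉ I
      · refine ⟨y, hyI, fun i hi him => ?_⟩
        rcases Nat.lt_succ_iff_lt_or_eq.1 him with h1 | h1
        exacts [hy i hi h1, hgood i hi h1]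
      · push Not at hgood
        obtain ⟨j, hj, rfl, hjI⟩ := hgood
        refine ⟨y + x j, by rw [add_mul]; exact I.add_mem hyI (hc j), fun i hi him => ?_⟩
        rw [add_mul]
        rcases Nat.lt_succ_iff_lt_or_eq.1 him with h1 | h1
        · rw [I.add_mem_iff_left (hswap i hi j h1)]
          exact hy i hi h1
        · obtain rfl : i = j := Fin.ext h1
          rw [I.add_mem_iff_right hjI]
          exact hself i hi
  obtain ⟨y, hyI, hy⟩ := hy k le_rfl
  obtain ⟨a, ha, haI⟩ := isNAbsorbing_iff_multiset.1 (h.mono hnd) (y ::ₘ t.map x)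
    (by simp [htd]) (by simpa using hyI)
  by_cases hay : a = y
  · subst hay
    rw [Multiset.erase_cons_head] at haI
    exact htI haI
  · obtain ⟨i, hi, rfl⟩ := Multiset.mem_map.1 ((Multiset.mem_cons.1 ha).resolve_left hay)
    rw [Multiset.erase_cons_tail _ (Ne.symm hay), ← Multiset.map_erase_of_mem _ _ hi,
      Multiset.prod_cons] at haI
    exact hy i hi i.2 haI

/-- A power of an ideal is generated by products of its elements, which the Choi–Walker theorem
covers. Colon ideals peel off one factor at a time. -/
theorem IsNAbsorbing.radical_pow_le {n : ℕ} {I : Ideal R} (h : IsNAbsorbing n I) :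
    I.radical ^ n ≤ I := by
  have key : ∀ (m : ℕ) (J : Ideal R), (∀ s : Multiset R, s.card = m → (∀ a ∈ s, a ∈ I.radical) →
      s.prod ∈ J) → I.radical ^ m ≤ J := by
    intro m
    induction m with
    | zero => intro J hJ; simpa [Ideal.eq_top_iff_one] using hJ 0 rfl (by simp)
    | succ m ih =>
      intro J hJ
      rw [pow_succ', Ideal.mul_le]
      intro r hr z hz
      have : I.radical ^ m ≤ J.colon {r} := ih _ fun s hs hsr => by
        rw [Submodule.mem_colon_singleton, smul_eq_mul, mul_comm, ← Multiset.prod_cons]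
        exact hJ _ (by simp [hs]) (by
          intro a ha
          rcases Multiset.mem_cons.1 ha with rfl | ha
          exacts [hr, hsr a ha])
      have := this hz
      rwa [Submodule.mem_colon_singleton, smul_eq_mul, mul_comm] at this
  exact key n I fun s hs hsr => h.prod_mem_of_mem_radical hs hsr

end Absorbing

/-! ### Localization of absorbing properties, and local rings with absorbing factorizations -/

section AbsorbingRings

variable {R : Type*} [CommRing R]

theorem IsNAbsorbing.map_localization {n : ℕ} {I : Ideal R} (h : IsNAbsorbing n I)
    (M : Ideal R) [M.IsPrime] :
    IsNAbsorbing n (I.map (algebraMap R (Localization.AtPrime M))) := by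
  classical
  intro a ha
  choose r s hrs using fun i => IsLocalization.exists_mk'_eq M.primeCompl (a i)
  have hprod : ∀ t : Finset (Fin (n + 1)), ∏ i ∈ t, a i ∈ I.map (algebraMap R _) ↔
      ∃ u ∈ M.primeCompl, u * ∏ i ∈ t, r i ∈ I := by
    intro t
    rw [← IsLocalization.algebraMap_mem_map_algebraMap_iff M.primeCompl (Localization.AtPrime M),
      map_prod]
    have : ∏ i ∈ t, algebraMap R (Localization.AtPrime M) (r i) =
        (∏ i ∈ t, algebraMap R (Localization.AtPrime M) (s i)) * ∏ i ∈ t, a i := by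
      rw [← Finset.prod_mul_distrib]
      refine Finset.prod_congr rfl fun i _ => ?_
      rw [← hrs i, IsLocalization.mk'_spec']
    rw [this, Ideal.unit_mul_mem_iff_mem]
    rw [← map_prod]
    have h2 := IsLocalization.map_units (Localization.AtPrime M) (∏ i ∈ t, s i)
    rwa [Submonoid.coe_finsetProd] at h2
  obtain ⟨u, hu, hI⟩ := (hprod _).1 ha
  -- The cleared denominator u is absorbed into the factor of index 0, so that the number of factors
  -- stays n + 1.
  have hupd : ∀ t : Finset (Fin (n + 1)),
      ∏ i ∈ t, (if i = 0 then u * r i else r i) ∣ u * ∏ i ∈ t, r i := by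
    intro t
    by_cases h0 : 0 ∈ t
    · rw [← Finset.mul_prod_erase t _ h0, ← Finset.mul_prod_erase t r h0, if_pos rfl, ← mul_assoc]
      refine mul_dvd_mul_left _ (Finset.prod_dvd_prod_of_dvd _ _ fun i hi => ?_)
      rw [if_neg (Finset.ne_of_mem_erase hi)]
    · refine Dvd.dvd.mul_left (Finset.prod_dvd_prod_of_dvd _ _ fun i hi => ?_) u
      rw [if_neg (by rintro rfl; exact h0 hi)]
  obtain ⟨i, hi⟩ := h (fun i => if i = 0 then u * r i else r i) (by
    have : ∏ i, (if i = 0 then u * r i else r i) = u * ∏ i, r i := by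
      rw [← Finset.mul_prod_erase Finset.univ _ (Finset.mem_univ 0),
        ← Finset.mul_prod_erase Finset.univ r (Finset.mem_univ 0), if_pos rfl, ← mul_assoc]
      congr 1
      exact Finset.prod_congr rfl fun i hi => if_neg (Finset.ne_of_mem_erase hi)
    rwa [this])
  exact ⟨i, (hprod _).2 ⟨u, hu, I.mem_of_dvd (hupd _) hi⟩⟩

theorem IsFiniteAbsorbing.localization (h : IsFiniteAbsorbing R) (M : Ideal R) [M.IsPrime] :
    IsFiniteAbsorbing (Localization.AtPrime M) := by
  intro I hI
  have hmap := IsLocalization.map_under M.primeCompl (Localization.AtPrime M) I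
  obtain ⟨n, hn, hJ⟩ := h (I.under R) (Ideal.comap_ne_top _ hI)
  exact ⟨n, hn, hmap ▸ hJ.map_localization M⟩

theorem ProperIdealsFactor.localization {n : ℕ} (h : ProperIdealsFactor R (IsNAbsorbing n))
    (M : Ideal R) [M.IsPrime] :
    ProperIdealsFactor (Localization.AtPrime M) (IsNAbsorbing n) := by
  intro I hI
  have hmap := IsLocalization.map_under M.primeCompl (Localization.AtPrime M) I
  obtain ⟨s, hs, hsI⟩ := h (I.under R) (Ideal.comap_ne_top _ hI)
  refine ⟨s.map (Ideal.map (algebraMap R _)), ?_, ?_⟩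
  · intro J hJ
    obtain ⟨J, hJs, rfl⟩ := Multiset.mem_map.1 hJ
    exact (hs J hJs).map_localization M
  · rw [← hmap, ← hsI]
    exact (map_multiset_prod (Ideal.mapHom (algebraMap R (Localization.AtPrime M))) s).symm

theorem IsStronglyLaskerian.isFiniteAbsorbing (h : IsStronglyLaskerian R) :
    IsFiniteAbsorbing R := by
  intro I hI
  obtain ⟨s, rfl, hs⟩ := h.1 I
  have key : ∀ t ⊆ s, ∃ n, IsNAbsorbing n (t.inf id) := by
    intro t
    classical
    induction t using Finset.induction_on with
    | empty => exact fun _ => ⟨0, isNAbsorbing_top 0⟩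
    | insert J t _ ih =>
      intro hts
      obtain ⟨n, hn⟩ := ih fun x hx => hts (Finset.mem_insert_of_mem hx)
      have hJ : J.IsPrimary := hs (hts (Finset.mem_insert_self J t))
      obtain ⟨m, hm⟩ := h.2 J hJ
      rw [Finset.inf_insert]
      exact ⟨m + n, (IsPrimary.isNAbsorbing hJ hm).inf hn⟩
  obtain ⟨n, hn⟩ := key s subset_rfl
  exact ⟨n + 1, n.succ_pos, hn.succ⟩

/-- In a divided ring each element of a prime ideal is divisible by each element outside, with a
quotient in the prime ideal. -/
theorem IsDividedRing.exists_eq_mul (h : IsDividedRing R) {P : Ideal R} (hP : P.IsPrime) {a p : R}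
    (ha : a ∉ P) (hp : p ∈ P) : ∃ q ∈ P, p = a * q := by
  obtain ⟨q, rfl⟩ := Ideal.mem_span_singleton.1 ((h P hP a ha).le hp)
  exact ⟨q, (hP.mem_or_mem hp).resolve_left ha, rfl⟩

theorem IsDividedRing.exists_eq_pow_mul (h : IsDividedRing R) {P : Ideal R} (hP : P.IsPrime)
    {a p : R} (ha : a ∉ P) (hp : p ∈ P) (n : ℕ) : ∃ q ∈ P, p = a ^ n * q :=
  h.exists_eq_mul hP (fun h => ha (hP.mem_of_pow_mem n h)) hp

/-- For p ∈ P and a nonunit a ∉ P, let (pa) be n-absorbing and write p = a ^ (n - 1) * q by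
dividedness. Then a ^ n * q = pa lies in (pa), and cancelling a power of a gives p ∈ (pa). Since 1 -
ac is a unit, p = 0. -/
theorem IsFiniteAbsorbing.eq_bot_of_isDividedRing [IsLocalRing R] (h : IsFiniteAbsorbing R)
    (hd : IsDividedRing R) {P : Ideal R} (hP : P.IsPrime)
    (hlt : P < IsLocalRing.maximalIdeal R) : P = ⊥ := by
  rw [eq_bot_iff]
  intro p hp
  obtain ⟨a, ham, haP⟩ := SetLike.exists_of_lt hlt
  have hne : Ideal.span {p * a} ≠ ⊤ := by
    intro htop
    have : Ideal.span {p * a} ≤ P := by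
      rw [Ideal.span_singleton_le_iff_mem]
      exact P.mul_mem_right _ hp
    exact hP.ne_top (top_le_iff.1 (htop ▸ this))
  obtain ⟨n, hn, habs⟩ := h _ hne
  have hle : Ideal.span {p * a} ≤ P := by
    rw [Ideal.span_singleton_le_iff_mem]
    exact P.mul_mem_right _ hp
  obtain ⟨q, hq, hpq⟩ := hd.exists_eq_pow_mul hP haP hp (n - 1)
  have hmem : a ^ n * q ∈ Ideal.span {p * a} := by
    rw [Ideal.mem_span_singleton, hpq]
    obtain ⟨n, rfl⟩ := Nat.exists_eq_succ_of_ne_zero hn.ne'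
    exact ⟨1, by simp [pow_succ]; ring⟩
  have hp' := habs.pow_pred_mul_mem (fun hmem => haP (hP.mem_of_pow_mem n (hle hmem))) hmem
  rw [← hpq, Ideal.mem_span_singleton] at hp'
  obtain ⟨c, hc⟩ := hp'
  have hunit : IsUnit (1 - a * c) := by
    rw [← not_not (a := IsUnit _), ← mem_nonunits_iff, ← IsLocalRing.mem_maximalIdeal]
    intro hmem
    exact (Ideal.ne_top_iff_one _).1 (IsLocalRing.maximalIdeal.isMaximal R).ne_top
      (by simpa using Ideal.add_mem _ hmem (Ideal.mul_mem_right c _ ham))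
  rw [Ideal.mem_bot, ← hunit.mul_left_eq_zero, mul_sub, mul_one, ← mul_assoc, ← hc, sub_self]

/-- The factors of s are multiplied onto K one by one. J is the first partial product that loses y ^
e; as the preceding one contained it, J still contains y ^ (e + n). -/
theorem exists_mul_eq_mul_prod {n e : ℕ} {y : R} (s : Multiset (Ideal R))
    (hs : ∀ J ∈ s, y ^ n ∈ J) (K : Ideal R) (hK : y ^ e ∈ K) (hKs : y ^ e ∉ K * s.prod) :
    ∃ J J' : Ideal R, J * J' = K * s.prod ∧ y ^ e ∉ J ∧ y ^ (e + n) ∈ J := by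
  induction s using Multiset.induction_on generalizing K with
  | empty => simp [hK] at hKs
  | cons a s ih =>
    rw [Multiset.prod_cons, ← mul_assoc] at hKs ⊢
    by_cases ha : y ^ e ∈ K * a
    · exact ih (fun J hJ => hs J (Multiset.mem_cons_of_mem hJ)) _ ha hKs
    · refine ⟨_, _, rfl, ha, ?_⟩
      rw [pow_add]
      exact Ideal.mul_mem_mul hK (hs a (Multiset.mem_cons_self a s))

/-- Here k counts the proper factors. -/
theorem exists_pow_mem_prod_le [IsLocalRing R] {n : ℕ} {y : R} (s : Multiset (Ideal R))
    (hs : ∀ J ∈ s, y ^ n ∈ J) :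
    ∃ k, s.prod ≤ IsLocalRing.maximalIdeal R ^ k ∧ y ^ (n * k) ∈ s.prod := by
  induction s using Multiset.induction_on with
  | empty => exact ⟨0, by simp⟩
  | cons a s ih =>
    obtain ⟨k, hk, hy⟩ := ih fun J hJ => hs J (Multiset.mem_cons_of_mem hJ)
    rw [Multiset.prod_cons]
    by_cases ha : a = ⊤
    · exact ⟨k, by simpa [ha, Ideal.top_mul] using hk, by simpa [ha, Ideal.top_mul] using hy⟩
    · refine ⟨k + 1, ?_, ?_⟩
      · rw [pow_succ']
        exact Ideal.mul_mono (IsLocalRing.le_maximalIdeal ha) hk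
      · rw [mul_add, mul_one, pow_add, mul_comm (y ^ (n * k))]
        exact Ideal.mul_mem_mul (hs a (Multiset.mem_cons_self a s)) hy

theorem IsLocalRing.isUnit_one_sub [IsLocalRing R] {a : R} (ha : a ∈ IsLocalRing.maximalIdeal R) :
    IsUnit (1 - a) := by
  rw [← not_not (a := IsUnit _), ← mem_nonunits_iff, ← IsLocalRing.mem_maximalIdeal]
  intro hmem
  exact (Ideal.ne_top_iff_one _).1 (IsLocalRing.maximalIdeal.isMaximal R).ne_top
    (by simpa using Ideal.add_mem _ hmem ha)

/-- In a local ring, modulo an element `f` of a prime ideal `P` no power `y ^ k` with `y ∉ P` lies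
in the ideal generated by higher powers of `y`. -/
theorem pow_notMem_span_pair [IsLocalRing R] {P : Ideal R} (hP : P.IsPrime) {f y : R}
    (hf : f ∈ P) (hy : y ∈ IsLocalRing.maximalIdeal R) (hyP : y ∉ P) {k N : ℕ} (hk : k < N) :
    y ^ k ∉ Ideal.span {f, y ^ N} := by
  intro hmem
  obtain ⟨a, b, hab⟩ := Ideal.mem_span_pair.1 hmem
  obtain ⟨j, rfl⟩ := Nat.exists_eq_add_of_lt hk
  have h1 : y ^ k * (1 - y * (b * y ^ j)) ∈ P := by
    have : y ^ k * (1 - y * (b * y ^ j)) = a * f := by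
      linear_combination (-1 : R) * hab
    rw [this]
    exact P.mul_mem_left _ hf
  have hu := IsLocalRing.isUnit_one_sub (Ideal.mul_mem_right (b * y ^ j) _ hy)
  rw [mul_comm, Ideal.unit_mul_mem_iff_mem _ hu] at h1
  exact hyP (hP.mem_of_pow_mem k h1)

theorem span_pair_pow_ne_top [IsLocalRing R] {P : Ideal R} (hP : P.IsPrime) {f y : R}
    (hf : f ∈ P) (hy : y ∈ IsLocalRing.maximalIdeal R) {N : ℕ} (hN : 0 < N) :
    Ideal.span {f, y ^ N} ≠ ⊤ := by
  intro htop
  have : Ideal.span {f, y ^ N} ≤ IsLocalRing.maximalIdeal R := by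
    rw [Ideal.span_le]
    rintro x (rfl | rfl)
    · exact IsLocalRing.le_maximalIdeal hP.ne_top hf
    · exact Ideal.pow_mem_of_mem _ hy N hN
  exact (IsLocalRing.maximalIdeal.isMaximal R).ne_top (top_le_iff.1 (htop ▸ this))

/-- Factor (f, y ^ N) with f ∈ P, y ∉ P and N = n * r + 1. Each factor contains y ^ n, so k proper
factors put y ^ (n * k) into the ideal. No power of y below y ^ N lies there, which makes k large,
while f is in the k-th power of the maximal ideal. -/
theorem ProperIdealsFactor.le_maximalIdeal_pow [IsLocalRing R] {n : ℕ}
    (hF : ProperIdealsFactor R (IsNAbsorbing n)) {P : Ideal R} (hP : P.IsPrime)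
    (hlt : P < IsLocalRing.maximalIdeal R) (r : ℕ) : P ≤ IsLocalRing.maximalIdeal R ^ r := by
  intro f hf
  obtain ⟨y, hym, hyP⟩ := SetLike.exists_of_lt hlt
  obtain ⟨s, hs, hsI⟩ := hF _ (span_pair_pow_ne_top hP hf hym (N := n * r + 1) (by omega))
  have hle : ∀ J ∈ s, Ideal.span {f, y ^ (n * r + 1)} ≤ J := fun J hJ =>
    hsI ▸ Ideal.le_of_dvd (Multiset.dvd_prod hJ)
  have hys : ∀ J ∈ s, y ^ n ∈ J := fun J hJ =>
    (hs J hJ).pow_mem (N := n * r + 1) (hle J hJ (Ideal.subset_span (by simp)))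
  obtain ⟨k, hk, hyk⟩ := exists_pow_mem_prod_le s hys
  rw [hsI] at hk hyk
  have hrk : r ≤ k := by
    by_contra hlt
    push Not at hlt
    have := Nat.mul_le_mul_left n hlt.le
    exact pow_notMem_span_pair hP hf hym hyP (by omega) hyk
  exact Ideal.pow_le_pow_right hrk (hk (Ideal.subset_span (by simp)))

/-- Suppose (f) were absorbing; then powers of y could be cancelled modulo f down to y ^ m, m = n -
1. A factorization (f, y ^ N) = J * J' with y ^ (2 * m) ∉ J is contradicted by dividing a relation
for y ^ m * f by the regular element f. -/
theorem ProperIdealsFactor.not_isNAbsorbing_span_singleton [IsLocalRing R] {n : ℕ} (hn : 0 < n)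
    (hF : ProperIdealsFactor R (IsNAbsorbing n)) {P : Ideal R} (hP : P.IsPrime)
    (hlt : P < IsLocalRing.maximalIdeal R) {f : R} (hf : f ∈ P) (hreg : f ∈ nonZeroDivisors R) :
    ¬ IsNAbsorbing n (Ideal.span {f}) := by
  intro habs
  obtain ⟨y, hym, hyP⟩ := SetLike.exists_of_lt hlt
  obtain ⟨m, rfl⟩ : ∃ m, n = m + 1 := ⟨n - 1, by omega⟩
  have hfP : Ideal.span {f} ≤ P := by rwa [Ideal.span_singleton_le_iff_mem]
  have hcancel : ∀ {k : ℕ} {t : R}, y ^ k * t ∈ Ideal.span {f} → y ^ m * t ∈ Ideal.span {f} :=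
    fun h => habs.pow_pred_mul_mem (fun hmem => hyP (hP.mem_of_pow_mem _ (hfP hmem))) h
  -- J will contain y ^ (3 * m + 1). Taking this out of y ^ N leaves y ^ (m + 3), which after
  -- multiplication by y ^ m still lies in (y ^ (2 * m + 1)).
  set N := 4 * m + 4 with hN
  obtain ⟨s, hs, hsI⟩ := hF _ (span_pair_pow_ne_top hP hf hym (N := N) (by omega))
  have hle : ∀ J ∈ s, Ideal.span {f, y ^ N} ≤ J := fun J hJ =>
    hsI ▸ Ideal.le_of_dvd (Multiset.dvd_prod hJ)
  have hys : ∀ J ∈ s, y ^ (m + 1) ∈ J := fun J hJ =>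
    (hs J hJ).pow_mem (N := N) (hle J hJ (Ideal.subset_span (by simp)))
  obtain ⟨J, J', hJJ, hyJ, hyJ'⟩ := exists_mul_eq_mul_prod (e := 2 * m) s hys ⊤ trivial
    (by rw [Ideal.top_mul, hsI]; exact pow_notMem_span_pair hP hf hym hyP (by omega))
  rw [Ideal.top_mul, hsI] at hJJ
  have hJ' : ∀ z ∈ J', y ^ m * z ∈ Ideal.span {f} ⊔ Ideal.span {y ^ (2 * m + 1)} := by
    intro z hz
    have h1 : y ^ (2 * m + (m + 1)) * z ∈ Ideal.span {f, y ^ N} := hJJ ▸ Ideal.mul_mem_mul hyJ' hz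
    obtain ⟨c, d, hcd⟩ := Ideal.mem_span_pair.1 h1
    have h2 : y ^ (2 * m + (m + 1)) * (z - d * y ^ (m + 3)) ∈ Ideal.span {f} :=
      Ideal.mem_span_singleton'.2 ⟨c, by rw [mul_sub, ← hcd, hN]; ring⟩
    have h3 := Ideal.mem_sup_left (T := Ideal.span {y ^ (2 * m + 1)}) (hcancel h2)
    have h4 : d * y ^ 2 * y ^ (2 * m + 1) ∈ Ideal.span {f} ⊔ Ideal.span {y ^ (2 * m + 1)} :=
      Ideal.mem_sup_right (Ideal.mul_mem_left _ _ (Ideal.mem_span_singleton_self _))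
    convert Ideal.add_mem _ h3 h4 using 1
    ring
  have hmul : y ^ m * f ∈ J * (Ideal.span {f} ⊔ Ideal.span {y ^ (2 * m + 1)}) := by
    have hfJ : f ∈ J * J' := hJJ ▸ Ideal.subset_span (by simp)
    have : J * J' ≤ (J * (Ideal.span {f} ⊔ Ideal.span {y ^ (2 * m + 1)})).colon {y ^ m} := by
      rw [Ideal.mul_le]
      intro r hr z hz
      rw [Submodule.mem_colon_singleton, smul_eq_mul, mul_assoc, mul_comm z]
      exact Ideal.mul_mem_mul hr (hJ' z hz)
    have := this hfJ
    rwa [Submodule.mem_colon_singleton, smul_eq_mul, mul_comm f] at this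
  rw [Ideal.mul_sup, Submodule.mem_sup] at hmul
  obtain ⟨u, hu, v, hv, huv⟩ := hmul
  obtain ⟨j, hj, rfl⟩ := Ideal.mem_mul_span_singleton.1 hu
  obtain ⟨t, -, rfl⟩ := Ideal.mem_mul_span_singleton.1 hv
  obtain ⟨w, hw⟩ := Ideal.mem_span_singleton.1 (hcancel (k := 2 * m + 1) (t := t)
    (Ideal.mem_span_singleton.2 ⟨y ^ m - j, by linear_combination huv⟩))
  -- The relation y ^ m * f = j * f + t * y ^ (2 * m + 1), multiplied by y ^ m, becomes divisible by
  -- f because y ^ m * t = f * w.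
  have hfinal : y ^ (2 * m) = y ^ m * j + y ^ (2 * m + 1) * w := by
    rw [← sub_eq_zero]
    refine mul_left_mem_nonZeroDivisors_eq_zero_iff hreg |>.1 ?_
    linear_combination (-y ^ m) * huv + y ^ (2 * m + 1) * hw
  have hmem : (1 - y * w) * y ^ (2 * m) ∈ J := by
    have : (1 - y * w) * y ^ (2 * m) = y ^ m * j := by linear_combination hfinal
    rw [this]
    exact J.mul_mem_left _ hj
  rw [Ideal.unit_mul_mem_iff_mem _ (IsLocalRing.isUnit_one_sub (Ideal.mul_mem_right w _ hym))]
    at hmem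
  exact hyJ hmem

/-- A factor of a principal ideal generated by a nonzerodivisor of a local ring is of the same
kind. -/
theorem exists_eq_span_singleton_of_mul_eq [IsLocalRing R] {x : R} (hx : x ∈ nonZeroDivisors R)
    {J J' : Ideal R} (h : J * J' = Ideal.span {x}) :
    ∃ f ∈ nonZeroDivisors R, J = Ideal.span {f} := by
  have hex : ∃ a ∈ J, ∃ b ∈ J', ∃ u, IsUnit u ∧ a * b = x * u := by
    by_contra hno
    push Not at hno
    -- If no product of elements of J and J' is a unit times x, then x lies in x times the maximal
    -- ideal; cancelling x puts 1 there.
    have hle : J * J' ≤ Ideal.span {x} * IsLocalRing.maximalIdeal R := by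
      rw [Ideal.mul_le]
      intro a ha b hb
      obtain ⟨c, hc⟩ := Ideal.mem_span_singleton.1 (h ▸ Ideal.mul_mem_mul ha hb)
      rw [hc]
      refine Ideal.mul_mem_mul (Ideal.mem_span_singleton_self x) ?_
      rw [IsLocalRing.mem_maximalIdeal, mem_nonunits_iff]
      exact fun hu => hno a ha b hb c hu hc
    have hxm := hle (h ▸ Ideal.mem_span_singleton_self x)
    obtain ⟨c, hc, hcx⟩ := Ideal.mem_span_singleton_mul.1 hxm
    have : x * (1 - c) = 0 := by rw [mul_sub, hcx, mul_one, sub_self]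
    have h1 := (mul_left_mem_nonZeroDivisors_eq_zero_iff hx).1 this
    rw [sub_eq_zero] at h1
    subst h1
    exact (Ideal.ne_top_iff_one _).1 (IsLocalRing.maximalIdeal.isMaximal R).ne_top hc
  obtain ⟨a, ha, b, hb, u, hu, hab⟩ := hex
  have hreg : a * b ∈ nonZeroDivisors R := hab ▸ mul_mem hx hu.mem_nonZeroDivisors
  have hregab := mul_mem_nonZeroDivisors.1 hreg
  refine ⟨a, hregab.1, le_antisymm (fun j hj => ?_) (by rwa [Ideal.span_singleton_le_iff_mem])⟩
  obtain ⟨c, hc⟩ := Ideal.mem_span_singleton.1 (h ▸ Ideal.mul_mem_mul hj hb)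
  obtain ⟨v, hv⟩ := hu.exists_right_inv
  refine Ideal.mem_span_singleton.2 ⟨v * c, ?_⟩
  rw [← sub_eq_zero]
  refine mul_right_mem_nonZeroDivisors_eq_zero_iff hregab.2 |>.1 ?_
  linear_combination hc - v * c * hab - x * c * hv

/-- Some absorbing factor of (x) lies in P, and it is itself principal with a regular generator.
Such an ideal cannot exist inside a nonmaximal prime. -/
theorem ProperIdealsFactor.eq_maximalIdeal_of_mem_nonZeroDivisors [IsLocalRing R] {n : ℕ}
    (hn : 0 < n) (hF : ProperIdealsFactor R (IsNAbsorbing n)) {P : Ideal R} (hP : P.IsPrime)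
    {x : R} (hx : x ∈ P) (hreg : x ∈ nonZeroDivisors R) : P = IsLocalRing.maximalIdeal R := by
  by_contra hne
  have hlt : P < IsLocalRing.maximalIdeal R :=
    lt_of_le_of_ne (IsLocalRing.le_maximalIdeal hP.ne_top) hne
  have hxP : Ideal.span {x} ≤ P := by rwa [Ideal.span_singleton_le_iff_mem]
  obtain ⟨s, hs, hsx⟩ := hF (Ideal.span {x}) fun h => hP.ne_top (top_le_iff.1 (h ▸ hxP))
  obtain ⟨J, hJs, hJP⟩ := (hP.multiset_prod_le).1 (hsx ▸ hxP)
  obtain ⟨t, rfl⟩ := Multiset.exists_cons_of_mem hJs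
  rw [Multiset.prod_cons] at hsx
  obtain ⟨f, hf, rfl⟩ := exists_eq_span_singleton_of_mul_eq hreg hsx
  exact hF.not_isNAbsorbing_span_singleton hn hP hlt
    (hJP (Ideal.mem_span_singleton_self f)) hf (hs _ hJs)

/-- The maximal ideal is the only prime over x, so by Choi–Walker its n-th power lies in every
factor of (x). -/
theorem ProperIdealsFactor.exists_maximalIdeal_pow_le [IsLocalRing R] {n : ℕ}
    (hn : 0 < n) (hF : ProperIdealsFactor R (IsNAbsorbing n)) {x : R}
    (hx : x ∈ IsLocalRing.maximalIdeal R) (hreg : x ∈ nonZeroDivisors R) :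
    ∃ k, IsLocalRing.maximalIdeal R ^ k ≤ Ideal.span {x} := by
  have hxm : Ideal.span {x} ≤ IsLocalRing.maximalIdeal R := by
    rwa [Ideal.span_singleton_le_iff_mem]
  obtain ⟨s, hs, hsx⟩ := hF (Ideal.span {x}) fun h =>
    (IsLocalRing.maximalIdeal.isMaximal R).ne_top (top_le_iff.1 (h ▸ hxm))
  have hrad : IsLocalRing.maximalIdeal R ≤ (Ideal.span {x}).radical := by
    rw [Ideal.radical_eq_sInf]
    refine le_sInf fun P hP => ?_
    exact (hF.eq_maximalIdeal_of_mem_nonZeroDivisors hn hP.2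
      (hP.1 (Ideal.mem_span_singleton_self x)) hreg).ge
  have hJ : ∀ J ∈ s, IsLocalRing.maximalIdeal R ^ n ≤ J := fun J hJ =>
    (Ideal.pow_right_mono (hrad.trans (Ideal.radical_mono
      (hsx ▸ Ideal.le_of_dvd (Multiset.dvd_prod hJ)))) n).trans (hs J hJ).radical_pow_le
  rw [← hsx]
  clear hsx hs
  induction s using Multiset.induction_on with
  | empty => exact ⟨0, by simp⟩
  | cons a s ih =>
    obtain ⟨k, hk⟩ := ih fun J hJs => hJ J (Multiset.mem_cons_of_mem hJs)
    refine ⟨n + k, ?_⟩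
    rw [Multiset.prod_cons, pow_add]
    exact Ideal.mul_mono (hJ a (Multiset.mem_cons_self a s)) hk

theorem ProperIdealsFactor.prime_le_span_pow [IsLocalRing R] {n : ℕ}
    (hn : 0 < n) (hF : ProperIdealsFactor R (IsNAbsorbing n)) {P : Ideal R} (hP : P.IsPrime)
    (hlt : P < IsLocalRing.maximalIdeal R) {x : R} (hx : x ∈ IsLocalRing.maximalIdeal R)
    (hreg : x ∈ nonZeroDivisors R) (r : ℕ) : P ≤ Ideal.span {x ^ r} := by
  obtain ⟨k, hk⟩ := hF.exists_maximalIdeal_pow_le hn hx hreg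
  refine (hF.le_maximalIdeal_pow hP hlt (k * r)).trans ?_
  rw [pow_mul, ← Ideal.span_singleton_pow]
  exact Ideal.pow_right_mono hk r

end AbsorbingRings

/-! ### Ideals of A + XB[X]: those over X and those contracted from B[X] -/

section Structure

variable {B : Type*} [CommRing B] (A : Subring B)

theorem mem_subringAddXMul {f : B[X]} : f ∈ subringAddXMul A ↔ f.coeff 0 ∈ A := Iff.rfl

/-- The constant coefficient `A + X B[X] → A`. -/
noncomputable def constHom : subringAddXMul A →+* A :=
  ((Polynomial.constantCoeff).comp (subringAddXMul A).subtype).codRestrict A fun f => f.2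

@[simp] theorem coe_constHom (f : subringAddXMul A) : (constHom A f : B) = (f : B[X]).coeff 0 := rfl

/-- The constants of `A + X B[X]`. -/
noncomputable def ofConst : A →+* subringAddXMul A :=
  ((C : B →+* B[X]).comp A.subtype).codRestrict (subringAddXMul A) fun a => by
    simp [mem_subringAddXMul]

@[simp] theorem coe_ofConst (a : A) : (ofConst A a : B[X]) = C (a : B) := rfl

@[simp] theorem constHom_ofConst (a : A) : constHom A (ofConst A a) = a := Subtype.ext (by simp)

theorem constHom_surjective : Function.Surjective (constHom A) :=
  fun a => ⟨ofConst A a, constHom_ofConst A a⟩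

/-- The element `X g` of `A + X B[X]`. -/
noncomputable def mulX (g : B[X]) : subringAddXMul A := ⟨X * g, by simp [mem_subringAddXMul]⟩

@[simp] theorem coe_mulX (g : B[X]) : (mulX A g : B[X]) = X * g := rfl

theorem mulX_mul (f g : B[X]) : mulX A f * mulX A g = mulX A (X * (f * g)) :=
  Subtype.ext (by simp; ring)

theorem mulX_one_mul (f : subringAddXMul A) : mulX A 1 * f = mulX A f := Subtype.ext (by simp)

theorem mulX_coe_mul (f : subringAddXMul A) (g : B[X]) : f * mulX A g = mulX A (f * g) :=
  Subtype.ext (by simp; ring)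

theorem mulX_add (f g : B[X]) : mulX A (f + g) = mulX A f + mulX A g :=
  Subtype.ext (by simp; ring)

theorem constHom_mulX (g : B[X]) : constHom A (mulX A g) = 0 := Subtype.ext (by simp)

theorem exists_eq_ofConst_add_mulX (f : subringAddXMul A) :
    ∃ g, f = ofConst A (constHom A f) + mulX A g :=
  ⟨(f : B[X]).divX, Subtype.ext (by simp [add_comm, X_mul_divX_add])⟩

theorem mulX_one_mem_nonZeroDivisors : mulX A 1 ∈ nonZeroDivisors (subringAddXMul A) := by
  rw [mem_nonZeroDivisors_iff_left]
  intro f hf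
  have : X * (f : B[X]) = 0 := by simpa using congrArg Subtype.val hf
  exact Subtype.ext (by simpa using this)

theorem mulX_mem_of_mulX_one_mem {P : Ideal (subringAddXMul A)} (hP : P.IsPrime)
    (hX : mulX A 1 ∈ P) (g : B[X]) : mulX A g ∈ P := by
  refine hP.mem_of_pow_mem 2 ?_
  have : mulX A g ^ 2 = mulX A 1 * mulX A (g * g) := Subtype.ext (by simp; ring)
  rw [this]
  exact P.mul_mem_right _ hX

/-- The ideal `P + X B[X]`. -/
noncomputable def overIdeal (P : Ideal A) : Ideal (subringAddXMul A) := P.comap (constHom A)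

theorem mem_overIdeal {P : Ideal A} {f : subringAddXMul A} :
    f ∈ overIdeal A P ↔ constHom A f ∈ P := Iff.rfl

theorem mulX_mem_overIdeal (P : Ideal A) (g : B[X]) : mulX A g ∈ overIdeal A P := by
  rw [mem_overIdeal, constHom_mulX]
  exact P.zero_mem

instance overIdeal_isPrime (P : Ideal A) [P.IsPrime] : (overIdeal A P).IsPrime :=
  Ideal.comap_isPrime _ _

instance overIdeal_isMaximal (P : Ideal A) [P.IsMaximal] : (overIdeal A P).IsMaximal :=
  Ideal.comap_isMaximal_of_surjective _ (constHom_surjective A)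

theorem overIdeal_lt_iff {P Q : Ideal A} : overIdeal A P < overIdeal A Q ↔ P < Q := by
  rw [lt_iff_le_not_ge, lt_iff_le_not_ge]
  simp only [overIdeal, Ideal.comap_le_comap_iff_of_surjective _ (constHom_surjective A)]

theorem overIdeal_le_iff {P Q : Ideal A} : overIdeal A P ≤ overIdeal A Q ↔ P ≤ Q := by
  simp only [overIdeal, Ideal.comap_le_comap_iff_of_surjective _ (constHom_surjective A)]

theorem eq_overIdeal {P : Ideal (subringAddXMul A)} (hX : ∀ g, mulX A g ∈ P) :
    P = overIdeal A (P.comap (ofConst A)) := by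
  ext f
  obtain ⟨g, hg⟩ := exists_eq_ofConst_add_mulX A f
  rw [mem_overIdeal, Ideal.mem_comap]
  nth_rw 1 [hg]
  exact P.add_mem_iff_left (hX g)

/-- The ideal of all polynomials of `A + X B[X]` with coefficients in `Q`. -/
noncomputable def starIdeal (Q : Ideal B) : Ideal (subringAddXMul A) :=
  (Q.map C).comap (subringAddXMul A).subtype

theorem mem_starIdeal {Q : Ideal B} {f : subringAddXMul A} :
    f ∈ starIdeal A Q ↔ ∀ i, (f : B[X]).coeff i ∈ Q := by
  simp [starIdeal, Ideal.mem_map_C_iff]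

instance starIdeal_isPrime (Q : Ideal B) [Q.IsPrime] : (starIdeal A Q).IsPrime := by
  have : (Q.map C).IsPrime := Ideal.isPrime_map_C_of_isPrime
  exact Ideal.comap_isPrime _ _

theorem mulX_C_mem_starIdeal {Q : Ideal B} {b : B} : mulX A (C b) ∈ starIdeal A Q ↔ b ∈ Q := by
  rw [mem_starIdeal]
  refine ⟨fun h => by simpa using h 1, fun h i => ?_⟩
  rw [coe_mulX, mul_comm, C_mul_X_eq_monomial, coeff_monomial]
  split_ifs
  exacts [h, Q.zero_mem]

theorem mulX_one_notMem_starIdeal {Q : Ideal B} (hQ : Q ≠ ⊤) : mulX A 1 ∉ starIdeal A Q := by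
  rw [← C_1, mulX_C_mem_starIdeal]
  exact (Ideal.ne_top_iff_one Q).1 hQ

theorem starIdeal_le_overIdeal (Q : Ideal B) : starIdeal A Q ≤ overIdeal A (Q.comap A.subtype) :=
  fun _ hf => (mem_starIdeal A).1 hf 0

theorem starIdeal_le_iff {P Q : Ideal B} : starIdeal A P ≤ starIdeal A Q ↔ P ≤ Q := by
  refine ⟨fun h b hb => ?_, fun h f hf => ?_⟩
  · exact (mulX_C_mem_starIdeal A).1 (h ((mulX_C_mem_starIdeal A).2 hb))
  · rw [mem_starIdeal] at hf ⊢
    exact fun i => h (hf i)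

theorem starIdeal_lt_overIdeal {Q : Ideal B} (hQ : Q ≠ ⊤) :
    starIdeal A Q < overIdeal A (Q.comap A.subtype) :=
  lt_of_le_not_ge (starIdeal_le_overIdeal A Q) fun h =>
    mulX_one_notMem_starIdeal A hQ (h (mulX_mem_overIdeal A _ _))

/-- The largest ideal of `B[X]` whose product with `X` lies in `Q`. -/
noncomputable def lowIdeal (Q : Ideal (subringAddXMul A)) : Ideal B[X] where
  carrier := {f | ∀ g, mulX A (g * f) ∈ Q}
  zero_mem' g := by
    have : mulX A (g * 0) = 0 := Subtype.ext (by simp)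
    rw [this]
    exact Q.zero_mem
  add_mem' {a b} ha hb g := by
    rw [mul_add, mulX_add]
    exact Q.add_mem (ha g) (hb g)
  smul_mem' c f hf g := by
    rw [smul_eq_mul, ← mul_assoc]
    exact hf (g * c)

/-- The factor g in the definition makes `lowIdeal` an ideal of B[X]. For a primary ideal whose
radical misses X it is redundant, as X can be cancelled. -/
theorem mem_lowIdeal_iff {Q : Ideal (subringAddXMul A)} (hQ : Q.IsPrimary)
    (hX : mulX A 1 ∉ Q.radical) {f : B[X]} : f ∈ lowIdeal A Q ↔ mulX A f ∈ Q := by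
  refine ⟨fun h => by simpa using h 1, fun h g => ?_⟩
  refine ((Ideal.isPrimary_iff.1 hQ).2 (x := mulX A (g * f)) (y := mulX A 1) ?_).resolve_right hX
  rw [mul_comm, mulX_one_mul]
  have : mulX A ↑(mulX A (g * f)) = mulX A g * mulX A f := Subtype.ext (by simp; ring)
  rw [this]
  exact Q.mul_mem_left _ h

theorem comap_lowIdeal {Q : Ideal (subringAddXMul A)} (hQ : Q.IsPrimary)
    (hX : mulX A 1 ∉ Q.radical) : (lowIdeal A Q).comap (subringAddXMul A).subtype = Q := by
  ext f
  rw [Ideal.mem_comap, Subring.subtype_apply, mem_lowIdeal_iff A hQ hX, ← mulX_one_mul, mul_comm]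
  exact ⟨fun h => ((Ideal.isPrimary_iff.1 hQ).2 h).resolve_right hX, fun h => Q.mul_mem_right _ h⟩

theorem mem_lowIdeal_iff_of_isPrime {P : Ideal (subringAddXMul A)} (hP : P.IsPrime)
    (hX : mulX A 1 ∉ P) {f : B[X]} : f ∈ lowIdeal A P ↔ mulX A f ∈ P :=
  mem_lowIdeal_iff A hP.isPrimary (by rwa [hP.radical])

theorem comap_lowIdeal_of_isPrime {P : Ideal (subringAddXMul A)} (hP : P.IsPrime)
    (hX : mulX A 1 ∉ P) : (lowIdeal A P).comap (subringAddXMul A).subtype = P :=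
  comap_lowIdeal A hP.isPrimary (by rwa [hP.radical])

theorem lowIdeal_isPrime {P : Ideal (subringAddXMul A)} (hP : P.IsPrime)
    (hX : mulX A 1 ∉ P) : (lowIdeal A P).IsPrime := by
  refine ⟨fun h => hX ?_, fun {f g} hfg => ?_⟩
  · rw [← mem_lowIdeal_iff_of_isPrime A hP hX, h]
    trivial
  · have h := hfg X
    rw [← mulX_mul] at h
    simpa only [mem_lowIdeal_iff_of_isPrime A hP hX] using hP.mem_or_mem h

theorem X_notMem_lowIdeal {P : Ideal (subringAddXMul A)} (hP : P.IsPrime)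
    (hX : mulX A 1 ∉ P) : X ∉ lowIdeal A P := by
  rw [mem_lowIdeal_iff_of_isPrime A hP hX]
  have : mulX A X = mulX A 1 * mulX A 1 := Subtype.ext (by simp)
  rw [this]
  exact fun h => (hP.mem_or_mem h).elim hX hX

theorem lowIdeal_mono {P Q : Ideal (subringAddXMul A)} (h : P ≤ Q) :
    lowIdeal A P ≤ lowIdeal A Q := fun _ hf g => h (hf g)

end Structure

/-! ### Zero-dimensional and von Neumann regular rings -/

section ZeroDimensional

variable {R : Type*} [CommRing R]

/-- Otherwise 0 is not in the monoid generated by S and x, and some prime ideal avoids this monoid.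
-/
theorem exists_mul_pow_eq_zero (S : Submonoid R) (x : R)
    (h : ∀ P : Ideal R, P.IsPrime → Disjoint (P : Set R) S → x ∈ P) :
    ∃ s ∈ S, ∃ k : ℕ, s * x ^ k = 0 := by
  by_contra hno
  push Not at hno
  have hdisj : Disjoint ((⊥ : Ideal R) : Set R) (S ⊔ Submonoid.powers x : Submonoid R) := by
    rw [Set.disjoint_left]
    rintro y hy hyS
    obtain ⟨s, hs, _, ⟨k, rfl⟩, rfl⟩ := Submonoid.mem_sup.1 hyS
    exact hno s hs k hy
  obtain ⟨P, hP, -, hPS⟩ := Ideal.exists_le_prime_disjoint _ _ hdisj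
  rw [Set.disjoint_left] at hPS
  refine hPS (h P hP (Set.disjoint_left.2 fun y hy hyS => hPS hy ?_))
    ((le_sup_right : _ ≤ S ⊔ _) (Submonoid.mem_powers x))
  exact (le_sup_left : S ≤ S ⊔ _) hyS

/-- In a zero-dimensional ring each element of a prime ideal is locally nilpotent. -/
theorem exists_mul_pow_eq_zero_of_mem [Ring.KrullDimLE 0 R] {P : Ideal R} (hP : P.IsPrime)
    {x : R} (hx : x ∈ P) : ∃ s ∉ P, ∃ k : ℕ, s * x ^ k = 0 := by
  obtain ⟨s, hs, k, h⟩ := exists_mul_pow_eq_zero P.primeCompl x fun Q hQ hdisj => by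
    have hQP : Q ≤ P := fun y hy => by
      by_contra hyP
      exact Set.disjoint_left.1 hdisj hy hyP
    rwa [hQ.isMaximal'.eq_of_le hP.ne_top hQP]
  exact ⟨s, hs, k, h⟩

theorem isVNRegular_iff [Nontrivial R] : IsVNRegular R ↔ IsReduced R ∧ Ring.KrullDimLE 0 R := by
  rw [IsVNRegular, ringKrullDimZero_iff_ringKrullDim_eq_zero]

theorem exists_mul_self_mul_eq [IsReduced R] [Ring.KrullDimLE 0 R] (a : R) :
    ∃ x, a * a * x = a := by
  suffices h : (Ideal.span {a * a}).colon {a} = ⊤ by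
    have h1 : (1 : R) ∈ (Ideal.span {a * a}).colon {a} := h ▸ Submodule.mem_top
    rw [Submodule.mem_colon_singleton, smul_eq_mul, one_mul] at h1
    obtain ⟨x, hx⟩ := Ideal.mem_span_singleton.1 h1
    exact ⟨x, hx.symm⟩
  by_contra hne
  obtain ⟨m, hm, hle⟩ := Ideal.exists_le_maximal _ hne
  have ham : a ∈ m := hle (by
    rw [Submodule.mem_colon_singleton, smul_eq_mul]
    exact Ideal.mem_span_singleton_self _)
  obtain ⟨s, hs, k, hk⟩ := exists_mul_pow_eq_zero_of_mem hm.isPrime ham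
  have hsa : s * a = 0 := by
    refine IsReduced.eq_zero _ ⟨k + 1, ?_⟩
    rw [mul_pow, pow_succ s, pow_succ a]
    linear_combination s ^ k * a * hk
  refine hs (hle ?_)
  rw [Submodule.mem_colon_singleton, smul_eq_mul, hsa]
  exact Ideal.zero_mem _

/-- In a von Neumann regular ring each element is a multiple of an idempotent it divides. -/
theorem exists_idempotent_dvd [IsReduced R] [Ring.KrullDimLE 0 R] (a : R) :
    ∃ e x, e * e = e ∧ e = a * x ∧ e * a = a := by
  obtain ⟨x, hx⟩ := exists_mul_self_mul_eq a
  refine ⟨a * x, x, ?_, rfl, ?_⟩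
  · linear_combination x * hx
  · linear_combination hx

end ZeroDimensional

/-! ### Dimension and reducedness of A + XB[X] -/

section Dimension

variable {B : Type*} [CommRing B] (A : Subring B)

theorem overIdeal_notMem_minimalPrimes (P : Ideal A) :
    overIdeal A P ∉ minimalPrimes (subringAddXMul A) := fun h =>
  notMem_nonZeroDivisors_of_mem_mem_minimalPrimes (mulX_mem_overIdeal A P 1) h
    (mulX_one_mem_nonZeroDivisors A)

theorem krullDimLE_zero_of_krullDimLE_one [Ring.KrullDimLE 1 (subringAddXMul A)] :
    Ring.KrullDimLE 0 A := by
  have hR := Ring.krullDimLE_one_iff.1 ‹Ring.KrullDimLE 1 (subringAddXMul A)›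
  refine Ring.KrullDimLE.mk₀ fun P hP => ?_
  have hmax := (hR (overIdeal A P) inferInstance).resolve_left (overIdeal_notMem_minimalPrimes A P)
  obtain ⟨Q, hQ, hPQ⟩ := Ideal.exists_le_maximal P hP.ne_top
  have : overIdeal A P = overIdeal A Q :=
    hmax.eq_of_le (Ideal.IsPrime.ne_top inferInstance) ((overIdeal_le_iff A).2 hPQ)
  rwa [le_antisymm hPQ ((overIdeal_le_iff A).1 this.ge)]

theorem krullDimLE_zero_of_krullDimLE_one' [Ring.KrullDimLE 1 (subringAddXMul A)] :
    Ring.KrullDimLE 0 B := by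
  have hR := Ring.krullDimLE_one_iff.1 ‹Ring.KrullDimLE 1 (subringAddXMul A)›
  have hmin : ∀ Q : Ideal B, Q.IsPrime → starIdeal A Q ∈ minimalPrimes (subringAddXMul A) := by
    intro Q hQ
    refine (hR (starIdeal A Q) inferInstance).resolve_right fun hmax => ?_
    have := starIdeal_lt_overIdeal A hQ.ne_top
    exact this.ne (hmax.eq_of_le (Ideal.IsPrime.ne_top inferInstance) this.le)
  refine Ring.KrullDimLE.mk₀ fun P hP => ?_
  obtain ⟨Q, hQ, hPQ⟩ := Ideal.exists_le_maximal P hP.ne_top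
  have hle := (hmin Q hQ.isPrime).2 ⟨inferInstanceAs (starIdeal A P).IsPrime, bot_le⟩
    ((starIdeal_le_iff A).2 hPQ)
  rwa [le_antisymm hPQ ((starIdeal_le_iff A).1 hle)]

/-- A prime ideal over `X` comes from `A`. -/
theorem exists_eq_overIdeal {P : Ideal (subringAddXMul A)} (hP : P.IsPrime) (hX : mulX A 1 ∈ P) :
    ∃ p : Ideal A, p.IsPrime ∧ P = overIdeal A p :=
  ⟨P.comap (ofConst A), Ideal.comap_isPrime _ _,
    eq_overIdeal A (mulX_mem_of_mulX_one_mem A hP hX)⟩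

/-- Primes over X come from maximal ideals of A. A prime without X inherits minimality or maximality
from the at most one-dimensional B[X]. In the maximal case X is invertible modulo the prime of B[X],
so no larger prime of R can contain X. -/
theorem krullDimLE_one [Ring.KrullDimLE 0 A] [Ring.KrullDimLE 0 B] :
    Ring.KrullDimLE 1 (subringAddXMul A) := by
  have hB : Ring.KrullDimLE 1 B[X] := by
    rw [Ring.krullDimLE_iff]
    refine Polynomial.ringKrullDim_le.trans ?_
    have h0 : ringKrullDim B ≤ 0 := Ring.krullDimLE_iff.1 inferInstance
    calc 2 * ringKrullDim B + 1 ≤ 2 * 0 + 1 := by gcongr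
      _ = _ := by simp
  refine Ring.KrullDimLE.mk₁ fun P hP => ?_
  by_cases hX : mulX A 1 ∈ P
  · obtain ⟨p, hp, rfl⟩ := exists_eq_overIdeal A hP hX
    exact Or.inr inferInstance
  · rcases Ring.krullDimLE_one_iff.1 hB _ (lowIdeal_isPrime A hP hX) with hmin | hmax
    · refine Or.inl ⟨⟨hP, bot_le⟩, fun P' hP' hle => ?_⟩
      have hX' : mulX A 1 ∉ P' := fun h => hX (hle h)
      have := hmin.2 ⟨lowIdeal_isPrime A hP'.1 hX', bot_le⟩ (lowIdeal_mono A hle)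
      rw [← comap_lowIdeal_of_isPrime A hP hX, ← comap_lowIdeal_of_isPrime A hP'.1 hX']
      exact Ideal.comap_mono this
    · right
      obtain ⟨M, hM, hPM⟩ := Ideal.exists_le_maximal P hP.ne_top
      have hXM : mulX A 1 ∉ M := by
        intro hXM
        obtain ⟨f, i, hi, hfi⟩ := hmax.exists_inv (X_notMem_lowIdeal A hP hX)
        have hmem : 1 - mulX A f ∈ P := by
          rw [← comap_lowIdeal_of_isPrime A hP hX, Ideal.mem_comap]
          have : (subringAddXMul A).subtype (1 - mulX A f) = i := by
            simp only [map_sub, map_one, Subring.subtype_apply, coe_mulX]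
            linear_combination -hfi
          rwa [this]
        refine (Ideal.ne_top_iff_one M).1 hM.ne_top ?_
        simpa using M.add_mem (hPM hmem) (mulX_mem_of_mulX_one_mem A hM.isPrime hXM f)
      have := hmax.eq_of_le (lowIdeal_isPrime A hM.isPrime hXM).ne_top (lowIdeal_mono A hPM)
      rwa [← comap_lowIdeal_of_isPrime A hP hX, this, comap_lowIdeal_of_isPrime A hM.isPrime hXM]

theorem one_le_ringKrullDim [Nontrivial B] : 1 ≤ ringKrullDim (subringAddXMul A) := by
  obtain ⟨m, hm⟩ := Ideal.exists_maximal A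
  obtain ⟨Q, hQ, hle⟩ := Ideal.exists_minimalPrimes_le (bot_le : ⊥ ≤ overIdeal A m)
  refine Order.one_le_krullDim_iff.2 ⟨⟨Q, hQ.1.1⟩, ⟨overIdeal A m, inferInstance⟩, ?_⟩
  refine lt_of_le_of_ne hle fun h => overIdeal_notMem_minimalPrimes A m ?_
  have : Q = overIdeal A m := congrArg PrimeSpectrum.asIdeal h
  rwa [← this]

theorem ringKrullDim_eq_one_iff_krullDimLE [Nontrivial B] :
    ringKrullDim (subringAddXMul A) = 1 ↔ Ring.KrullDimLE 0 A ∧ Ring.KrullDimLE 0 B := by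
  have h : ringKrullDim (subringAddXMul A) = 1 ↔ Ring.KrullDimLE 1 (subringAddXMul A) := by
    rw [Ring.krullDimLE_iff, Nat.cast_one]
    exact ⟨fun h => h.le, fun h => le_antisymm h (one_le_ringKrullDim A)⟩
  rw [h]
  constructor
  · intro h
    exact ⟨krullDimLE_zero_of_krullDimLE_one A, krullDimLE_zero_of_krullDimLE_one' A⟩
  · rintro ⟨h1, h2⟩
    exact krullDimLE_one A

theorem isReduced_subringAddXMul_iff : IsReduced (subringAddXMul A) ↔ IsReduced B := by
  constructor
  · intro h
    refine ⟨fun b ⟨n, hb⟩ => ?_⟩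
    have : mulX A (C b) = 0 := by
      refine IsReduced.eq_zero _ ⟨n, Subtype.ext ?_⟩
      simp [mul_pow, ← C_pow, hb]
    have := congrArg (fun f : subringAddXMul A => (f : B[X]).coeff 1) this
    simpa using this
  · intro h
    refine ⟨fun f ⟨n, hf⟩ => Subtype.ext (Polynomial.ext fun i => ?_)⟩
    have : IsNilpotent (f : B[X]) := ⟨n, by simpa using congrArg Subtype.val hf⟩
    simpa using (Polynomial.isNilpotent_iff.1 this i).eq_zero

theorem isReduced_subring [IsReduced B] : IsReduced A :=
  isReduced_of_injective A.subtype A.subtype_injective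

theorem ringKrullDim_eq_one_and_isReduced_iff [Nontrivial B] :
    (ringKrullDim (subringAddXMul A) = 1 ∧ IsReduced (subringAddXMul A)) ↔
      (IsVNRegular A ∧ IsVNRegular B) := by
  rw [ringKrullDim_eq_one_iff_krullDimLE, isVNRegular_iff, isVNRegular_iff,
    isReduced_subringAddXMul_iff]
  exact ⟨fun ⟨⟨h1, h2⟩, h3⟩ => ⟨⟨isReduced_subring A, h1⟩, h3, h2⟩,
    fun ⟨⟨_, h1⟩, h3, h2⟩ => ⟨⟨h1, h2⟩, h3⟩⟩

end Dimension

/-! ### The central condition: elements of primes of B are killed from A -/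

section Kills

variable {B : Type*} [CommRing B] (A : Subring B)

/-- `A` is zero-dimensional, and every element of a prime ideal `P` of `B` is killed by an element
of `A` outside `P`. -/
def IsLocallyFieldExtension : Prop :=
  Ring.KrullDimLE 0 A ∧ ∀ P : Ideal B, P.IsPrime → ∀ b ∈ P, ∃ s : A, (s : B) ∉ P ∧ (s : B) * b = 0

variable {A}

/-- Minimal primes lie under primes of any overring; in dimension zero all primes are minimal, so
integrality is not needed. -/
theorem exists_comap_subtype_eq [Ring.KrullDimLE 0 A] (p : Ideal A) (hp : p.IsPrime) :
    ∃ P : Ideal B, P.IsPrime ∧ P.comap A.subtype = p :=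
  Ideal.exists_comap_eq_of_mem_minimalPrimes_of_injective A.subtype_injective p
    (Ideal.mem_minimalPrimes_of_krullDimLE_zero p)

theorem IsLocallyFieldExtension.isReduced (h : IsLocallyFieldExtension A) : IsReduced B := by
  have := h.1
  refine ⟨fun b hb => ?_⟩
  let I : Ideal A := (LinearMap.toSpanSingleton A B b).ker
  have hI : ∀ s : A, s ∈ I ↔ (s : B) * b = 0 := fun s => by
    simp [I, LinearMap.mem_ker, Subring.smul_def]
  suffices htop : I = ⊤ by
    have := (hI 1).1 (htop ▸ Submodule.mem_top)
    simpa using this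
  by_contra hne
  obtain ⟨m, hm, hle⟩ := Ideal.exists_le_maximal I hne
  obtain ⟨P, hP, rfl⟩ := exists_comap_subtype_eq m hm.isPrime
  obtain ⟨s, hs, hsb⟩ := h.2 P hP b (nilradical_le_prime P hb)
  exact hs (hle ((hI s).2 hsb))

theorem IsLocallyFieldExtension.le_of_comap_le (h : IsLocallyFieldExtension A) {P Q : Ideal B}
    (hP : P.IsPrime) (hQ : Q.IsPrime) (hle : P.comap A.subtype ≤ Q.comap A.subtype) : Q ≤ P := by
  have := h.1
  have heq : P.comap A.subtype = Q.comap A.subtype :=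
    (Ideal.IsPrime.isMaximal' (Ideal.comap_isPrime A.subtype P)).eq_of_le
      (Ideal.comap_isPrime A.subtype Q).ne_top hle
  intro b hb
  obtain ⟨s, hs, hsb⟩ := h.2 Q hQ b hb
  refine (hP.mem_or_mem (hsb ▸ P.zero_mem : (s : B) * b ∈ P)).resolve_left fun hsP => hs ?_
  exact heq.le hsP

theorem IsLocallyFieldExtension.krullDimLE (h : IsLocallyFieldExtension A) :
    Ring.KrullDimLE 0 B := by
  refine Ring.KrullDimLE.mk₀ fun P hP => ?_
  obtain ⟨Q, hQ, hPQ⟩ := Ideal.exists_le_maximal P hP.ne_top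
  rwa [le_antisymm hPQ (h.le_of_comap_le hP hQ.isPrime (Ideal.comap_mono hPQ))]

/-- If P is the only prime over p, it is the only prime of B avoiding the image of A ∖ p. Hence each
b ∈ P satisfies s * b ^ k = 0 with s in that image, and s * b = 0 by reducedness. -/
theorem isLocallyFieldExtension_iff [Nontrivial B] :
    IsLocallyFieldExtension A ↔ IsVNRegular A ∧ IsVNRegular B ∧ IsUnibranched A := by
  rw [isVNRegular_iff, isVNRegular_iff]
  constructor
  · intro h
    have := h.1
    have := h.isReduced
    refine ⟨⟨isReduced_subring A, h.1⟩, ⟨this, h.krullDimLE⟩, fun p hp => ?_⟩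
    obtain ⟨P, hP, hPp⟩ := exists_comap_subtype_eq p hp
    refine ⟨P, ⟨hP, hPp⟩, fun Q ⟨hQ, hQp⟩ => ?_⟩
    exact le_antisymm (h.le_of_comap_le hP hQ (by rw [hPp, hQp]))
      (h.le_of_comap_le hQ hP (by rw [hPp, hQp]))
  · rintro ⟨⟨_, hA⟩, ⟨_, hB⟩, hun⟩
    refine ⟨hA, fun P hP b hb => ?_⟩
    obtain ⟨s, hs, k, hk⟩ := exists_mul_pow_eq_zero
        ((P.comap A.subtype).primeCompl.map A.subtype) b fun Q hQ hdisj => by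
      have hle : Q.comap A.subtype ≤ P.comap A.subtype := fun a ha => by
        by_contra haP
        exact Set.disjoint_left.1 hdisj ha ⟨a, haP, rfl⟩
      have heq := (Ideal.IsPrime.isMaximal' (Ideal.comap_isPrime A.subtype Q)).eq_of_le
        (Ideal.comap_isPrime A.subtype P).ne_top hle
      rwa [(hun _ (Ideal.comap_isPrime A.subtype P)).unique ⟨hQ, heq⟩ ⟨hP, rfl⟩]
    obtain ⟨s, hs, rfl⟩ := hs
    refine ⟨s, hs, ?_⟩
    refine IsReduced.eq_zero _ ⟨k + 1, ?_⟩
    rw [mul_pow, pow_succ (s : B), pow_succ b]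
    rw [Subring.subtype_apply] at hk
    linear_combination (s : B) ^ k * b * hk

end Kills

/-! ### From local conditions on A + XB[X] to the central condition -/

section Hub

theorem exists_isPrime_localization {R : Type*} [CommRing R] {M P : Ideal R} [M.IsPrime]
    (hP : P.IsPrime) (hlt : P < M) :
    ∃ Q : Ideal (Localization.AtPrime M), Q.IsPrime ∧
      Q < IsLocalRing.maximalIdeal (Localization.AtPrime M) ∧
      ∀ f, algebraMap R (Localization.AtPrime M) f ∈ Q ↔ f ∈ P := by
  have hdisj : Disjoint (M.primeCompl : Set R) P := by
    rw [Set.disjoint_left]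
    exact fun x hx hxP => hx (hlt.le hxP)
  have hprime := IsLocalization.isPrime_of_isPrime_disjoint M.primeCompl (Localization.AtPrime M)
    P hP hdisj
  have hmem : ∀ f, algebraMap R (Localization.AtPrime M) f ∈
      P.map (algebraMap R (Localization.AtPrime M)) ↔ f ∈ P := fun f => by
    have := IsLocalization.under_map_of_isPrime_disjoint M.primeCompl (Localization.AtPrime M)
      hP hdisj
    rw [← Ideal.mem_comap]
    exact iff_of_eq (congrArg (f ∈ ·) this)
  refine ⟨_, hprime, lt_of_le_of_ne (IsLocalRing.le_maximalIdeal hprime.ne_top) fun h => ?_, hmem⟩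
  obtain ⟨x, hxM, hxP⟩ := SetLike.exists_of_lt hlt
  refine hxP ((hmem x).1 (h ▸ ?_))
  exact (IsLocalization.AtPrime.to_map_mem_maximal_iff _ M x).2 hxM

variable {B : Type*} [CommRing B] {A : Subring B}

theorem krullDimLE_zero_of_localization
    (h : ∀ (M : Ideal (subringAddXMul A)) [M.IsMaximal], ∀ Q : Ideal (Localization.AtPrime M),
      Q.IsPrime → Q < IsLocalRing.maximalIdeal (Localization.AtPrime M) →
      algebraMap _ (Localization.AtPrime M) (mulX A 1) ∉ Q) :
    Ring.KrullDimLE 0 A := by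
  refine Ring.KrullDimLE.mk₀ fun P hP => ?_
  obtain ⟨m, hm, hPm⟩ := Ideal.exists_le_maximal P hP.ne_top
  rcases hPm.eq_or_lt with rfl | hlt
  · exact hm
  · obtain ⟨Q, hQ, hQm, hQP⟩ := exists_isPrime_localization (M := overIdeal A m)
      (inferInstanceAs (overIdeal A P).IsPrime) ((overIdeal_lt_iff A).2 hlt)
    exact absurd ((hQP _).2 (mulX_mem_overIdeal A P 1)) (h _ Q hQ hQm)

/-- The hypothesis is applied to P[X] ∩ R and its element Xb. The square matters: membership in (X)
would only give s(0)b ∈ A, whereas X² has no linear coefficient and forces s(0)b = 0. -/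
theorem isLocallyFieldExtension_of_localization (hA : Ring.KrullDimLE 0 A)
    (h : ∀ (M : Ideal (subringAddXMul A)) [M.IsMaximal], mulX A 1 ∈ M →
      ∀ Q : Ideal (Localization.AtPrime M),
      Q.IsPrime → Q < IsLocalRing.maximalIdeal (Localization.AtPrime M) →
      algebraMap _ (Localization.AtPrime M) (mulX A 1) ∉ Q →
      Q ≤ Ideal.span {algebraMap _ (Localization.AtPrime M) (mulX A 1) ^ 2}) :
    IsLocallyFieldExtension A := by
  refine ⟨hA, fun P hP b hb => ?_⟩
  have hm : (P.comap A.subtype).IsMaximal := (Ideal.comap_isPrime A.subtype P).isMaximal'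
  set M := overIdeal A (P.comap A.subtype) with hM
  obtain ⟨Q, hQ, hQm, hQP⟩ := exists_isPrime_localization (M := M)
    (inferInstanceAs (starIdeal A P).IsPrime) (starIdeal_lt_overIdeal A hP.ne_top)
  have hbQ := h M (mulX_mem_overIdeal A _ 1) Q hQ hQm
    (fun h => mulX_one_notMem_starIdeal A hP.ne_top ((hQP _).1 h))
    ((hQP _).2 ((mulX_C_mem_starIdeal A).2 hb))
  rw [← map_pow, ← Set.image_singleton, ← Ideal.map_span,
    IsLocalization.algebraMap_mem_map_algebraMap_iff M.primeCompl] at hbQ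
  obtain ⟨s, hs, hsb⟩ := hbQ
  obtain ⟨r, hr⟩ := Ideal.mem_span_singleton.1 hsb
  refine ⟨constHom A s, hs, ?_⟩
  have h1 : X * ((s : B[X]) * C b) = X * (X * (r : B[X])) := by
    have h2 := congrArg Subtype.val hr
    simp only [Subring.coe_mul, Subring.coe_pow, coe_mulX] at h2
    linear_combination h2
  have h2 := congrArg (fun f : B[X] => f.coeff 1) h1
  simpa [coeff_X_mul, mul_coeff_zero] using h2

/-- Every nonmaximal prime ideal of a localization at a maximal ideal is zero. -/
theorem isLocallyFieldExtension_of_eq_bot [Nontrivial B]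
    (h : ∀ (M : Ideal (subringAddXMul A)) [M.IsMaximal], ∀ Q : Ideal (Localization.AtPrime M),
      Q.IsPrime → Q < IsLocalRing.maximalIdeal (Localization.AtPrime M) → Q = ⊥) :
    IsLocallyFieldExtension A := by
  have hreg : ∀ (M : Ideal (subringAddXMul A)) [M.IsMaximal],
      algebraMap _ (Localization.AtPrime M) (mulX A 1) ≠ 0 := by
    intro M hM h0
    rw [IsLocalization.map_eq_zero_iff M.primeCompl] at h0
    obtain ⟨s, hs⟩ := h0
    have := (mul_right_mem_nonZeroDivisors_eq_zero_iff (mulX_one_mem_nonZeroDivisors A)).1 hs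
    exact s.2 (this ▸ M.zero_mem)
  refine isLocallyFieldExtension_of_localization
    (krullDimLE_zero_of_localization fun M _ Q hQ hlt hX => ?_) fun M _ _ Q hQ hlt _ => ?_
  · rw [h M Q hQ hlt] at hX
    exact hreg M hX
  · rw [h M Q hQ hlt]
    exact bot_le

theorem isLocallyFieldExtension_of_finiteAbsorbing [Nontrivial B]
    (h : IsFiniteAbsorbing (subringAddXMul A)) (hd : IsLocallyDivided (subringAddXMul A)) :
    IsLocallyFieldExtension A :=
  isLocallyFieldExtension_of_eq_bot fun M _ _ hQ hlt =>
    (h.localization M).eq_bot_of_isDividedRing (hd M) hQ hlt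

theorem isLocallyFieldExtension_of_divided [Nontrivial B]
    (h : ringKrullDim (subringAddXMul A) = 1) (hd : IsLocallyDivided (subringAddXMul A)) :
    IsLocallyFieldExtension A := by
  refine isLocallyFieldExtension_of_localization ((ringKrullDim_eq_one_iff_krullDimLE A).1 h).1
    fun M _ _ Q hQ _ hX => (hd M Q hQ _ fun h => hX (hQ.mem_of_pow_mem 2 h)).le

theorem map_mulX_one_mem_nonZeroDivisors (M : Ideal (subringAddXMul A)) [M.IsPrime] :
    algebraMap _ (Localization.AtPrime M) (mulX A 1) ∈
      nonZeroDivisors (Localization.AtPrime M) :=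
  IsLocalization.map_nonZeroDivisors_le M.primeCompl _
    (Submonoid.mem_map_of_mem _ (mulX_one_mem_nonZeroDivisors A))

theorem isLocallyFieldExtension_of_isFAFRing (h : IsFAFRing (subringAddXMul A)) :
    IsLocallyFieldExtension A := by
  obtain ⟨n, hn, hF⟩ := h
  refine isLocallyFieldExtension_of_localization
    (krullDimLE_zero_of_localization fun M _ Q hQ hlt hX => hlt.ne ?_) fun M _ hXM Q hQ hlt _ => ?_
  · exact (hF.localization M).eq_maximalIdeal_of_mem_nonZeroDivisors hn hQ hX
      (map_mulX_one_mem_nonZeroDivisors M)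
  · exact (hF.localization M).prime_le_span_pow hn hQ hlt
      ((IsLocalization.AtPrime.to_map_mem_maximal_iff _ M _).2 hXM)
      (map_mulX_one_mem_nonZeroDivisors M) 2

end Hub

/-! ### Divided local rings and Mori PVDs -/

section Local

variable {T : Type*} [CommRing T]

/-- For p ∈ P and a nonunit a ∉ P, the inclusion aM ⊆ (p) would put a * a into P. So p ∈ aM. -/
theorem IsPVR.isDividedRing [IsLocalRing T] (h : IsPVR T) : IsDividedRing T := by
  obtain ⟨M, hM, h⟩ := h
  intro P hP a ha
  have hle : P ≤ Ideal.span {a} := by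
    intro p hp
    rcases h a p with h1 | h1
    · by_cases hau : IsUnit a
      · rw [Ideal.span_singleton_eq_top.2 hau]
        trivial
      · have haM : a ∈ M := by
          rw [IsLocalRing.eq_maximalIdeal hM]
          exact (IsLocalRing.mem_maximalIdeal a).2 hau
        have hpP : Ideal.span {p} ≤ P := by rwa [Ideal.span_singleton_le_iff_mem]
        have := hpP (h1 (Ideal.mul_mem_mul (Ideal.mem_span_singleton_self a) haM))
        exact absurd this fun h => (hP.mem_or_mem h).elim ha ha
    · have hmul : Ideal.span {a} * M ≤ Ideal.span {a} := Ideal.mul_le_left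
      exact hmul (h1 (Ideal.mem_span_singleton_self p))
  exact lt_of_le_of_ne hle fun h => ha (h ▸ Ideal.mem_span_singleton_self a)

theorem isDividedRing_of_le_total (h : ∀ I J : Ideal T, I ≤ J ∨ J ≤ I) : IsDividedRing T := by
  intro P hP a ha
  rcases h P (Ideal.span {a}) with h1 | h1
  · exact lt_of_le_of_ne h1 fun h => ha (h ▸ Ideal.mem_span_singleton_self a)
  · exact absurd (h1 (Ideal.mem_span_singleton_self a)) ha

theorem isDividedRing_of_eq_bot [IsLocalRing T]
    (h : ∀ Q : Ideal T, Q.IsPrime → Q < IsLocalRing.maximalIdeal T → Q = ⊥) :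
    IsDividedRing T := by
  intro P hP a ha
  rcases (IsLocalRing.le_maximalIdeal hP.ne_top).eq_or_lt with rfl | hlt
  · have hau : IsUnit a := by
      by_contra hau
      exact ha hau
    rw [Ideal.span_singleton_eq_top.2 hau]
    exact hP.ne_top.lt_top
  · obtain rfl := h P hP hlt
    refine bot_lt_iff_ne_bot.2 fun h => ha ?_
    exact h ▸ Ideal.mem_span_singleton_self a

theorem eq_bot_of_ringKrullDim_eq_one [IsLocalRing T] [IsDomain T] (h : ringKrullDim T = 1)
    {Q : Ideal T} (hQ : Q.IsPrime) (hlt : Q < IsLocalRing.maximalIdeal T) : Q = ⊥ := by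
  by_contra hne
  have : Ring.KrullDimLE 1 T := Ring.krullDimLE_iff.2 h.le
  exact hlt.ne (IsLocalRing.eq_maximalIdeal (hQ.isMaximal_of_ne_bot hne))

/-- Strong primeness divides p by every power of a nonunit a ∉ P: p = a ^ n * q n. If p ≠ 0, the
principal, hence divisorial, ideals (q n) ascend, and stabilization would make a a unit. -/
theorem IsPVD.eq_bot_of_isMoriDomain [IsLocalRing T] (h : IsPVD T) (hM : IsMoriDomain T)
    {P : Ideal T} (hP : P.IsPrime) (hlt : P < IsLocalRing.maximalIdeal T) : P = ⊥ := by
  obtain ⟨_, hstrong⟩ := h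
  obtain ⟨_, hchain⟩ := hM
  rw [eq_bot_iff]
  intro p hp
  by_contra hp0
  obtain ⟨a, ham, haP⟩ := SetLike.exists_of_lt hlt
  let K := FractionRing T
  have hdiv : ∀ n : ℕ, ∃ q ∈ P, p = a ^ n * q := by
    intro n
    have ha0 : algebraMap T K (a ^ n) ≠ 0 := by
      rw [Ne, IsFractionRing.to_map_eq_zero_iff]
      rintro h
      exact haP (hP.mem_of_pow_mem n (h ▸ P.zero_mem))
    rcases hstrong P hP (algebraMap T K (a ^ n)) (algebraMap T K p / algebraMap T K (a ^ n))
      (by rw [mul_div_cancel₀ _ ha0]; exact ⟨p, hp, rfl⟩) with h1 | h1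
    · obtain ⟨x, hx, hxa⟩ := h1
      have : x = a ^ n := IsFractionRing.injective T K hxa
      exact absurd (hP.mem_of_pow_mem n (this ▸ hx)) haP
    · obtain ⟨q, hq, hqa⟩ := h1
      refine ⟨q, hq, IsFractionRing.injective T K ?_⟩
      rw [map_mul]
      change algebraMap T K q = _ at hqa
      rw [hqa, mul_div_cancel₀ _ ha0]
  choose q hqP hq using hdiv
  have hq0 : ∀ n, q n ≠ 0 := fun n h => hp0 (by rw [hq n, h, mul_zero]; exact Ideal.zero_mem _)
  have ha0 : a ≠ 0 := fun h => haP (h ▸ P.zero_mem)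
  have hstep : ∀ n, q n = a * q (n + 1) := fun n => by
    refine mul_left_cancel₀ (pow_ne_zero n ha0) ?_
    rw [← hq n, hq (n + 1), pow_succ]
    ring
  have hdivisorial : ∀ x : T, x ≠ 0 → IsDivisorialIdeal (Ideal.span {x}) := by
    intro x hx
    have hx0 : algebraMap T K x ≠ 0 := by
      rwa [Ne, IsFractionRing.to_map_eq_zero_iff]
    refine ⟨by simpa using hx, le_antisymm (fun y hy => ?_) ?_⟩
    · rw [Submodule.mem_div_iff_forall_mul_mem] at hy
      have hxinv : (algebraMap T K x)⁻¹ ∈ (1 : Submodule T K) /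
          IsLocalization.coeSubmodule K (Ideal.span {x}) := by
        rw [Submodule.mem_div_iff_forall_mul_mem]
        rintro _ ⟨z, hz, rfl⟩
        obtain ⟨c, rfl⟩ := Ideal.mem_span_singleton.1 hz
        rw [Submodule.mem_one]
        refine ⟨c, ?_⟩
        simp only [Algebra.linearMap_apply, map_mul]
        rw [inv_mul_cancel_left₀ hx0]
      obtain ⟨c, hc⟩ := Submodule.mem_one.1 (hy _ hxinv)
      refine ⟨x * c, Ideal.mul_mem_right _ _ (Ideal.mem_span_singleton_self x), ?_⟩
      simp only [Algebra.linearMap_apply, map_mul]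
      rw [hc]
      rw [mul_comm, inv_mul_cancel_right₀ hx0]
    · intro y hy
      rw [Submodule.mem_div_iff_forall_mul_mem]
      intro z hz
      rw [mul_comm]
      exact (Submodule.mem_div_iff_forall_mul_mem.1 hz) y hy
  obtain ⟨n, hn⟩ := hchain ⟨fun n => Ideal.span {q n}, monotone_nat_of_le_succ fun n => by
    rw [Ideal.span_singleton_le_span_singleton, hstep n]
    exact dvd_mul_left _ _⟩ fun n => hdivisorial _ (hq0 n)
  have hle : Ideal.span {q (n + 1)} ≤ Ideal.span {q n} := (hn (n + 1) n.le_succ).le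
  obtain ⟨c, hc⟩ := Ideal.span_singleton_le_span_singleton.1 hle
  rw [hstep n] at hc
  have hac : a * c = 1 := by
    refine mul_right_cancel₀ (hq0 (n + 1)) ?_
    linear_combination -hc
  exact ham (IsUnit.of_mul_eq_one c hac)

end Local

/-! ### Condition (*) -/

section Star

variable {B : Type*} [CommRing B] {A : Subring B}

/-- The polynomials `f` of `A + X B[X]` with `f₀ ∈ J`, `f₁ ∈ W` and all other coefficients
in `V`. -/
noncomputable def coeffIdeal (J : Ideal A) (W : Submodule A B) (V : Ideal B)
    (hJW : ∀ a ∈ J, ∀ b : B, (a : B) * b ∈ W) :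
    Ideal (subringAddXMul A) where
  carrier := {f | constHom A f ∈ J ∧ (f : B[X]).coeff 1 ∈ W ∧ ∀ i, (f : B[X]).coeff i ∈ V}
  zero_mem' := by simp
  add_mem' {f g} hf hg := by
    refine ⟨?_, ?_, fun i => ?_⟩
    · rw [map_add]
      exact J.add_mem hf.1 hg.1
    · simpa using W.add_mem hf.2.1 hg.2.1
    · simpa using V.add_mem (hf.2.2 i) (hg.2.2 i)
  smul_mem' r f hf := by
    refine ⟨?_, ?_, ?_⟩
    · rw [smul_eq_mul, map_mul]
      exact J.mul_mem_left _ hf.1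
    · have h1 := W.smul_mem (constHom A r) hf.2.1
      have h2 := hJW _ hf.1 ((r : B[X]).coeff 1)
      rw [Subring.smul_def, smul_eq_mul] at h1
      simp only [smul_eq_mul, Subring.coe_mul, mul_coeff_one]
      refine W.add_mem h1 ?_
      rwa [mul_comm]
    · have hf' : (f : B[X]) ∈ V.map C := Ideal.mem_map_C_iff.2 hf.2.2
      exact Ideal.mem_map_C_iff.1 ((V.map C).mul_mem_left (r : B[X]) hf')

theorem mem_coeffIdeal {J : Ideal A} {W : Submodule A B} {V : Ideal B}
    {hJW : ∀ a ∈ J, ∀ b : B, (a : B) * b ∈ W} {f : subringAddXMul A} :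
    f ∈ coeffIdeal J W V hJW ↔
      constHom A f ∈ J ∧ (f : B[X]).coeff 1 ∈ W ∧ ∀ i, (f : B[X]).coeff i ∈ V := Iff.rfl

theorem coeff_ofConst_mul_mulX_one (a : A) (i : ℕ) :
    ((mulX A 1 * ofConst A a : subringAddXMul A) : B[X]).coeff i = if i = 1 then (a : B) else 0 := by
  simp only [Subring.coe_mul, coe_mulX, mul_one, coe_ofConst]
  rw [mul_comm, C_mul_X_eq_monomial, coeff_monomial]
  simp [eq_comm]

/-- Let P₀ be a minimal prime below a maximal Q, with q ∈ Q outside P₀. Constant coefficients in P₀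
and linear coefficients in P₀B + Q define an ideal with radical P₀ + XB[X]. It contains qX, so if
primary it contains X; then 1 ∈ P₀B + Q, which a prime of B over P₀ rules out. -/
theorem SatisfiesStar.krullDimLE (h : SatisfiesStar (subringAddXMul A)) :
    Ring.KrullDimLE 0 A := by
  refine Ring.KrullDimLE.mk₀ fun P hP => ?_
  obtain ⟨Q, hQ, hPQ⟩ := Ideal.exists_le_maximal P hP.ne_top
  rcases hPQ.eq_or_lt with rfl | hlt
  · exact hQ
  exfalso
  obtain ⟨P₀, hP₀, hle⟩ := Ideal.exists_minimalPrimes_le (bot_le : ⊥ ≤ P)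
  have hprime := hP₀.1.1
  obtain ⟨q, hqQ, hqP⟩ := SetLike.exists_of_lt (hle.trans_lt hlt)
  let W : Submodule A B := (P₀.map A.subtype).restrictScalars A ⊔
    Submodule.map (Algebra.linearMap A B) Q
  let I := coeffIdeal P₀ W ⊤
    (fun a ha b => Submodule.mem_sup_left (Ideal.mul_mem_right b _ (Ideal.mem_map_of_mem _ ha)))
  have hrad : I.radical = overIdeal A P₀ := by
    refine le_antisymm ?_ fun f hf => ⟨2, ?_⟩
    · exact (Ideal.IsPrime.radical_le_iff inferInstance).2 fun f hf => hf.1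
    · refine mem_coeffIdeal.2 ⟨?_, ?_, fun _ => trivial⟩
      · rw [map_pow]
        exact Ideal.pow_mem_of_mem P₀ hf 2 two_pos
      · refine Submodule.mem_sup_left ?_
        have h0 : (f : B[X]).coeff 0 ∈ P₀.map A.subtype := Ideal.mem_map_of_mem A.subtype hf
        rw [Subring.coe_pow, pow_two, mul_coeff_one]
        exact add_mem (Ideal.mul_mem_right _ _ h0) (Ideal.mul_mem_left _ _ h0)
  have hprim : I.IsPrimary := h I (hrad ▸ inferInstance)
  have hmem : mulX A 1 * ofConst A q ∈ I := by
    refine mem_coeffIdeal.2 ⟨?_, ?_, fun _ => trivial⟩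
    · rw [map_mul, constHom_mulX, zero_mul]
      exact P₀.zero_mem
    · rw [coeff_ofConst_mul_mulX_one, if_pos rfl]
      exact Submodule.mem_sup_right ⟨q, hqQ, rfl⟩
  have hX : mulX A 1 ∈ I := ((Ideal.isPrimary_iff.1 hprim).2 hmem).resolve_right fun h => by
    rw [hrad, mem_overIdeal, constHom_ofConst] at h
    exact hqP h
  have h1W : (1 : B) ∈ W := by simpa using hX.2.1
  obtain ⟨w, hw, _, ⟨q', hq', rfl⟩, hsum⟩ := Submodule.mem_sup.1 h1W
  obtain ⟨P', hP', hcomap⟩ := Ideal.exists_comap_eq_of_mem_minimalPrimes_of_injective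
    A.subtype_injective P₀ hP₀
  have hwP' : w ∈ P' := (Ideal.map_le_iff_le_comap.2 hcomap.ge) hw
  have h1q : 1 - q' ∈ P₀ := by
    rw [← hcomap, Ideal.mem_comap]
    have : A.subtype (1 - q') = w := by
      rw [map_sub, map_one, ← hsum]
      exact add_sub_cancel_right _ _
    rwa [this]
  refine (Ideal.ne_top_iff_one Q).1 hQ.ne_top ?_
  simpa using Q.add_mem (hlt.le (hle h1q)) hq'

/-- Let W consist of the elements of B killed from A outside P. The ideal with coefficients in P,
linear coefficient in W and constant coefficient in W ∩ A has radical P[X] ∩ R. It contains Xb * X,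
and X is not in the radical, so Xb belongs to it and b ∈ W. -/
theorem SatisfiesStar.isLocallyFieldExtension (h : SatisfiesStar (subringAddXMul A)) :
    IsLocallyFieldExtension A := by
  have hA := h.krullDimLE
  refine ⟨hA, fun P hP b hb => ?_⟩
  let W : Submodule A B :=
    { carrier := {b | ∃ s : A, (s : B) ∉ P ∧ (s : B) * b = 0}
      zero_mem' := ⟨1, by simpa using (Ideal.ne_top_iff_one P).1 hP.ne_top, by simp⟩
      add_mem' := by
        rintro x y ⟨s, hs, hsx⟩ ⟨t, ht, hty⟩
        refine ⟨s * t, fun h => (hP.mem_or_mem h).elim hs ht, ?_⟩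
        rw [Subring.coe_mul]
        linear_combination (t : B) * hsx + (s : B) * hty
      smul_mem' := by
        rintro a x ⟨s, hs, hsx⟩
        refine ⟨s, hs, ?_⟩
        rw [Subring.smul_def, smul_eq_mul]
        linear_combination (a : B) * hsx }
  let J : Ideal A := W.comap (Algebra.linearMap A B)
  have hJW : ∀ a ∈ J, ∀ b : B, (a : B) * b ∈ W := by
    rintro a ⟨s, hs, hsa⟩ b
    refine ⟨s, hs, ?_⟩
    rw [← mul_assoc]
    have : (s : B) * (a : B) = 0 := hsa
    rw [this, zero_mul]
  let I := coeffIdeal J W P hJW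
  have hrad : I.radical = starIdeal A P := by
    refine le_antisymm ?_ fun f hf => ?_
    · exact (Ideal.IsPrime.radical_le_iff inferInstance).2 fun f hf => (mem_starIdeal A).2 hf.2.2
    · have hf0 : constHom A f ∈ P.comap A.subtype := (mem_starIdeal A).1 hf 0
      obtain ⟨s, hs, k, hk⟩ := exists_mul_pow_eq_zero_of_mem (Ideal.comap_isPrime A.subtype P) hf0
      have hJ : constHom A (f ^ k) ∈ J := ⟨s, hs, by
        rw [map_pow]
        exact congrArg Subtype.val hk⟩
      have hk0 : k ≠ 0 := by
        rintro rfl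
        rw [pow_zero, mul_one] at hk
        exact hs (hk ▸ Ideal.zero_mem _)
      refine ⟨k + k, mem_coeffIdeal.2 ⟨?_, ?_, ?_⟩⟩
      · rw [pow_add, map_mul]
        exact J.mul_mem_left _ hJ
      · rw [pow_add, Subring.coe_mul, mul_coeff_one]
        have := hJW _ hJ (((f ^ k : subringAddXMul A) : B[X]).coeff 1)
        refine W.add_mem this ?_
        rwa [mul_comm]
      · refine (mem_starIdeal A).1 ?_
        exact Ideal.pow_mem_of_mem _ hf _ (by omega)
  have hprim : I.IsPrimary := h I (hrad ▸ inferInstance)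
  have hmem : mulX A (C b) * mulX A 1 ∈ I := by
    have h1 : (mulX A (C b) * mulX A 1 : subringAddXMul A) = mulX A (X * C b) := by
      rw [mulX_mul, mul_one]
    rw [h1]
    refine mem_coeffIdeal.2 ⟨?_, ?_, ?_⟩
    · rw [constHom_mulX]
      exact J.zero_mem
    · simp [coeff_X_mul]
    · refine (mem_starIdeal A).1 ?_
      rw [← h1]
      exact Ideal.mul_mem_right _ _ ((mulX_C_mem_starIdeal A).2 hb)
  have := ((Ideal.isPrimary_iff.1 hprim).2 hmem).resolve_right fun h => by
    rw [hrad] at h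
    exact mulX_one_notMem_starIdeal A hP.ne_top h
  obtain ⟨s, hs, hsb⟩ := this.2.1
  exact ⟨s, hs, by simpa using hsb⟩

theorem IsLocallyFieldExtension.exists_C_mul_eq_zero (h : IsLocallyFieldExtension A) {P : Ideal B}
    (hP : P.IsPrime) {f : B[X]} (hf : ∀ i, f.coeff i ∈ P) :
    ∃ s : A, (s : B) ∉ P ∧ C (s : B) * f = 0 := by
  choose s hs hsf using fun i => h.2 P hP (f.coeff i) (hf i)
  refine ⟨∏ i ∈ f.support, s i, ?_, Polynomial.ext fun i => ?_⟩
  · have h1 : ∏ i ∈ f.support, s i ∉ P.comap A.subtype := by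
      have := Ideal.comap_isPrime A.subtype P
      rw [Ideal.IsPrime.prod_mem_iff]
      push Not
      exact fun i _ => hs i
    exact h1
  · rw [coeff_C_mul, coeff_zero]
    by_cases hi : i ∈ f.support
    · rw [← Finset.mul_prod_erase _ _ hi, Subring.coe_mul]
      linear_combination ((∏ j ∈ f.support.erase i, s j : A) : B) * hsf i
    · rw [notMem_support_iff.1 hi, mul_zero]

/-- A nonmaximal prime radical is minimal, so it misses X and equals n[X] ∩ R. Each f in it is
killed by an idempotent e of A outside n; then 1 - e is an idempotent in the radical, hence in I,
and f = (1 - e)f. So I is already prime. -/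
theorem IsLocallyFieldExtension.satisfiesStar (h : IsLocallyFieldExtension A) :
    SatisfiesStar (subringAddXMul A) := by
  have hA := h.1
  have hB := h.krullDimLE
  have hBred := h.isReduced
  have hAred := isReduced_subring A
  have hR := krullDimLE_one A
  intro I hI
  rcases Ring.krullDimLE_one_iff.1 hR _ hI with hmin | hmax
  swap
  · exact Ideal.isPrimary_of_isMaximal_radical hmax
  have hX : mulX A 1 ∉ I.radical := fun hX =>
    notMem_nonZeroDivisors_of_mem_mem_minimalPrimes hX hmin (mulX_one_mem_nonZeroDivisors A)
  have hN := lowIdeal_isPrime A hI hX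
  let n : Ideal B := (lowIdeal A I.radical).comap C
  have hn : n.IsPrime := Ideal.comap_isPrime C _
  have hle : starIdeal A n ≤ I.radical := by
    intro f hf
    rw [← comap_lowIdeal_of_isPrime A hI hX, Ideal.mem_comap]
    have hmap : n.map C ≤ lowIdeal A I.radical := Ideal.map_le_iff_le_comap.2 le_rfl
    exact hmap hf
  have heq : I.radical = starIdeal A n :=
    le_antisymm (hmin.2 ⟨inferInstance, bot_le⟩ hle) hle
  have hIeq : I = starIdeal A n := by
    refine le_antisymm (heq ▸ Ideal.le_radical) fun f hf => ?_
    obtain ⟨s, hs, hsf⟩ := h.exists_C_mul_eq_zero hn ((mem_starIdeal A).1 hf)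
    obtain ⟨e, x, he, hex, hes⟩ := exists_idempotent_dvd s
    have hen : (e : B) ∉ n := fun hen => hs (by
      rw [← hes, Subring.coe_mul]
      exact n.mul_mem_right _ hen)
    have h1e : ((1 - e : A) : B) ∈ n := by
      refine (hn.mem_or_mem (x := (e : B)) ?_).resolve_left hen
      rw [← Subring.coe_mul, mul_sub, mul_one, he, sub_self]
      exact n.zero_mem
    have h1I : ofConst A (1 - e) ∈ I.radical := by
      rw [heq, mem_starIdeal]
      intro i
      rw [coe_ofConst, coeff_C]
      split_ifs
      exacts [h1e, n.zero_mem]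
    obtain ⟨k, hk⟩ := h1I
    have hidem : IsIdempotentElem (1 - e) := IsIdempotentElem.one_sub he
    have h1 : ofConst A (1 - e) ∈ I := by
      have := I.mul_mem_right (ofConst A (1 - e)) hk
      rwa [← pow_succ, ← map_pow, hidem.pow_succ_eq] at this
    have hfe : f = ofConst A (1 - e) * f := by
      have hef : ofConst A e * f = 0 := Subtype.ext (by
        rw [hex]
        simp only [Subring.coe_mul, coe_ofConst, C_mul, Subring.coe_zero]
        linear_combination C (x : B) * hsf)
      rw [map_sub, map_one, sub_mul, one_mul, hef, sub_zero]
    rw [hfe]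
    exact I.mul_mem_right _ h1
  rw [hIeq]
  exact Ideal.IsPrime.isPrimary inferInstance

end Star

/-! ### Local rings sharing their maximal ideal with a discrete valuation ring -/

section PseudoValuation

variable {T : Type*} [CommRing T] [IsLocalRing T]

/-- A discrete valuation on a local ring `T` whose valuation ring has the same maximal ideal
as `T`. -/
structure IsPseudoValuation (v : Valuation T (WithZero (Multiplicative ℤ))) : Prop where
  eq_zero : ∀ t, v t = 0 → t = 0
  le_one : ∀ t, v t ≤ 1
  lt_one_iff : ∀ t, v t < 1 ↔ t ∈ IsLocalRing.maximalIdeal T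
  exists_eq_mul : ∀ a b, v a < v b → ∃ c ∈ IsLocalRing.maximalIdeal T, a = c * b
  exists_ne_zero : ∃ t ∈ IsLocalRing.maximalIdeal T, t ≠ 0

variable {v : Valuation T (WithZero (Multiplicative ℤ))}

namespace IsPseudoValuation

theorem ne_zero (h : IsPseudoValuation v) {t : T} (ht : t ≠ 0) : v t ≠ 0 :=
  fun h0 => ht (h.eq_zero t h0)

theorem isDomain (h : IsPseudoValuation v) : IsDomain T := by
  have : NoZeroDivisors T := ⟨fun {a b} hab => by
    have : v a * v b = 0 := by rw [← map_mul, hab, map_zero]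
    exact (mul_eq_zero.1 this).imp (h.eq_zero a) (h.eq_zero b)⟩
  exact NoZeroDivisors.to_isDomain T

theorem exists_pow_eq_mul (h : IsPseudoValuation v) {x y : T} (hx : x ≠ 0)
    (hy : y ∈ IsLocalRing.maximalIdeal T) :
    ∃ k, ∃ c ∈ IsLocalRing.maximalIdeal T, y ^ k = c * x := by
  obtain ⟨k, hk⟩ := exists_pow_lt₀ ((h.lt_one_iff y).2 hy) (Units.mk0 (v x) (h.ne_zero hx))
  rw [← map_pow] at hk
  exact ⟨k, h.exists_eq_mul _ _ hk⟩

theorem ringKrullDim_eq_one (h : IsPseudoValuation v) : ringKrullDim T = 1 := by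
  have := h.isDomain
  refine ringKrullDim_eq_one_iff_of_isLocalRing_isDomain.2 ⟨fun hf => ?_, fun x hx y hy => ?_⟩
  · obtain ⟨t, ht, ht0⟩ := h.exists_ne_zero
    rw [IsLocalRing.isField_iff_maximalIdeal_eq.1 hf] at ht
    exact ht0 ht
  · obtain ⟨k, c, -, hc⟩ := h.exists_pow_eq_mul hx hy
    exact ⟨k, hc ▸ Ideal.mul_mem_left _ _ (Ideal.mem_span_singleton_self x)⟩

theorem isPVD (h : IsPseudoValuation v) : IsPVD T := by
  have hdom := h.isDomain
  refine ⟨hdom, fun P hP x y hxy => ?_⟩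
  rcases (IsLocalRing.le_maximalIdeal hP.ne_top).eq_or_lt with rfl | hlt
  · obtain ⟨p, hp, hpxy⟩ := hxy
    obtain ⟨a, b, hb, rfl⟩ := IsFractionRing.div_surjective (A := T) x
    obtain ⟨c, d, hd, rfl⟩ := IsFractionRing.div_surjective (A := T) y
    have hb0 := IsFractionRing.to_map_ne_zero_of_mem_nonZeroDivisors (K := FractionRing T) hb
    have hd0 := IsFractionRing.to_map_ne_zero_of_mem_nonZeroDivisors (K := FractionRing T) hd
    have hac : a * c = p * (b * d) := by
      apply IsFractionRing.injective T (FractionRing T)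
      simp only [map_mul]
      rw [Algebra.linearMap_apply] at hpxy
      rw [hpxy]
      field_simp
    have hv : v a * v c < v b * v d := by
      rw [← map_mul, ← map_mul, hac, map_mul]
      refine mul_lt_of_lt_one_left ?_ ((h.lt_one_iff p).2 hp)
      rw [zero_lt_iff]
      exact h.ne_zero (nonZeroDivisors.ne_zero (mul_mem hb hd))
    have hor : v a < v b ∨ v c < v d := by
      by_contra! hcon
      exact absurd hv (not_lt.2 (mul_le_mul' hcon.1 hcon.2))
    refine hor.imp (fun hab => ?_) fun hcd => ?_
    · obtain ⟨e, he, rfl⟩ := h.exists_eq_mul _ _ hab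
      refine ⟨e, he, ?_⟩
      rw [Algebra.linearMap_apply, map_mul, mul_div_cancel_right₀ _ hb0]
    · obtain ⟨e, he, rfl⟩ := h.exists_eq_mul _ _ hcd
      refine ⟨e, he, ?_⟩
      rw [Algebra.linearMap_apply, map_mul, mul_div_cancel_right₀ _ hd0]
  · obtain rfl := eq_bot_of_ringKrullDim_eq_one h.ringKrullDim_eq_one hP hlt
    simpa [IsLocalization.coeSubmodule_bot] using hxy

/-- A divisorial ideal that contains `y` and is bounded by the value of `y` is generated by `y` or
contains every element of value at most that of `y`. -/
theorem eq_span_or_forall_mem (h : IsPseudoValuation v) {I : Ideal T} (hI : IsDivisorialIdeal I)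
    {y : T} (hy : y ∈ I) (hy0 : y ≠ 0) :
    I = Ideal.span {y} ∨ ∀ w, v w ≤ v y → w ∈ I := by
  have hdom := h.isDomain
  refine or_iff_not_imp_left.2 fun hne w hw => ?_
  obtain ⟨z, hzI, hz⟩ := SetLike.exists_of_lt
    (lt_of_le_of_ne ((Ideal.span_singleton_le_iff_mem I).2 hy) (Ne.symm hne))
  let K := FractionRing T
  have hyK : algebraMap T K y ≠ 0 := by rwa [Ne, IsFractionRing.to_map_eq_zero_iff]
  suffices hmem : algebraMap T K w ∈ IsLocalization.coeSubmodule K I by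
    obtain ⟨w', hw', hww⟩ := hmem
    rwa [← IsFractionRing.injective T K hww]
  rw [← hI.2, Submodule.mem_div_iff_forall_mul_mem]
  intro x hx
  rw [Submodule.mem_div_iff_forall_mul_mem] at hx
  obtain ⟨α, hα⟩ := Submodule.mem_one.1 (hx (algebraMap T K y) ⟨y, hy, rfl⟩)
  obtain ⟨β, hβ⟩ := Submodule.mem_one.1 (hx (algebraMap T K z) ⟨z, hzI, rfl⟩)
  -- With z ∈ I outside (y), the relation forces α = xy to be a nonunit. Then wα has smaller value
  -- than y, so wx = wα / y lies in T.
  have hzy : z * α = y * β := by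
    apply IsFractionRing.injective T K
    rw [map_mul, map_mul, hα, hβ]
    ring
  have hαm : α ∈ IsLocalRing.maximalIdeal T := by
    by_contra hαm
    obtain ⟨u, hu⟩ := (not_not.1 hαm : IsUnit α).exists_right_inv
    refine hz (Ideal.mem_span_singleton.2 ⟨β * u, ?_⟩)
    linear_combination -z * hu + u * hzy
  have hlt : v (w * α) < v y := by
    rw [map_mul]
    calc v w * v α ≤ v y * v α := by gcongr
      _ < v y := mul_lt_of_lt_one_right (zero_lt_iff.2 (h.ne_zero hy0)) ((h.lt_one_iff α).2 hαm)
  obtain ⟨c, -, hc⟩ := h.exists_eq_mul _ _ hlt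
  refine Submodule.mem_one.2 ⟨c, ?_⟩
  apply mul_right_cancel₀ hyK
  rw [← map_mul, ← hc, map_mul, hα]
  ring

theorem exists_forall_le (h : IsPseudoValuation v) {S : Set T} (hS : ∃ t ∈ S, t ≠ 0) :
    ∃ y ∈ S, y ≠ 0 ∧ ∀ z ∈ S, v z ≤ v y := by
  let f : T → ℕ := fun t => (-WithZero.log (v t)).toNat
  obtain ⟨t, htS, ht0⟩ := hS
  obtain ⟨y, ⟨hyS, hy0⟩, hy⟩ := exists_minimalFor_of_wellFoundedLT (fun t => t ∈ S ∧ t ≠ 0) f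
    ⟨t, htS, ht0⟩
  refine ⟨y, hyS, hy0, fun z hz => ?_⟩
  by_cases hz0 : z = 0
  · simp [hz0]
  by_contra! hlt
  have hneg : ∀ t, t ≠ 0 → WithZero.log (v t) ≤ 0 := fun t ht => by
    rw [← WithZero.log_one]
    exact (WithZero.log_le_log (h.ne_zero ht) one_ne_zero).2 (h.le_one t)
  have h1 := (WithZero.log_lt_log (h.ne_zero hy0) (h.ne_zero hz0)).2 hlt
  have h2 := hneg z hz0
  have hfz : f z < f y := by
    simp only [f]
    omega
  exact absurd (hy ⟨hz, hz0⟩ hfz.le) (not_le.2 hfz)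

/-- Take y of largest value in the union of the chain. Once y is reached, each member is (y) or the
set of all elements of value at most that of y, so the chain can grow at most once more. -/
theorem isMoriDomain (h : IsPseudoValuation v) : IsMoriDomain T := by
  have hdom := h.isDomain
  refine ⟨hdom, fun I hI => ?_⟩
  obtain ⟨y, hyU, hy0, hy⟩ := h.exists_forall_le (S := {t | ∃ n, t ∈ I n}) (by
    obtain ⟨t, ht, ht0⟩ := Submodule.exists_mem_ne_zero_of_ne_bot (hI 0).1
    exact ⟨t, ⟨0, ht⟩, ht0⟩)
  obtain ⟨N, hN⟩ := hyU
  by_cases hbig : ∃ n, N ≤ n ∧ ∀ w, v w ≤ v y → w ∈ I n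
  · obtain ⟨n, -, hn⟩ := hbig
    exact ⟨n, fun m hm => le_antisymm (fun z hz => hn z (hy z ⟨m, hz⟩)) (I.monotone hm)⟩
  · push Not at hbig
    have hspan : ∀ n, N ≤ n → I n = Ideal.span {y} := fun n hn =>
      (h.eq_span_or_forall_mem (hI n) (I.monotone hn hN) hy0).resolve_right fun hall => by
        obtain ⟨w, hw, hwI⟩ := hbig n hn
        exact hwI (hall w hw)
    exact ⟨N, fun m hm => by rw [hspan m hm, hspan N le_rfl]⟩

/-- A pseudo-valuation whose valuation ring is all of `T`. -/
theorem isDVR (h : IsPseudoValuation v) (hle : ∀ a b, b ≠ 0 → v a ≤ v b → ∃ c, a = c * b) :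
    IsDVR T := by
  have hdom := h.isDomain
  refine ⟨hdom, ?_⟩
  obtain ⟨t, ht⟩ := h.exists_ne_zero
  obtain ⟨π, hπm, hπ0, hπ⟩ := h.exists_forall_le (S := (IsLocalRing.maximalIdeal T : Set T)) ⟨t, ht⟩
  have hdvd : ∀ z ∈ IsLocalRing.maximalIdeal T, π ∣ z := fun z hz => by
    obtain ⟨c, rfl⟩ := hle z π hπ0 (hπ z hz)
    exact dvd_mul_left _ _
  have hirr : Irreducible π := by
    refine ⟨hπm, fun a b hab => ?_⟩
    by_contra! hcon
    obtain ⟨c, rfl⟩ := hdvd a hcon.1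
    refine hcon.2 (IsUnit.of_mul_eq_one c ?_)
    refine mul_left_cancel₀ hπ0 ?_
    linear_combination -hab
  refine IsDiscreteValuationRing.ofHasUnitMulPowIrreducibleFactorization ⟨π, hirr, fun {x} hx => ?_⟩
  obtain ⟨k, c, hcm, hc⟩ := h.exists_pow_eq_mul hx hπm
  have hfin : FiniteMultiplicity π x := by
    refine ⟨k, fun ⟨d, hd⟩ => ?_⟩
    have hone : c * (d * π) = 1 := by
      refine mul_left_cancel₀ (pow_ne_zero k hπ0) ?_
      rw [pow_succ] at hd
      linear_combination (-1 : T) * hc - c * hd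
    exact hcm (IsUnit.of_mul_eq_one _ hone)
  obtain ⟨u, hu, hndvd⟩ := hfin.exists_eq_pow_mul_and_not_dvd
  have huu : IsUnit u := by
    by_contra huu
    exact hndvd (hdvd u huu)
  refine ⟨multiplicity π x, huu.unit, ?_⟩
  rw [IsUnit.unit_spec, ← hu]

end IsPseudoValuation

theorem IsPVD.isPVR (h : IsPVD T) : IsPVR T := by
  obtain ⟨hdom, hstrong⟩ := h
  refine ⟨IsLocalRing.maximalIdeal T, inferInstance, fun a b => ?_⟩
  refine or_iff_not_imp_left.2 fun hno => ?_
  rw [Ideal.span_singleton_mul_le_iff] at hno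
  push Not at hno
  obtain ⟨p, hp, hpb⟩ := hno
  rw [Ideal.mem_span_singleton] at hpb
  by_cases hb : b = 0
  · simp [hb]
  have hb0 : algebraMap T (FractionRing T) b ≠ 0 := by rwa [Ne, IsFractionRing.to_map_eq_zero_iff]
  have ha0 : algebraMap T (FractionRing T) a ≠ 0 := by
    rw [Ne, IsFractionRing.to_map_eq_zero_iff]
    rintro rfl
    exact hpb (by simp)
  -- With p in the maximal ideal and ap ∉ (b), strong primeness is applied to (b / a) * (ap / b) =
  -- p.
  rcases hstrong (IsLocalRing.maximalIdeal T) inferInstance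
    (algebraMap T (FractionRing T) b / algebraMap T (FractionRing T) a)
    (algebraMap T (FractionRing T) a * algebraMap T (FractionRing T) p /
      algebraMap T (FractionRing T) b)
    ⟨p, hp, by change algebraMap T (FractionRing T) p = _; field_simp⟩ with h1 | h1
  · obtain ⟨c, hc, hcb⟩ := h1
    rw [Ideal.span_singleton_le_iff_mem, Ideal.mem_span_singleton_mul]
    refine ⟨c, hc, IsFractionRing.injective T (FractionRing T) ?_⟩
    rw [Algebra.linearMap_apply] at hcb
    rw [map_mul, hcb, mul_div_cancel₀ _ ha0]
  · obtain ⟨c, hc, hcb⟩ := h1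
    refine absurd ⟨c, IsFractionRing.injective T (FractionRing T) ?_⟩ hpb
    rw [Algebra.linearMap_apply] at hcb
    rw [map_mul, map_mul, hcb, mul_div_cancel₀ _ hb0]

end PseudoValuation

/-! ### Passing a valuation of R to a localization -/

section LocalizedValuation

variable {R : Type*} [CommRing R] (M : Ideal R) [M.IsPrime]
  (v : Valuation R (WithZero (Multiplicative ℤ)))

/-- A valuation of `R` centred at `M` that induces a pseudo-valuation on the localization at `M`. -/
structure IsPseudoValuationAt : Prop where
  exists_mul_eq_zero : ∀ r, v r = 0 → ∃ s ∉ M, s * r = 0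
  eq_one : ∀ r ∉ M, v r = 1
  lt_one : ∀ r ∈ M, v r < 1
  exists_mul_eq : ∀ a b, v a < v b → ∃ s ∉ M, ∃ c ∈ M, s * a = c * b
  exists_ne_zero : ∃ r ∈ M, v r ≠ 0

variable {M v}

theorem IsPseudoValuationAt.le_supp (h : IsPseudoValuationAt M v) :
    M.primeCompl ≤ v.supp.primeCompl := fun s hs hsupp => by
  have h1 := h.eq_one s hs
  rw [(Valuation.mem_supp_iff v s).1 hsupp] at h1
  exact zero_ne_one h1

theorem IsPseudoValuationAt.extend_mk' (h : IsPseudoValuationAt M v) (r : R) (s : M.primeCompl) :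
    v.extendToLocalization h.le_supp (Localization.AtPrime M) (IsLocalization.mk' _ r s) = v r := by
  rw [Valuation.extendToLocalization_mk', h.eq_one s s.2, inv_one, mul_one]

theorem IsPseudoValuationAt.isPseudoValuation (h : IsPseudoValuationAt M v) :
    IsPseudoValuation (v.extendToLocalization h.le_supp (Localization.AtPrime M)) where
  eq_zero t ht := by
    obtain ⟨r, s, rfl⟩ := IsLocalization.exists_mk'_eq M.primeCompl t
    rw [h.extend_mk'] at ht
    obtain ⟨u, hu, hur⟩ := h.exists_mul_eq_zero r ht
    exact (IsLocalization.mk'_eq_zero_iff r s).2 ⟨⟨u, hu⟩, hur⟩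
  le_one t := by
    obtain ⟨r, s, rfl⟩ := IsLocalization.exists_mk'_eq M.primeCompl t
    rw [h.extend_mk']
    by_cases hr : r ∈ M
    exacts [(h.lt_one r hr).le, (h.eq_one r hr).le]
  lt_one_iff t := by
    obtain ⟨r, s, rfl⟩ := IsLocalization.exists_mk'_eq M.primeCompl t
    rw [h.extend_mk', IsLocalization.AtPrime.mk'_mem_maximal_iff _ M]
    refine ⟨fun hlt => ?_, h.lt_one r⟩
    by_contra hr
    exact hlt.ne (h.eq_one r hr)
  exists_eq_mul a b hab := by
    obtain ⟨r, s, rfl⟩ := IsLocalization.exists_mk'_eq M.primeCompl a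
    obtain ⟨r', s', rfl⟩ := IsLocalization.exists_mk'_eq M.primeCompl b
    rw [h.extend_mk', h.extend_mk'] at hab
    obtain ⟨u, hu, c, hc, huc⟩ := h.exists_mul_eq _ _ hab
    refine ⟨IsLocalization.mk' _ (c * s') (⟨u, hu⟩ * s), ?_, ?_⟩
    · rw [IsLocalization.AtPrime.mk'_mem_maximal_iff _ M]
      exact M.mul_mem_right _ hc
    · rw [← IsLocalization.mk'_mul, IsLocalization.mk'_eq_iff_eq]
      congr 1
      simp only [Submonoid.coe_mul]
      linear_combination (s : R) * (s' : R) * huc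
  exists_ne_zero := by
    obtain ⟨r, hr, hv⟩ := h.exists_ne_zero
    refine ⟨algebraMap R _ r, (IsLocalization.AtPrime.to_map_mem_maximal_iff _ M r).2 hr, ?_⟩
    intro h0
    refine hv ?_
    rw [← Valuation.extendToLocalization_apply_map_apply v h.le_supp (Localization.AtPrime M), h0,
      map_zero]

theorem IsPseudoValuationAt.isDVR (h : IsPseudoValuationAt M v)
    (hle : ∀ a b, v b ≠ 0 → v a ≤ v b → ∃ s ∉ M, ∃ c, s * a = c * b) :
    IsDVR (Localization.AtPrime M) := by
  refine h.isPseudoValuation.isDVR fun a b hb hab => ?_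
  have hvb := h.isPseudoValuation.ne_zero hb
  obtain ⟨r, s, rfl⟩ := IsLocalization.exists_mk'_eq M.primeCompl a
  obtain ⟨r', s', rfl⟩ := IsLocalization.exists_mk'_eq M.primeCompl b
  rw [h.extend_mk'] at hvb
  rw [h.extend_mk', h.extend_mk'] at hab
  obtain ⟨u, hu, c, huc⟩ := hle _ _ hvb hab
  refine ⟨IsLocalization.mk' _ (c * s') (⟨u, hu⟩ * s), ?_⟩
  rw [← IsLocalization.mk'_mul, IsLocalization.mk'_eq_iff_eq]
  congr 1
  simp only [Submonoid.coe_mul]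
  linear_combination (s : R) * (s' : R) * huc

end LocalizedValuation

/-! ### Valuations from polynomial rings over residue fields -/

section Residue

open IsDedekindDomain

variable {B : Type u} [CommRing B] (A : Subring B)

/-- Reduction of the coefficients along `φ`. -/
noncomputable def reduceHom {L : Type*} [Field L] (φ : B →+* L) : subringAddXMul A →+* L[X] :=
  (Polynomial.mapRingHom φ).comp (subringAddXMul A).subtype

theorem reduceHom_apply {L : Type*} [Field L] (φ : B →+* L) (f : subringAddXMul A) :
    reduceHom A φ f = (f : B[X]).map φ := rfl

theorem reduceHom_eq_zero_iff {L : Type*} [Field L] (φ : B →+* L) (f : subringAddXMul A) :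
    reduceHom A φ f = 0 ↔ ∀ i, (f : B[X]).coeff i ∈ RingHom.ker φ := by
  simp [reduceHom_apply, Polynomial.ext_iff]

theorem exists_reduceHom_eq_X_mul {L : Type*} [Field L] {φ : B →+* L}
    (hφ : Function.Surjective φ) (g : L[X]) : ∃ f, reduceHom A φ f = X * g := by
  obtain ⟨f, rfl⟩ := Polynomial.map_surjective φ hφ g
  exact ⟨mulX A f, by simp [reduceHom_apply]⟩

theorem exists_reduceHom_eq_of_coeff_zero {L : Type*} [Field L] {φ : B →+* L}
    (hφ : Function.Surjective φ) (g : L[X]) (hg : g.coeff 0 = 1) :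
    ∃ f, reduceHom A φ f = g := by
  obtain ⟨f, hf⟩ := exists_reduceHom_eq_X_mul A hφ g.divX
  refine ⟨1 + f, ?_⟩
  rw [map_add, map_one, hf]
  nth_rw 2 [← X_mul_divX_add g]
  rw [hg, C_1, add_comm]

variable {A}

/-- Each maximal ideal of `A + X B[X]` is the contraction of a nonzero prime ideal of the
polynomial ring over a residue field of `B`. -/
theorem IsLocallyFieldExtension.exists_heightOneSpectrum (h : IsLocallyFieldExtension A)
    (M : Ideal (subringAddXMul A)) [hM : M.IsMaximal] :
    ∃ (L : Type u) (_ : Field L) (φ : B →+* L) (N : HeightOneSpectrum L[X]),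
      Function.Surjective φ ∧ M = N.asIdeal.comap (reduceHom A φ) := by
  have hA := h.1
  have hB := h.krullDimLE
  by_cases hX : mulX A 1 ∈ M
  · obtain ⟨p, hp, rfl⟩ := exists_eq_overIdeal A hM.isPrime hX
    obtain ⟨n, hn, rfl⟩ := exists_comap_subtype_eq p hp
    have hnmax : n.IsMaximal := hn.isMaximal'
    refine ⟨B ⧸ n, Ideal.Quotient.field n, Ideal.Quotient.mk n,
      ⟨RingHom.ker (Polynomial.constantCoeff (R := B ⧸ n)), ?_, ?_⟩,
      Ideal.Quotient.mk_surjective, ?_⟩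
    · exact RingHom.ker_isPrime _
    · intro h0
      have : (X : (B ⧸ n)[X]) ∈ RingHom.ker (Polynomial.constantCoeff (R := B ⧸ n)) := by
        simp
      rw [h0] at this
      exact X_ne_zero this
    · ext f
      rw [mem_overIdeal, Ideal.mem_comap, Ideal.mem_comap, RingHom.mem_ker]
      change _ ↔ ((f : B[X]).map (Ideal.Quotient.mk n)).coeff 0 = 0
      rw [coeff_map, Ideal.Quotient.eq_zero_iff_mem]
      rfl
  · have hN := lowIdeal_isPrime A hM.isPrime hX
    set n : Ideal B := (lowIdeal A M).comap C with hn_def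
    have hn : n.IsPrime := Ideal.comap_isPrime C _
    have hnmax : n.IsMaximal := hn.isMaximal'
    let φ := Ideal.Quotient.mk n
    have hφ : Function.Surjective (Polynomial.mapRingHom φ) :=
      Polynomial.map_surjective φ Ideal.Quotient.mk_surjective
    have hker : RingHom.ker (Polynomial.mapRingHom φ) ≤ lowIdeal A M := by
      intro f hf
      have hfn : f ∈ n.map C := by
        rw [Ideal.mem_map_C_iff]
        intro i
        rw [← Ideal.Quotient.eq_zero_iff_mem]
        have := congrArg (fun g => coeff g i) ((RingHom.mem_ker).1 hf)
        simpa using this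
      exact (Ideal.map_le_iff_le_comap.2 le_rfl : n.map C ≤ lowIdeal A M) hfn
    have hcm : ((lowIdeal A M).map (Polynomial.mapRingHom φ)).comap (Polynomial.mapRingHom φ) =
        lowIdeal A M := by
      rw [Ideal.comap_map_of_surjective' _ hφ, sup_eq_left]
      exact hker
    have hMeq : M = ((lowIdeal A M).map (Polynomial.mapRingHom φ)).comap
        ((Polynomial.mapRingHom φ).comp (subringAddXMul A).subtype) := by
      rw [← Ideal.comap_comap, hcm, comap_lowIdeal_of_isPrime A hM.isPrime hX]
    refine ⟨B ⧸ n, Ideal.Quotient.field n, φ,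
      ⟨(lowIdeal A M).map (Polynomial.mapRingHom φ), ?_, ?_⟩, Ideal.Quotient.mk_surjective, hMeq⟩
    · exact Ideal.map_isPrime_of_surjective hφ hker
    · intro h0
      -- A zero image would place M inside n[X] ∩ R, which is strictly below another proper ideal
      -- and so not maximal.
      have hle : M ≤ starIdeal A n := by
        intro f hf
        rw [hMeq] at hf
        rw [mem_starIdeal]
        intro i
        rw [← Ideal.Quotient.eq_zero_iff_mem]
        have h1 : (f : B[X]).map φ = 0 := by
          have h2 : (f : B[X]).map φ ∈ (lowIdeal A M).map (Polynomial.mapRingHom φ) := hf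
          rw [h0] at h2
          exact h2
        simpa using congrArg (fun g => coeff g i) h1
      have hlt := starIdeal_lt_overIdeal A hn.ne_top
      have heq := hM.eq_of_le (Ideal.IsPrime.ne_top inferInstance) hle
      rw [← heq] at hlt
      exact hlt.ne (hM.eq_of_le (Ideal.IsPrime.ne_top inferInstance) hlt.le)

theorem exists_eq_pow_mul {L : Type*} [Field L] (N : HeightOneSpectrum L[X]) {π : L[X]}
    (hπ : N.asIdeal = Ideal.span {π}) {b : L[X]} (hb : b ≠ 0) :
    ∃ (j : ℕ) (b' : L[X]), b' ∉ N.asIdeal ∧ b = π ^ j * b' ∧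
      (∀ a, N.intValuation a ≤ N.intValuation b → π ^ j ∣ a) ∧
      ∀ a, N.intValuation a < N.intValuation b → π ^ (j + 1) ∣ a := by
  have hπp : Prime π := by
    rw [← Ideal.span_singleton_prime, ← hπ]
    · exact N.isPrime
    · rintro rfl
      exact N.ne_bot (by simpa using hπ)
  obtain ⟨b', hb', hndvd⟩ := (FiniteMultiplicity.of_prime_left hπp hb).exists_eq_pow_mul_and_not_dvd
  have hb'N : b' ∉ N.asIdeal := by rwa [hπ, Ideal.mem_span_singleton]
  have hdvd : ∀ (k : ℕ) (a : L[X]), N.intValuation a ≤ WithZero.exp (-(k : ℤ)) → π ^ k ∣ a := by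
    intro k a ha
    rwa [N.intValuation_le_pow_iff_mem, hπ, Ideal.span_singleton_pow,
      Ideal.mem_span_singleton] at ha
  have hvb : N.intValuation b = WithZero.exp (-(multiplicity π b : ℤ)) := by
    conv_lhs => rw [hb', map_mul, map_pow, HeightOneSpectrum.intValuation_eq_one_iff.2 hb'N,
      mul_one, N.intValuation_singleton hπp.ne_zero hπ, ← WithZero.exp_nsmul]
    simp
  refine ⟨multiplicity π b, b', hb'N, hb', fun a ha => hdvd _ a (hvb ▸ ha), fun a ha => ?_⟩
  rcases eq_or_ne a 0 with rfl | ha0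
  · exact dvd_zero _
  have hva := N.intValuation_ne_zero a ha0
  refine hdvd _ a ?_
  rw [hvb, ← WithZero.log_lt_iff_lt_exp hva] at ha
  rw [← WithZero.log_le_iff_le_exp hva]
  push_cast
  omega

theorem IsLocallyFieldExtension.exists_mul_eq_zero_of_reduceHom_eq_zero
    (h : IsLocallyFieldExtension A) {L : Type*} [Field L] {φ : B →+* L} (N : HeightOneSpectrum L[X])
    (f : subringAddXMul A) (hf : reduceHom A φ f = 0) :
    ∃ s ∉ N.asIdeal.comap (reduceHom A φ), s * f = 0 := by
  obtain ⟨s, hs, hsf⟩ := h.exists_C_mul_eq_zero (RingHom.ker_isPrime φ)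
    ((reduceHom_eq_zero_iff A φ f).1 hf)
  refine ⟨ofConst A s, fun hmem => ?_, Subtype.ext hsf⟩
  rw [Ideal.mem_comap, reduceHom_apply, coe_ofConst, map_C] at hmem
  refine N.isPrime.ne_top (Ideal.eq_top_of_isUnit_mem _ hmem ?_)
  exact isUnit_C.2 (isUnit_iff_ne_zero.2 hs)

theorem IsLocallyFieldExtension.isPseudoValuationAt (h : IsLocallyFieldExtension A)
    {L : Type*} [Field L] {φ : B →+* L} (hφ : Function.Surjective φ) (N : HeightOneSpectrum L[X])
    [(N.asIdeal.comap (reduceHom A φ)).IsPrime] :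
    IsPseudoValuationAt (N.asIdeal.comap (reduceHom A φ))
      (N.intValuation.comap (reduceHom A φ)) := by
  have hzero := h.exists_mul_eq_zero_of_reduceHom_eq_zero (φ := φ) N
  obtain ⟨π, hπ⟩ : ∃ π, N.asIdeal = Ideal.span {π} :=
    (IsPrincipalIdealRing.principal N.asIdeal).principal
  have hπ0 : π ≠ 0 := by
    rintro rfl
    exact N.ne_bot (by simpa using hπ)
  refine ⟨fun r hr => ?_, fun r hr => ?_, fun r hr => ?_, fun a b hab => ?_, ?_⟩
  · refine hzero r ?_
    by_contra h0
    exact N.intValuation_ne_zero _ h0 hr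
  · exact HeightOneSpectrum.intValuation_eq_one_iff.2 hr
  · exact (N.intValuation_lt_one_iff_mem _).2 hr
  · have hb0 : reduceHom A φ b ≠ 0 := by
      intro h0
      rw [Valuation.comap_apply, Valuation.comap_apply, h0, map_zero] at hab
      exact not_lt_zero hab
    obtain ⟨j, b', hb'N, hb', -, hdvd⟩ := exists_eq_pow_mul N hπ hb0
    obtain ⟨a', ha'⟩ := hdvd _ hab
    -- Only polynomials with suitable constant coefficient come from R, so a multiplier w outside N
    -- is needed. If X ∉ N, then w = X works. If X ∈ N, a constant w normalizes b' to constant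
    -- coefficient 1, while π * a' has constant coefficient 0.
    obtain ⟨w, hw, s, hs, c, hc⟩ : ∃ w ∉ N.asIdeal, ∃ s, reduceHom A φ s = w * b' ∧
        ∃ c, reduceHom A φ c = w * (π * a') := by
      by_cases hXN : X ∈ N.asIdeal
      · have hNX : ∀ g ∈ N.asIdeal, g.coeff 0 = 0 := by
          intro g hg
          by_contra hg0
          refine N.isPrime.ne_top (Ideal.eq_top_of_isUnit_mem _ (x := C (g.coeff 0)) ?_ ?_)
          · have : C (g.coeff 0) = g - X * g.divX := by
              linear_combination X_mul_divX_add g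
            rw [this]
            exact sub_mem hg (Ideal.mul_mem_right _ _ hXN)
          · exact isUnit_C.2 (isUnit_iff_ne_zero.2 hg0)
        have hb0 : b'.coeff 0 ≠ 0 := by
          intro h0
          refine hb'N ?_
          rw [← X_mul_divX_add b', h0, C_0, add_zero]
          exact Ideal.mul_mem_right _ _ hXN
        obtain ⟨s, hs⟩ := exists_reduceHom_eq_of_coeff_zero A hφ (C (b'.coeff 0)⁻¹ * b')
          (by simp [hb0])
        have hca : (C (b'.coeff 0)⁻¹ * (π * a')).coeff 0 = 0 := by
          refine hNX _ (Ideal.mul_mem_left _ _ (Ideal.mul_mem_right _ _ ?_))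
          rw [hπ]
          exact Ideal.mem_span_singleton_self π
        obtain ⟨c, hc⟩ := exists_reduceHom_eq_X_mul A hφ (C (b'.coeff 0)⁻¹ * (π * a')).divX
        refine ⟨C (b'.coeff 0)⁻¹, fun hmem => ?_, s, hs, c, ?_⟩
        · refine N.isPrime.ne_top (Ideal.eq_top_of_isUnit_mem _ hmem ?_)
          exact isUnit_C.2 (isUnit_iff_ne_zero.2 (inv_ne_zero hb0))
        · rw [hc]
          nth_rw 2 [← X_mul_divX_add (C (b'.coeff 0)⁻¹ * (π * a'))]
          rw [hca, C_0, add_zero]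
      · obtain ⟨s, hs⟩ := exists_reduceHom_eq_X_mul A hφ b'
        obtain ⟨c, hc⟩ := exists_reduceHom_eq_X_mul A hφ (π * a')
        exact ⟨X, hXN, s, hs, c, hc⟩
    obtain ⟨t, ht, htk⟩ := hzero (s * a - c * b) (by
      rw [map_sub, map_mul, map_mul, hs, hc, ha', hb']
      ring)
    refine ⟨t * s, fun hmem => ?_, t * c, Ideal.mul_mem_left _ _ ?_, by linear_combination htk⟩
    · rcases Ideal.IsPrime.mem_or_mem inferInstance hmem with h1 | h1
      · exact ht h1
      · rw [Ideal.mem_comap, hs] at h1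
        exact (N.isPrime.mem_or_mem h1).elim hw hb'N
    · rw [Ideal.mem_comap, hc, hπ]
      exact Ideal.mul_mem_left _ _ (Ideal.mul_mem_right _ _ (Ideal.mem_span_singleton_self π))
  · obtain ⟨f, hf⟩ := exists_reduceHom_eq_X_mul A hφ π
    refine ⟨f, ?_, N.intValuation_ne_zero _ ?_⟩
    · rw [Ideal.mem_comap, hf, hπ]
      exact Ideal.mul_mem_left _ _ (Ideal.mem_span_singleton_self π)
    · rw [hf]
      exact mul_ne_zero X_ne_zero hπ0

theorem IsLocallyFieldExtension.exists_isPseudoValuation (h : IsLocallyFieldExtension A)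
    (M : Ideal (subringAddXMul A)) [hM : M.IsMaximal] :
    ∃ v : Valuation (Localization.AtPrime M) (WithZero (Multiplicative ℤ)),
      IsPseudoValuation v := by
  obtain ⟨L, _, φ, N, hφ, rfl⟩ := h.exists_heightOneSpectrum M
  exact ⟨_, (h.isPseudoValuationAt hφ N).isPseudoValuation⟩

theorem IsLocallyFieldExtension.isDVR (h : IsLocallyFieldExtension A) (hA : A = ⊤)
    (M : Ideal (subringAddXMul A)) [hM : M.IsMaximal] : IsDVR (Localization.AtPrime M) := by
  obtain ⟨L, _, φ, N, hφ, rfl⟩ := h.exists_heightOneSpectrum M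
  refine (h.isPseudoValuationAt hφ N).isDVR fun a b hb hab => ?_
  have hsurj : Function.Surjective (reduceHom A φ) := fun g => by
    obtain ⟨f, rfl⟩ := Polynomial.map_surjective φ hφ g
    exact ⟨⟨f, by simp [subringAddXMul, hA]⟩, rfl⟩
  have hb0 : reduceHom A φ b ≠ 0 := by
    intro h0
    rw [Valuation.comap_apply, h0, map_zero] at hb
    exact hb rfl
  obtain ⟨π, hπ⟩ : ∃ π, N.asIdeal = Ideal.span {π} :=
    (IsPrincipalIdealRing.principal N.asIdeal).principal
  obtain ⟨j, b', hb'N, hb', hdvd, -⟩ := exists_eq_pow_mul N hπ hb0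
  obtain ⟨a', ha'⟩ := hdvd _ hab
  obtain ⟨s, hs⟩ := hsurj b'
  obtain ⟨c, hc⟩ := hsurj a'
  obtain ⟨t, ht, htk⟩ := h.exists_mul_eq_zero_of_reduceHom_eq_zero N (s * a - c * b) (by
    rw [map_sub, map_mul, map_mul, hs, hc, ha', hb']
    ring)
  refine ⟨t * s, fun hmem => ?_, t * c, by linear_combination htk⟩
  rcases hM.isPrime.mem_or_mem hmem with h1 | h1
  · exact ht h1
  · rw [Ideal.mem_comap, hs] at h1
    exact hb'N h1

end Residue

/-! ### Bézout rings are arithmetical -/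

section TotallyOrdered

variable {T : Type*} [CommRing T]

theorem le_total_of_dvd_total (h : ∀ a b : T, a ∣ b ∨ b ∣ a) (I J : Ideal T) : I ≤ J ∨ J ≤ I := by
  by_contra! hcon
  obtain ⟨a, haI, haJ⟩ := SetLike.not_le_iff_exists.1 hcon.1
  obtain ⟨b, hbJ, hbI⟩ := SetLike.not_le_iff_exists.1 hcon.2
  rcases h a b with hab | hba
  exacts [hbI (Ideal.mem_of_dvd I hab haI), haJ (Ideal.mem_of_dvd J hba hbJ)]

/-- Let (r, r') = (d), r = dx, r' = dy and d = pr + qr'. If x or y is outside M, use x * r' = y * r.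
Otherwise 1 - px - qy is outside M and kills d. -/
theorem isArithmeticalRing_of_isBezout [IsBezout T] : IsArithmeticalRing T := by
  intro M hM
  refine le_total_of_dvd_total fun a b => ?_
  obtain ⟨r, s, rfl⟩ := IsLocalization.exists_mk'_eq M.primeCompl a
  obtain ⟨r', s', rfl⟩ := IsLocalization.exists_mk'_eq M.primeCompl b
  obtain ⟨d, hd⟩ := (IsBezout.span_pair_isPrincipal r r').principal
  rw [Ideal.submodule_span_eq] at hd
  obtain ⟨x, hx⟩ := Ideal.mem_span_singleton.1
    (hd ▸ Ideal.subset_span (Set.mem_insert r {r'}) : r ∈ Ideal.span {d})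
  obtain ⟨y, hy⟩ := Ideal.mem_span_singleton.1
    (hd ▸ Ideal.subset_span (Set.mem_insert_of_mem r rfl) : r' ∈ Ideal.span {d})
  obtain ⟨p, q, hpq⟩ := Ideal.mem_span_pair.1 (hd ▸ Ideal.mem_span_singleton_self d)
  have key : ∀ r r' z w : T, z ∉ M → z * r' = w * r → ∀ s s' : M.primeCompl,
      IsLocalization.mk' (Localization.AtPrime M) r s ∣
        IsLocalization.mk' (Localization.AtPrime M) r' s' := by
    intro r r' z w hz hzr s s'
    refine ⟨IsLocalization.mk' _ (w * s) (⟨z, hz⟩ * s'), ?_⟩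
    rw [← IsLocalization.mk'_mul, IsLocalization.mk'_eq_iff_eq]
    congr 1
    simp only [Submonoid.coe_mul]
    linear_combination (s : T) * (s' : T) * hzr
  by_cases hxM : x ∈ M
  · by_cases hyM : y ∈ M
    · left
      refine key r r' (1 - p * x - q * y) 0 (fun h1 => hM.ne_top ?_) ?_ s s'
      · rw [Ideal.eq_top_iff_one]
        have : (1 : T) = (1 - p * x - q * y) + (p * x + q * y) := by ring
        rw [this]
        exact add_mem h1 (add_mem (Ideal.mul_mem_left _ _ hxM) (Ideal.mul_mem_left _ _ hyM))
      · linear_combination (1 - p * x - q * y) * hy - y * hpq + y * p * hx + y * q * hy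
    · right
      exact key r' r y x hyM (by linear_combination y * hx - x * hy) s' s
  · left
    exact key r r' x y hxM (by linear_combination x * hy - y * hx) s s'

end TotallyOrdered

/-! ### Polynomials over a von Neumann regular ring -/

section Bezout

variable {B : Type*} [CommRing B]

/-- This is Euclid's algorithm with idempotent splitting. Let e be the idempotent of the top
coefficient of the shorter polynomial. On the component 1 - e that coefficient vanishes; on e it is
invertible and cancels the top coefficient of the other. The sum of the two lengths drops on both
components. -/
theorem exists_eq_add_and_dvd_of_coeff [IsReduced B] [Ring.KrullDimLE 0 B] (n : ℕ) :
    ∀ (a b : ℕ) (f g : B[X]), a + b = n → (∀ i, a ≤ i → f.coeff i = 0) →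
      (∀ i, b ≤ i → g.coeff i = 0) → ∃ d u v p q, d = u * f + v * g ∧ f = d * p ∧ g = d * q := by
  induction n using Nat.strong_induction_on with
  | _ n ih =>
    have key : ∀ (a b : ℕ) (f g : B[X]), a ≤ b → a + b = n → (∀ i, a ≤ i → f.coeff i = 0) →
        (∀ i, b ≤ i → g.coeff i = 0) →
        ∃ d u v p q, d = u * f + v * g ∧ f = d * p ∧ g = d * q := by
      intro a b f g hle hab hf hg
      rcases a with _ | a
      · refine ⟨g, 0, 1, 0, 1, by ring, ?_, by ring⟩
        ext i
        simp [hf i (Nat.zero_le i)]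
      obtain ⟨b, rfl⟩ : ∃ b', b = b' + 1 := ⟨b - 1, by omega⟩
      obtain ⟨e, x, hee, hex, hec⟩ := exists_idempotent_dvd (f.coeff a)
      have hE : (C e * C e : B[X]) = C e := by rw [← C_mul, hee]
      obtain ⟨d₁, u₁, v₁, p₁, q₁, hd₁, hf₁, hg₁⟩ := ih (a + (b + 1)) (by omega) a (b + 1)
        (C (1 - e) * f) (C (1 - e) * g) rfl (fun i hi => by
          rw [coeff_C_mul]
          rcases hi.eq_or_lt with rfl | hi
          · rw [sub_mul, one_mul, hec, sub_self]
          · rw [hf i hi, mul_zero]) (fun i hi => by rw [coeff_C_mul, hg i hi, mul_zero])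
      obtain ⟨d₂, u₂, v₂, p₂, q₂, hd₂, hf₂, hg₂⟩ := ih (a + 1 + b) (by omega) (a + 1) b
        (C e * f) (C e * g - C (x * g.coeff b) * (X ^ (b - a) * f)) rfl
        (fun i hi => by rw [coeff_C_mul, hf i hi, mul_zero]) (fun i hi => by
          rw [coeff_sub, coeff_C_mul, coeff_C_mul, coeff_X_pow_mul', if_pos (by omega)]
          rcases hi.eq_or_lt with rfl | hi
          · rw [Nat.sub_sub_self (by omega), hex]
            ring
          · rw [hg i hi, hf _ (by omega)]
            ring)
      simp only [C_sub, C_1] at hd₁ hf₁ hg₁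
      refine ⟨(1 - C e) * d₁ + C e * d₂,
        (1 - C e) * u₁ + C e * u₂ - C e * v₂ * (C (x * g.coeff b) * X ^ (b - a)),
        (1 - C e) * v₁ + C e * v₂, (1 - C e) * p₁ + C e * p₂,
        (1 - C e) * q₁ + C e * (q₂ + C (x * g.coeff b) * X ^ (b - a) * p₂), ?_, ?_, ?_⟩
      · rw [hd₁, hd₂]
        linear_combination (u₁ * f + v₁ * g + u₂ * f + v₂ * g) * hE
      · linear_combination (1 - C e) * hf₁ + C e * hf₂ +
          (-2 * f - d₁ * p₁ - d₂ * p₂ + d₁ * p₂ + d₂ * p₁) * hE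
      · linear_combination (1 - C e) * hg₁ + C e * hg₂ +
          C e * (C (x * g.coeff b) * X ^ (b - a)) * hf₂ +
          (-2 * g - d₁ * q₁ - d₂ * q₂ + d₁ * q₂ + d₂ * q₁ + (C (x * g.coeff b) * X ^ (b - a)) *
            (d₁ * p₂ - d₂ * p₂ - f)) * hE
    intro a b f g hab hf hg
    rcases le_total a b with hle | hle
    · exact key a b f g hle hab hf hg
    · obtain ⟨d, u, v, p, q, hd, hp, hq⟩ := key b a g f hle (by omega) hg hf
      exact ⟨d, v, u, q, p, by rw [hd, add_comm], hq, hp⟩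

theorem isBezout_polynomial [IsReduced B] [Ring.KrullDimLE 0 B] : IsBezout B[X] := by
  rw [IsBezout.iff_span_pair_isPrincipal]
  intro f g
  obtain ⟨d, u, v, p, q, hd, hf, hg⟩ := exists_eq_add_and_dvd_of_coeff _ (f.natDegree + 1)
    (g.natDegree + 1) f g rfl (fun i hi => coeff_eq_zero_of_natDegree_lt hi)
    (fun i hi => coeff_eq_zero_of_natDegree_lt hi)
  refine ⟨d, le_antisymm ?_ ?_⟩
  · rw [Ideal.submodule_span_eq, Ideal.span_le, Set.insert_subset_iff,
      Set.singleton_subset_iff, SetLike.mem_coe, SetLike.mem_coe, Ideal.mem_span_singleton,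
      Ideal.mem_span_singleton]
    exact ⟨⟨p, hf⟩, ⟨q, hg⟩⟩
  · rw [Ideal.submodule_span_eq, Ideal.span_singleton_le_iff_mem, Ideal.mem_span_pair]
    exact ⟨u, v, hd.symm⟩

/-- When `A = B`, the ring `A + X B[X]` is the polynomial ring. -/
noncomputable def subringAddXMulTopEquiv : subringAddXMul (⊤ : Subring B) ≃+* B[X] :=
  (RingEquiv.subringCongr (Subring.comap_top _)).trans Subring.topEquiv

end Bezout

/-! ### The equivalences for localizations and for A = B -/

section LocalProperties

variable {B : Type u} [CommRing B] {A : Subring B}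

theorem isLocallyFieldExtension_top [Nontrivial B] (h : IsVNRegular B) :
    IsLocallyFieldExtension (⊤ : Subring B) := by
  obtain ⟨hred, hdim⟩ := isVNRegular_iff.1 h
  refine ⟨?_, fun P hP b hb => ?_⟩
  · rw [Ring.krullDimLE_iff, ringKrullDim_eq_of_ringEquiv (Subring.topEquiv (R := B))]
    exact h.2.le
  · obtain ⟨e, x, hee, hex, heb⟩ := exists_idempotent_dvd b
    refine ⟨⟨1 - e, trivial⟩, fun h1 => hP.ne_top ?_, ?_⟩
    · rw [Ideal.eq_top_iff_one]
      have h2 : (1 - e) + b * x ∈ P := add_mem h1 (P.mul_mem_right x hb)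
      rwa [← hex, sub_add_cancel] at h2
    · change (1 - e) * b = 0
      rw [sub_mul, one_mul, heb, sub_self]

theorem IsLocallyFieldExtension.ringKrullDim_eq_one [Nontrivial B] (h : IsLocallyFieldExtension A) :
    ringKrullDim (subringAddXMul A) = 1 :=
  (ringKrullDim_eq_one_iff_krullDimLE A).2 ⟨h.1, h.krullDimLE⟩

theorem isLocallyFieldExtension_of_isDomain_of_ringKrullDim_eq_one [Nontrivial B]
    (h : ∀ (M : Ideal (subringAddXMul A)) [M.IsMaximal],
      IsDomain (Localization.AtPrime M) ∧ ringKrullDim (Localization.AtPrime M) = 1) :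
    IsLocallyFieldExtension A :=
  isLocallyFieldExtension_of_eq_bot fun M _ _ hQ hlt =>
    have := (h M).1
    eq_bot_of_ringKrullDim_eq_one (h M).2 hQ hlt

theorem IsLocallyFieldExtension.isLocallyDivided (h : IsLocallyFieldExtension A) :
    IsLocallyDivided (subringAddXMul A) := by
  intro M _
  obtain ⟨v, hv⟩ := h.exists_isPseudoValuation M
  have := hv.isDomain
  exact isDividedRing_of_eq_bot fun Q hQ hlt =>
    eq_bot_of_ringKrullDim_eq_one hv.ringKrullDim_eq_one hQ hlt

theorem isVNRegular_unibranched_tfae [Nontrivial B] (A : Subring B) :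
    List.TFAE [
      ∀ (M : Ideal (subringAddXMul A)) [M.IsMaximal],
        IsMoriDomain (Localization.AtPrime M) ∧ IsPVD (Localization.AtPrime M),
      ∀ (M : Ideal (subringAddXMul A)) [M.IsMaximal],
        IsDomain (Localization.AtPrime M) ∧ ringKrullDim (Localization.AtPrime M) = 1,
      SatisfiesStar (subringAddXMul A),
      ringKrullDim (subringAddXMul A) = 1 ∧ IsLPVR (subringAddXMul A),
      ringKrullDim (subringAddXMul A) = 1 ∧ IsLocallyDivided (subringAddXMul A),
      IsVNRegular A ∧ IsVNRegular B ∧ IsUnibranched A] := by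
  rw [← isLocallyFieldExtension_iff]
  tfae_have 1 → 6 := fun h => isLocallyFieldExtension_of_eq_bot fun M _ _ hQ hlt =>
    (h M).2.eq_bot_of_isMoriDomain (h M).1 hQ hlt
  tfae_have 2 → 6 := isLocallyFieldExtension_of_isDomain_of_ringKrullDim_eq_one
  tfae_have 3 → 6 := SatisfiesStar.isLocallyFieldExtension
  tfae_have 4 → 5 := fun h => ⟨h.1, fun M _ => (h.2 M).isDividedRing⟩
  tfae_have 5 → 6 := fun h => isLocallyFieldExtension_of_divided h.1 h.2
  tfae_have 6 → 1 := fun h M _ => by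
    obtain ⟨v, hv⟩ := h.exists_isPseudoValuation M
    exact ⟨hv.isMoriDomain, hv.isPVD⟩
  tfae_have 6 → 2 := fun h M _ => by
    obtain ⟨v, hv⟩ := h.exists_isPseudoValuation M
    exact ⟨hv.isDomain, hv.ringKrullDim_eq_one⟩
  tfae_have 6 → 3 := IsLocallyFieldExtension.satisfiesStar
  tfae_have 6 → 4 := fun h => ⟨h.ringKrullDim_eq_one, fun M _ => by
    obtain ⟨v, hv⟩ := h.exists_isPseudoValuation M
    exact hv.isPVD.isPVR⟩
  tfae_finish

theorem IsArithmeticalRing.isLocallyDivided {T : Type*} [CommRing T] (h : IsArithmeticalRing T) :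
    IsLocallyDivided T := fun M _ => isDividedRing_of_le_total (h M)

theorem coeff_mul_coeff_eq_of_mul_mulX_eq {s c : subringAddXMul A} {f g : B[X]}
    (h : s * mulX A f = c * mulX A g) :
    (constHom A s : B) * f.coeff 0 = (constHom A c : B) * g.coeff 0 := by
  rw [mulX_coe_mul, mulX_coe_mul] at h
  simpa using congrArg (fun f : subringAddXMul A => (f : B[X]).coeff 1) h

theorem mem_of_forall_exists_mul_mem {b : B}
    (h : ∀ p : Ideal A, p.IsMaximal → ∃ s ∉ p, (s : B) * b ∈ A) : b ∈ A := by
  let I : Ideal A :=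
    { carrier := {t | (t : B) * b ∈ A}
      add_mem' := fun {s t} hs ht => by
        simp only [Set.mem_ofPred_eq, Subring.coe_add, add_mul] at *
        exact add_mem hs ht
      zero_mem' := by simp
      smul_mem' := fun c t ht => by
        simp only [Set.mem_ofPred_eq, smul_eq_mul, Subring.coe_mul, mul_assoc] at *
        exact mul_mem c.2 ht }
  suffices hI : I = ⊤ by
    have h1 : (1 : A) ∈ I := hI ▸ trivial
    simpa [I] using h1
  by_contra hI
  obtain ⟨p, hp, hIp⟩ := Ideal.exists_le_maximal I hI
  obtain ⟨s, hs, hsb⟩ := h p hp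
  exact hs (hIp hsb)

/-- Membership of b in A is checked locally, by comparing Xb with X at p + XB[X]. If X divides Xb,
linear coefficients give s(0)b ∈ A with s(0) ∉ p. If Xb divides X, then s(0) = c(0)b forces c(0) ∉
p, and the idempotent of c(0) multiplies b into A. -/
theorem IsArithmeticalRing.eq_top (h : IsArithmeticalRing (subringAddXMul A))
    (hA : IsLocallyFieldExtension A) : A = ⊤ := by
  rw [eq_top_iff]
  intro b _
  have := hA.1
  have := hA.isReduced
  have := isReduced_subring A
  refine mem_of_forall_exists_mul_mem fun p hp => ?_
  have hM : (overIdeal A p).IsMaximal := inferInstance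
  have hdvd : ∀ f g : subringAddXMul A,
      Ideal.span {algebraMap _ (Localization.AtPrime (overIdeal A p)) f} ≤
        Ideal.span {algebraMap _ (Localization.AtPrime (overIdeal A p)) g} →
      ∃ s ∉ overIdeal A p, ∃ c, s * f = c * g := by
    intro f g hle
    obtain ⟨t, ht⟩ := Ideal.mem_span_singleton.1 (hle (Ideal.mem_span_singleton_self _))
    obtain ⟨r, s, rfl⟩ := IsLocalization.exists_mk'_eq (overIdeal A p).primeCompl t
    rw [IsLocalization.mul_mk'_eq_mk'_of_mul, IsLocalization.eq_mk'_iff_mul_eq, ← map_mul,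
      IsLocalization.eq_iff_exists (overIdeal A p).primeCompl] at ht
    obtain ⟨c, hc⟩ := ht
    exact ⟨c * s, (c * s).2, c * r, by linear_combination hc⟩
  rcases h (overIdeal A p) (Ideal.span {algebraMap _ _ (mulX A (C b))})
    (Ideal.span {algebraMap _ _ (mulX A 1)}) with hle | hle
  · obtain ⟨s, hs, c, hsc⟩ := hdvd _ _ hle
    refine ⟨constHom A s, hs, ?_⟩
    have h1 := coeff_mul_coeff_eq_of_mul_mulX_eq hsc
    rw [coeff_C_zero, coeff_one_zero, mul_one] at h1
    rw [h1]
    exact SetLike.coe_mem _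
  · obtain ⟨s, hs, c, hsc⟩ := hdvd _ _ hle
    have h1 : (constHom A s : B) = (constHom A c : B) * b := by
      simpa using coeff_mul_coeff_eq_of_mul_mulX_eq hsc
    obtain ⟨P, hP, hPp⟩ := exists_comap_subtype_eq p hp.isPrime
    have hcp : constHom A c ∉ p := by
      intro hcp
      refine hs ?_
      rw [mem_overIdeal, ← hPp, Ideal.mem_comap]
      rw [← hPp, Ideal.mem_comap] at hcp
      change (constHom A s : B) ∈ P
      rw [h1]
      exact P.mul_mem_right b hcp
    obtain ⟨e, x, hee, hex, hec⟩ := exists_idempotent_dvd (constHom A c)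
    refine ⟨e, fun he => hcp (hec ▸ p.mul_mem_right _ he), ?_⟩
    have h2 : (e : B) * b = (x * constHom A s : A) := by
      rw [hex]
      push_cast
      rw [h1]
      ring
    rw [h2]
    exact SetLike.coe_mem _

theorem isVNRegular_top_tfae [Nontrivial B] (A : Subring B) :
    List.TFAE [
      ringKrullDim (subringAddXMul A) = 1 ∧ IsBezout (subringAddXMul A),
      ∀ (M : Ideal (subringAddXMul A)) [M.IsMaximal], IsDVR (Localization.AtPrime M),
      ringKrullDim (subringAddXMul A) = 1 ∧ IsArithmeticalRing (subringAddXMul A),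
      A = ⊤ ∧ IsVNRegular B] := by
  tfae_have 1 → 3 := fun ⟨h, _⟩ => ⟨h, isArithmeticalRing_of_isBezout⟩
  tfae_have 3 → 4 := fun ⟨h, hA⟩ => by
    have hE := isLocallyFieldExtension_of_divided h hA.isLocallyDivided
    exact ⟨hA.eq_top hE, (isLocallyFieldExtension_iff.1 hE).2.1⟩
  tfae_have 4 → 2 := by
    rintro ⟨rfl, h⟩ M _
    exact (isLocallyFieldExtension_top h).isDVR rfl M
  tfae_have 2 → 3 := fun h => by
    refine ⟨IsLocallyFieldExtension.ringKrullDim_eq_one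
      (isLocallyFieldExtension_of_isDomain_of_ringKrullDim_eq_one fun M _ => ?_), fun M _ => ?_⟩
    · obtain ⟨hdom, hdvr⟩ := h M
      exact ⟨hdom, IsDiscreteValuationRing.ringKrullDim_eq_one _⟩
    · obtain ⟨hdom, hdvr⟩ := h M
      exact le_total_of_dvd_total fun a b => ValuationRing.dvd_total a b
  tfae_have 4 → 1 := by
    rintro ⟨rfl, h⟩
    obtain ⟨hred, hdim⟩ := isVNRegular_iff.1 h
    have := isBezout_polynomial (B := B)
    exact ⟨(isLocallyFieldExtension_top h).ringKrullDim_eq_one,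
      Function.Surjective.isBezout (subringAddXMulTopEquiv (B := B)).symm.toRingHom
        (subringAddXMulTopEquiv (B := B)).symm.surjective⟩
  tfae_finish

end LocalProperties

/-! ### Artinian reduced rings and primary decompositions -/

section Artinian

variable {R : Type*} [CommRing R]

theorem iInf_isMaximal_eq_bot [IsReduced R] [Ring.KrullDimLE 0 R] :
    ⨅ m : MaximalSpectrum R, m.asIdeal = ⊥ := by
  rw [eq_bot_iff]
  intro x hx
  rw [Submodule.mem_iInf] at hx
  refine IsReduced.eq_zero x (nilpotent_iff_mem_prime.2 fun P hP => hx ⟨P, hP.isMaximal'⟩)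

theorem isSemiQuasilocal_and_isVNRegular_iff [Nontrivial R] :
    IsSemiQuasilocal R ∧ IsVNRegular R ↔ IsArtinianRing R ∧ IsReduced R := by
  rw [isVNRegular_iff]
  constructor
  · rintro ⟨hfin, hred, hdim⟩
    refine ⟨?_, hred⟩
    have : Finite (MaximalSpectrum R) :=
      (hfin.to_subtype : Finite {M : Ideal R | M.IsMaximal}).of_injective
        (fun m => ⟨m.asIdeal, m.isMaximal⟩) fun m n h => by
          ext1
          exact congrArg Subtype.val h
    let e := Ideal.quotientInfRingEquivPiQuotient (fun m : MaximalSpectrum R => m.asIdeal)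
      fun m n hmn => Ideal.isCoprime_of_isMaximal fun h => hmn (MaximalSpectrum.ext h)
    have hfield : ∀ m : MaximalSpectrum R, IsArtinianRing (R ⧸ m.asIdeal) := fun m => by
      let _ := Ideal.Quotient.field m.asIdeal
      infer_instance
    have h1 : IsArtinianRing (R ⧸ ⨅ m : MaximalSpectrum R, m.asIdeal) :=
      e.symm.surjective.isArtinianRing (f := e.symm)
    let e' := (Ideal.quotEquivOfEq (iInf_isMaximal_eq_bot (R := R))).trans (RingEquiv.quotientBot R)
    exact e'.surjective.isArtinianRing (f := e')
  · rintro ⟨hart, hred⟩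
    exact ⟨IsArtinianRing.setOfPred_isMaximal_finite R, hred, inferInstance⟩

/-- For comaximal ideals, adding K commutes with intersection: two decompositions of x are glued
along a partition of unity u + v = 1. -/
theorem sup_iInf_of_isCoprime {ι : Type*} (K : Ideal R) (f : ι → Ideal R)
    (hf : Pairwise (Function.onFun IsCoprime f)) (s : Finset ι) :
    s.inf (fun i => K ⊔ f i) ≤ K ⊔ ⨅ i ∈ s, f i := by
  classical
  induction s using Finset.induction_on with
  | empty => simp
  | insert a s ha ih =>
    rw [Finset.inf_insert, Finset.iInf_insert]
    have htop : f a ⊔ ⨅ i ∈ s, f i = ⊤ := Ideal.sup_iInf_eq_top fun i hi =>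
      Ideal.isCoprime_iff_sup_eq.1 (hf fun h => ha (h ▸ hi))
    obtain ⟨u, hu, v, hv, huv⟩ := Submodule.mem_sup.1 (htop ▸ trivial : (1 : R) ∈ f a ⊔ ⨅ i ∈ s, f i)
    rintro x ⟨hx1, hx2⟩
    obtain ⟨k₁, hk₁, i, hi, rfl⟩ := Submodule.mem_sup.1 hx1
    obtain ⟨k₂, hk₂, j, hj, hij⟩ := Submodule.mem_sup.1 (ih hx2)
    refine Submodule.mem_sup.2 ⟨k₂ * u + k₁ * v, add_mem (Ideal.mul_mem_right _ _ hk₂)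
      (Ideal.mul_mem_right _ _ hk₁), j * u + i * v, ?_, ?_⟩
    · exact add_mem ⟨Ideal.mul_mem_left _ _ hu, Ideal.mul_mem_right _ _ hj⟩
        ⟨Ideal.mul_mem_right _ _ hi, Ideal.mul_mem_left _ _ hv⟩
    · linear_combination (k₁ + i) * huv + u * hij

theorem sup_pow_le_sup_pow (I J : Ideal R) (n : ℕ) : (I ⊔ J) ^ n ≤ I ⊔ J ^ n := by
  induction n with
  | zero => simp
  | succ n ih =>
    calc (I ⊔ J) ^ (n + 1) = (I ⊔ J) ^ n * (I ⊔ J) := pow_succ _ _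
      _ ≤ (I ⊔ J ^ n) * (I ⊔ J) := Ideal.mul_mono_left ih
      _ = I * (I ⊔ J) ⊔ (J ^ n * I ⊔ J ^ n * J) := by rw [Ideal.sup_mul, Ideal.mul_sup (J ^ n)]
      _ ≤ I ⊔ J ^ (n + 1) := sup_le (le_sup_of_le_left Ideal.mul_le_left)
        (sup_le_sup Ideal.mul_le_right (pow_succ J n).ge)

/-- `I` is a finite intersection of primary ideals. -/
def HasPrimaryDecomposition (I : Ideal R) : Prop :=
  ∃ s : Finset (Ideal R), s.inf id = I ∧ ∀ ⦃J⦄, J ∈ s → J.IsPrimary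

theorem HasPrimaryDecomposition.inf {I J : Ideal R} (hI : HasPrimaryDecomposition I)
    (hJ : HasPrimaryDecomposition J) : HasPrimaryDecomposition (I ⊓ J) := by
  classical
  obtain ⟨s, rfl, hs⟩ := hI
  obtain ⟨t, rfl, ht⟩ := hJ
  refine ⟨s ∪ t, Finset.inf_union, fun J hJ => ?_⟩
  exact (Finset.mem_union.1 hJ).elim (fun h => hs h) fun h => ht h

theorem HasPrimaryDecomposition.comap {S : Type*} [CommRing S] {J : Ideal S}
    (hJ : HasPrimaryDecomposition J) (φ : R →+* S) : HasPrimaryDecomposition (J.comap φ) := by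
  classical
  obtain ⟨s, rfl, hs⟩ := hJ
  refine ⟨s.image (Ideal.comap φ), ?_, fun J hJ => ?_⟩
  · rw [Finset.inf_image]
    ext x
    simp [Submodule.mem_finsetInf, Ideal.mem_comap]
  · obtain ⟨q, hq, rfl⟩ := Finset.mem_image.1 hJ
    exact (hs hq).comap φ

theorem hasPrimaryDecomposition_inf {ι : Type*} (s : Finset ι) (f : ι → Ideal R)
    (hf : ∀ i ∈ s, f i = ⊤ ∨ (f i).IsPrimary) : HasPrimaryDecomposition (s.inf f) := by
  classical
  refine ⟨(s.filter fun i => f i ≠ ⊤).image f, ?_, fun J hJ => ?_⟩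
  · rw [Finset.inf_image]
    ext x
    simp only [Submodule.mem_finsetInf, Finset.mem_filter, Function.comp_apply, id]
    refine ⟨fun h i hi => ?_, fun h i hi => h i hi.1⟩
    by_cases hi' : f i = ⊤
    · rw [hi']; trivial
    · exact h i ⟨hi, hi'⟩
  · obtain ⟨i, hi, rfl⟩ := Finset.mem_image.1 hJ
    rw [Finset.mem_filter] at hi
    exact (hf i hi.1).resolve_left hi.2

theorem IsLasker.finite_minimalPrimes (h : IsLasker R R) (I : Ideal R) : I.minimalPrimes.Finite := by
  classical
  obtain ⟨s, rfl, hs⟩ := h I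
  refine (s.image Ideal.radical).finite_toSet.subset fun P hP => ?_
  have hPp : P.IsPrime := hP.1.1
  obtain ⟨q, hq, hqP⟩ := (Ideal.IsPrime.inf_le' hPp).1 hP.1.2
  rw [Finset.coe_image]
  refine ⟨q, hq, le_antisymm (hPp.radical_le_iff.2 hqP) ?_⟩
  exact hP.2 ⟨Ideal.isPrime_radical (hs hq), (Finset.inf_le hq).trans Ideal.le_radical⟩
    (hPp.radical_le_iff.2 hqP)

end Artinian

/-! ### The strongly Laskerian property -/

section StronglyLaskerian

variable {B : Type u} [CommRing B] {A : Subring B}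

/-- Maximal ideals m of A give minimal primes m + XB[X] over XB[X], and a finite primary
decomposition allows only finitely many. -/
theorem isSemiQuasilocal_of_isLasker [Ring.KrullDimLE 0 A] (h : IsLasker (subringAddXMul A)
    (subringAddXMul A)) : IsSemiQuasilocal A := by
  refine Set.Finite.of_injOn (f := overIdeal A) (fun p hp => ?_) (fun p _ q _ hpq => ?_)
    (h.finite_minimalPrimes (overIdeal A ⊥))
  · have hp' : p.IsMaximal := hp
    refine ⟨⟨inferInstance, (overIdeal_le_iff A).2 bot_le⟩, fun q ⟨hq, hbot⟩ hqp => ?_⟩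
    have heq := eq_overIdeal A (P := q) fun g => hbot (mulX_mem_overIdeal A ⊥ g)
    rw [heq] at hqp ⊢
    rw [overIdeal_le_iff] at hqp ⊢
    have hmax : (q.comap (ofConst A)).IsMaximal :=
      Ideal.IsPrime.isMaximal' (hI := Ideal.comap_isPrime (ofConst A) q)
    exact (hmax.eq_of_le hp'.ne_top hqp).ge
  · exact le_antisymm ((overIdeal_le_iff A).1 hpq.le) ((overIdeal_le_iff A).1 hpq.ge)

theorem isSemiQuasilocal_of_isLasker' [Ring.KrullDimLE 0 B] (h : IsLasker (subringAddXMul A)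
    (subringAddXMul A)) : IsSemiQuasilocal B := by
  refine Set.Finite.of_injOn (f := starIdeal A) (fun n hn => ?_) (fun p _ q _ hpq => ?_)
    (h.finite_minimalPrimes ⊥)
  · have hn' : n.IsMaximal := hn
    refine ⟨⟨inferInstance, bot_le⟩, fun q ⟨hq, _⟩ hqn => ?_⟩
    have hX : mulX A 1 ∉ q := fun hX => mulX_one_notMem_starIdeal A hn'.ne_top (hqn hX)
    have hlow := lowIdeal_isPrime A hq hX
    have hle : (lowIdeal A q).comap C ≤ n := fun b hb => by
      rw [Ideal.mem_comap, mem_lowIdeal_iff_of_isPrime A hq hX] at hb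
      exact (mulX_C_mem_starIdeal A).1 (hqn hb)
    have hmax : ((lowIdeal A q).comap C).IsMaximal :=
      Ideal.IsPrime.isMaximal' (hI := Ideal.comap_isPrime C _)
    have heq := hmax.eq_of_le hn'.ne_top hle
    intro f hf
    rw [← comap_lowIdeal_of_isPrime A hq hX, Ideal.mem_comap]
    have hmap : n.map C ≤ lowIdeal A q := Ideal.map_le_iff_le_comap.2 heq.ge
    exact hmap (Ideal.mem_map_C_iff.2 ((mem_starIdeal A).1 hf))
  · exact le_antisymm ((starIdeal_le_iff A).1 hpq.le) ((starIdeal_le_iff A).1 hpq.ge)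

theorem exists_coe_eq_X_pow_mul {n : ℕ} {f : subringAddXMul A} (hf : f ∈ overIdeal A ⊥ ^ n) :
    ∃ g, (f : B[X]) = X ^ n * g := by
  have h1 : (overIdeal A ⊥).map (subringAddXMul A).subtype ≤ Ideal.span {X} := by
    rw [Ideal.map_le_iff_le_comap]
    intro f hf
    rw [Ideal.mem_comap, Ideal.mem_span_singleton, X_dvd_iff]
    exact congrArg Subtype.val ((Submodule.mem_bot A).1 hf)
  have h2 := Ideal.mem_map_of_mem (subringAddXMul A).subtype hf
  rw [Ideal.map_pow] at h2
  have h3 := Ideal.pow_right_mono h1 n h2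
  rwa [Ideal.span_singleton_pow, Ideal.mem_span_singleton] at h3

/-- XB[X] is an ideal of B[X] contained in R, so X times the extension of I to B[X] falls back into
I. -/
theorem mulX_mem_of_mem_map {I : Ideal (subringAddXMul A)} {f : B[X]}
    (hf : f ∈ I.map (subringAddXMul A).subtype) : mulX A f ∈ I := by
  suffices h : ∀ g, mulX A (g * f) ∈ I by simpa using h 1
  refine Submodule.span_induction ?_ ?_ ?_ ?_ hf
  · rintro _ ⟨x, hx, rfl⟩ g
    have : mulX A (g * x) = mulX A g * x := Subtype.ext (by simp [mul_assoc])
    change mulX A (g * x) ∈ I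
    rw [this]
    exact I.mul_mem_left _ hx
  · intro g
    have : mulX A (g * 0) = 0 := Subtype.ext (by simp)
    rw [this]
    exact I.zero_mem
  · intro x y _ _ hx hy g
    rw [mul_add, mulX_add]
    exact add_mem (hx g) (hy g)
  · intro a x _ hx g
    rw [smul_eq_mul, ← mul_assoc]
    exact hx (g * a)

theorem isPrimary_of_overIdeal_pow_le {m : Ideal A} [m.IsMaximal] {k : ℕ}
    {K : Ideal (subringAddXMul A)} (hK : overIdeal A m ^ k ≤ K) : K = ⊤ ∨ K.IsPrimary := by
  refine or_iff_not_imp_left.2 fun htop => ?_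
  have hle : overIdeal A m ≤ K.radical := fun x hx => ⟨k, hK (Ideal.pow_mem_pow hx k)⟩
  refine Ideal.isPrimary_of_isMaximal_radical ?_
  rw [← (inferInstance : (overIdeal A m).IsMaximal).eq_of_le (mt Ideal.radical_eq_top.1 htop) hle]
  infer_instance

theorem isLasker_of_isArtinianRing [IsArtinianRing A] [IsReduced A] [IsArtinianRing B] :
    IsLasker (subringAddXMul A) (subringAddXMul A) := by
  classical
  intro (I : Ideal (subringAddXMul A))
  change HasPrimaryDecomposition I
  set J := I.map (subringAddXMul A).subtype with hJ
  obtain ⟨k, hk⟩ := Ideal.exists_pow_inf_eq_pow_smul (Ideal.span {(X : B[X])}) J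
  -- By Artin–Rees the elements of J divisible by X ^ (k + 1) lie in XJ, and XJ is contained in I.
  have hAR : ∀ f ∈ J, X ^ (k + 1) ∣ f → ∃ g ∈ J, f = X * g := by
    intro f hf hdvd
    have h1 : f ∈ Ideal.span {(X : B[X])} ^ (k + 1) • ⊤ ⊓ J := by
      refine ⟨?_, hf⟩
      rwa [smul_eq_mul, Ideal.mul_top, Ideal.span_singleton_pow, SetLike.mem_coe,
        Ideal.mem_span_singleton]
    rw [hk (k + 1) (by omega), Nat.add_sub_cancel_left, pow_one, smul_eq_mul,
      Ideal.mem_span_singleton_mul] at h1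
    obtain ⟨g, hg, rfl⟩ := h1
    exact ⟨g, hg.2, rfl⟩
  let T : MaximalSpectrum A → Ideal (subringAddXMul A) := fun m => overIdeal A m.asIdeal ^ (k + 1)
  have := Fintype.ofFinite (MaximalSpectrum A)
  have hcop : Pairwise (Function.onFun IsCoprime T) := by
    intro m n hmn
    refine IsCoprime.pow (Ideal.isCoprime_of_isMaximal fun h => hmn (MaximalSpectrum.ext ?_))
    exact le_antisymm ((overIdeal_le_iff A).1 h.le) ((overIdeal_le_iff A).1 h.ge)
  have hT : ⨅ m ∈ (Finset.univ : Finset (MaximalSpectrum A)), T m ≤ overIdeal A ⊥ ^ (k + 1) := by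
    rw [← Ideal.prod_eq_iInf_of_pairwise_isCoprime fun m _ n _ hmn => hcop hmn,
      Finset.prod_pow]
    refine Ideal.pow_right_mono (Ideal.prod_le_inf.trans fun f hf => ?_) _
    rw [mem_overIdeal, ← iInf_isMaximal_eq_bot (R := A), Submodule.mem_iInf]
    exact fun m => (Submodule.mem_finsetInf.1 hf) m (Finset.mem_univ m)
  -- The components I ⊔ T m contain powers of maximal ideals. The rest comes from a decomposition of
  -- J in the Noetherian ring B[X].
  have hI : I = Finset.univ.inf (fun m => I ⊔ T m) ⊓ J.comap (subringAddXMul A).subtype := by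
    refine le_antisymm (le_inf (Finset.le_inf fun m _ => le_sup_left) Ideal.le_comap_map) ?_
    rintro x ⟨hx1, hx2⟩
    obtain ⟨i, hi, t, ht, rfl⟩ := Submodule.mem_sup.1 (sup_iInf_of_isCoprime I T hcop _ hx1)
    refine add_mem hi ?_
    have htJ : (t : B[X]) ∈ J := by
      have h2 : ((i + t : subringAddXMul A) : B[X]) - i ∈ J :=
        sub_mem hx2 (Ideal.mem_map_of_mem (subringAddXMul A).subtype hi)
      simpa using h2
    obtain ⟨g, hg⟩ := exists_coe_eq_X_pow_mul (hT ht)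
    obtain ⟨f, hf, hft⟩ := hAR _ htJ ⟨g, hg⟩
    have : t = mulX A f := Subtype.ext hft
    rw [this]
    exact mulX_mem_of_mem_map hf
  rw [hI]
  refine (hasPrimaryDecomposition_inf _ _ fun m _ =>
    isPrimary_of_overIdeal_pow_le (m := m.asIdeal) le_sup_right).inf (HasPrimaryDecomposition.comap ?_ _)
  exact Submodule.isLasker B[X] B[X] J

theorem isStronglyLaskerian_of_isArtinianRing [IsArtinianRing A] [IsReduced A] [IsArtinianRing B] :
    IsStronglyLaskerian (subringAddXMul A) := by
  refine ⟨isLasker_of_isArtinianRing, fun Q hQ => ?_⟩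
  have hP := Ideal.isPrime_radical hQ
  by_cases hX : mulX A 1 ∈ Q.radical
  · obtain ⟨j, hj⟩ := hX
    obtain ⟨m, hm, hQm⟩ := exists_eq_overIdeal A hP ⟨j, hj⟩
    refine ⟨j + 1, ?_⟩
    -- The constant coefficient of an element of the radical is a multiple of an idempotent of the
    -- radical, which lies in Q. Then X ^ (j + 1) B[X] ⊆ Q bounds the power, the extra X being
    -- needed because only XB[X] is inside R.
    have h1 : Q.radical ≤ Q ⊔ overIdeal A ⊥ := by
      intro f hf
      obtain ⟨g, hg⟩ := exists_eq_ofConst_add_mulX A f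
      rw [hg]
      refine add_mem (Ideal.mem_sup_left ?_) (Ideal.mem_sup_right (mulX_mem_overIdeal A ⊥ g))
      rw [hQm, mem_overIdeal] at hf
      obtain ⟨e, x, hee, hex, hea⟩ := exists_idempotent_dvd (constHom A f)
      have heQ : ofConst A e ∈ Q.radical := by
        rw [hQm, mem_overIdeal, constHom_ofConst, hex]
        exact m.mul_mem_right x hf
      obtain ⟨n, hn⟩ := heQ
      rw [← hea, map_mul]
      refine Q.mul_mem_right _ ?_
      have hidem : IsIdempotentElem (ofConst A e) := by
        rw [IsIdempotentElem, ← map_mul, hee]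
      rcases n with _ | n
      · rw [(Ideal.eq_top_iff_one Q).2 (by simpa using hn)]
        trivial
      · rwa [hidem.pow_succ_eq] at hn
    refine (Ideal.pow_right_mono h1 _).trans ((sup_pow_le_sup_pow _ _ _).trans (sup_le le_rfl ?_))
    intro f hf
    obtain ⟨g, hg⟩ := exists_coe_eq_X_pow_mul hf
    have : f = mulX A g * mulX A 1 ^ j := Subtype.ext (by simp [hg]; ring)
    rw [this]
    exact Q.mul_mem_left _ hj
  · obtain ⟨n, hn⟩ := (lowIdeal A Q).exists_radical_pow_le_of_fg
      (IsNoetherian.noetherian (lowIdeal A Q).radical)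
    refine ⟨n, ?_⟩
    nth_rw 2 [← comap_lowIdeal A hQ hX]
    rw [← Ideal.map_le_iff_le_comap, Ideal.map_pow]
    refine (Ideal.pow_right_mono ?_ n).trans hn
    rw [Ideal.map_le_iff_le_comap]
    rintro f ⟨k, hk⟩
    refine ⟨k, ?_⟩
    rw [← comap_lowIdeal A hQ hX] at hk
    simpa using hk

theorem ringKrullDim_eq_one_and_isStronglyLaskerian_and_isReduced_iff [Nontrivial B]
    (A : Subring B) :
    (ringKrullDim (subringAddXMul A) = 1 ∧ IsStronglyLaskerian (subringAddXMul A) ∧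
        IsReduced (subringAddXMul A)) ↔
      ((IsSemiQuasilocal A ∧ IsVNRegular A) ∧ (IsSemiQuasilocal B ∧ IsVNRegular B)) := by
  constructor
  · rintro ⟨hdim, hL, hred⟩
    obtain ⟨hA, hB⟩ := (ringKrullDim_eq_one_and_isReduced_iff A).1 ⟨hdim, hred⟩
    have hA0 := (isVNRegular_iff.1 hA).2
    have hB0 := (isVNRegular_iff.1 hB).2
    exact ⟨⟨isSemiQuasilocal_of_isLasker hL.1, hA⟩, isSemiQuasilocal_of_isLasker' hL.1, hB⟩
  · rintro ⟨hA, hB⟩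
    obtain ⟨hdim, hred⟩ := (ringKrullDim_eq_one_and_isReduced_iff A).2 ⟨hA.2, hB.2⟩
    obtain ⟨hA1, hA2⟩ := isSemiQuasilocal_and_isVNRegular_iff.1 hA
    obtain ⟨hB1, hB2⟩ := isSemiQuasilocal_and_isVNRegular_iff.1 hB
    exact ⟨hdim, isStronglyLaskerian_of_isArtinianRing, hred⟩

end StronglyLaskerian

/-! ### Absorbing ideals of von Neumann regular rings -/

section Absorbing

variable {R S : Type*} [CommRing R] [CommRing S]

theorem IsNAbsorbing.comap {n : ℕ} {I : Ideal S} (h : IsNAbsorbing n I) (f : R →+* S) :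
    IsNAbsorbing n (I.comap f) := by
  intro a ha
  rw [Ideal.mem_comap, map_prod] at ha
  obtain ⟨i, hi⟩ := h _ ha
  exact ⟨i, by rwa [Ideal.mem_comap, map_prod]⟩

/-- Given n + 1 distinct maximal ideals over J, choose x l in the l-th one only, and let e be the
idempotent of their product. The product times 1 - e is 0, and 1 - e avoids all these ideals.
Omitting index i leaves a product outside the i-th ideal, contrary to absorption. -/
theorem IsNAbsorbing.finite_isMaximal [IsReduced R] [Ring.KrullDimLE 0 R] {n : ℕ} {J : Ideal R}
    (h : IsNAbsorbing n J) : {m : Ideal R | m.IsMaximal ∧ J ≤ m}.Finite := by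
  by_contra hinf
  let f := Set.Infinite.natEmbedding _ hinf
  let m : Fin (n + 1) → Ideal R := fun i => (f i : Ideal R)
  have hm : ∀ i, (m i).IsMaximal := fun i => (f i).2.1
  have hne : ∀ i j, i ≠ j → m i ≠ m j := fun i j hij h => hij <| Fin.ext <|
    f.injective (Subtype.ext h)
  have hx : ∀ l, ∃ x ∈ m l, ∀ j, j ≠ l → x ∉ m j := by
    intro l
    have htop : m l ⊔ ⨅ j ∈ Finset.univ.erase l, m j = ⊤ := Ideal.sup_iInf_eq_top fun j hj =>
      (hm l).coprime_of_ne (hm j) (hne l j (Finset.ne_of_mem_erase hj).symm)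
    obtain ⟨u, hu, v, hv, huv⟩ := Submodule.mem_sup.1 (htop ▸ trivial :
      (1 : R) ∈ m l ⊔ ⨅ j ∈ Finset.univ.erase l, m j)
    refine ⟨u, hu, fun j hj huj => (hm j).ne_top ((Ideal.eq_top_iff_one _).2 ?_)⟩
    rw [← huv]
    simp only [Submodule.mem_iInf] at hv
    exact add_mem huj (hv j (Finset.mem_erase.2 ⟨hj, Finset.mem_univ j⟩))
  choose x hxm hxj using hx
  obtain ⟨e, z, -, hez, hey⟩ := exists_idempotent_dvd (∏ i, x i)
  have hu : ∀ i, 1 - e ∉ m i := by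
    intro i hi
    refine (hm i).ne_top ((Ideal.eq_top_iff_one _).2 ?_)
    have he : e ∈ m i := by
      rw [hez]
      exact (m i).mul_mem_right _ (Ideal.mem_of_dvd _ (Finset.dvd_prod_of_mem x (Finset.mem_univ i)) (hxm i))
    have := add_mem hi he
    rwa [sub_add_cancel] at this
  have hprod : ∏ i, (if i = 0 then 1 - e else 1) * x i ∈ J := by
    rw [Finset.prod_mul_distrib, Finset.prod_ite_eq' Finset.univ (0 : Fin (n + 1)),
      if_pos (Finset.mem_univ _), sub_mul, one_mul, hey, sub_self]
    exact J.zero_mem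
  obtain ⟨i, hi⟩ := h _ hprod
  obtain ⟨j, hj, hjm⟩ := ((hm i).isPrime.prod_mem_iff).1 ((f i).2.2 hi)
  refine ((hm i).isPrime.mem_or_mem hjm).elim (fun h1 => ?_) (hxj j i (Finset.ne_of_mem_erase hj).symm)
  split_ifs at h1
  · exact hu i h1
  · exact (hm i).ne_top ((Ideal.eq_top_iff_one _).2 h1)

end Absorbing

/-! ### Semi-quasilocality and products of fields -/

section Semiquasilocal

variable {B : Type u} [CommRing B] {A : Subring B}

theorem comap_ofConst_overIdeal (p : Ideal A) : (overIdeal A p).comap (ofConst A) = p := by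
  ext a
  rw [Ideal.mem_comap, mem_overIdeal, constHom_ofConst]

theorem isSemiQuasilocal_of_isFiniteAbsorbing [Nontrivial B] [IsReduced A] [Ring.KrullDimLE 0 A]
    (h : IsFiniteAbsorbing (subringAddXMul A)) : IsSemiQuasilocal A := by
  obtain ⟨n, -, hn⟩ := h (overIdeal A ⊥) fun htop => by
    have h1 := comap_ofConst_overIdeal (⊥ : Ideal A)
    rw [htop, Ideal.comap_top] at h1
    exact top_ne_bot h1
  have h1 := hn.comap (ofConst A)
  rw [comap_ofConst_overIdeal] at h1
  exact h1.finite_isMaximal.subset fun m hm => ⟨hm, bot_le⟩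

theorem isSemiQuasilocal_of_isFAFRing [Nontrivial B] [IsReduced A] [Ring.KrullDimLE 0 A]
    (h : IsFAFRing (subringAddXMul A)) : IsSemiQuasilocal A := by
  classical
  obtain ⟨n, -, hn⟩ := h
  obtain ⟨s, hs, hprod⟩ := hn (overIdeal A ⊥) fun htop => by
    have h1 := comap_ofConst_overIdeal (⊥ : Ideal A)
    rw [htop, Ideal.comap_top] at h1
    exact top_ne_bot h1
  refine Set.Finite.subset (s.toFinset.finite_toSet.biUnion (t := fun J =>
    {m : Ideal A | m.IsMaximal ∧ J.comap (ofConst A) ≤ m}) fun J hJ =>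
      ((hs J (Multiset.mem_toFinset.1 hJ)).comap (ofConst A)).finite_isMaximal) fun m hm => ?_
  have hm' : m.IsMaximal := hm
  obtain ⟨J, hJ, hJm⟩ := ((inferInstance : (overIdeal A m).IsPrime).multiset_prod_le).1
    (hprod.trans_le ((overIdeal_le_iff A).2 bot_le) : s.prod ≤ overIdeal A m)
  refine Set.mem_biUnion (Finset.mem_coe.2 (Multiset.mem_toFinset.2 hJ)) ⟨hm', ?_⟩
  rw [← comap_ofConst_overIdeal m]
  exact Ideal.comap_mono hJm

theorem IsLocallyFieldExtension.isSemiQuasilocal (h : IsLocallyFieldExtension A)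
    (hA : IsSemiQuasilocal A) : IsSemiQuasilocal B := by
  have := h.1
  refine Set.Finite.of_injOn (f := Ideal.comap A.subtype) (fun n hn => ?_)
    (fun n hn m hm hnm => ?_) hA
  · have hn' : n.IsMaximal := hn
    exact (Ideal.comap_isPrime A.subtype n).isMaximal'
  · have hn' : n.IsMaximal := hn
    have hm' : m.IsMaximal := hm
    exact le_antisymm (h.le_of_comap_le hm'.isPrime hn'.isPrime hnm.ge)
      (h.le_of_comap_le hn'.isPrime hm'.isPrime hnm.le)

/-- The image of a von Neumann regular subring in a field. -/
def imageSubfield (A : Subring B) [IsReduced A] [Ring.KrullDimLE 0 A] {L : Type*} [Field L]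
    (φ : B →+* L) : Subfield L :=
  { A.map φ with
    inv_mem' := by
      rintro _ ⟨a, ha, rfl⟩
      obtain ⟨e, x, -, hex, hea⟩ := exists_idempotent_dvd (⟨a, ha⟩ : A)
      refine ⟨x * e, (x * e).2, ?_⟩
      have hex' : (e : B) = a * x := congrArg Subtype.val hex
      have hea' : (e : B) * a = a := congrArg Subtype.val hea
      have h1 : φ (a * x) * φ a = φ a := by rw [← map_mul, ← hex', hea']
      rw [map_mul] at h1
      by_cases h0 : φ a = 0
      · rw [map_mul, hex', map_mul, h0]
        simp
      · refine eq_inv_of_mul_eq_one_left ?_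
        rw [map_mul, hex', map_mul]
        have h2 : φ a * φ x = 1 := mul_right_cancel₀ h0 (by rw [h1, one_mul])
        linear_combination (φ a * φ x + 1) * h2 }

/-- B is the product of its residue fields, with F i the image of A. If b agrees with some a ∈ A
modulo P, then b - a is killed by some s ∈ A outside P, so s * b ∈ A; these local memberships give b
∈ A. -/
theorem IsLocallyFieldExtension.exists_ringEquiv_pi (h : IsLocallyFieldExtension A)
    [IsArtinianRing B] :
    ∃ (n : ℕ) (L : Fin n → Type u) (_ : ∀ i, Field (L i)) (F : ∀ i, Subfield (L i))
        (e : B ≃+* ∀ i, L i), ∀ b : B, b ∈ A ↔ ∀ i, e b i ∈ F i := by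
  have := h.1
  have := h.isReduced
  have := isReduced_subring A
  let σ := (Finite.equivFin (MaximalSpectrum B)).symm
  let m : Fin (Nat.card (MaximalSpectrum B)) → Ideal B := fun i => (σ i).asIdeal
  have hm : ∀ i, (m i).IsMaximal := fun i => (σ i).isMaximal
  have hcop : Pairwise (Function.onFun IsCoprime m) := fun i j hij =>
    Ideal.isCoprime_of_isMaximal fun h => hij (σ.injective (MaximalSpectrum.ext h))
  have hbot : ⨅ i, m i = ⊥ := by
    rw [← iInf_isMaximal_eq_bot (R := B)]
    exact σ.iInf_comp (g := fun m : MaximalSpectrum B => m.asIdeal)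
  let φ : B →+* ∀ i, B ⧸ m i := RingHom.pi fun i => Ideal.Quotient.mk (m i)
  have hφ : Function.Bijective φ := by
    constructor
    · rw [injective_iff_map_eq_zero]
      intro b hb
      rw [← Submodule.mem_bot B, ← hbot, Submodule.mem_iInf]
      exact fun i => Ideal.Quotient.eq_zero_iff_mem.1 (congrFun hb i)
    · intro y
      obtain ⟨b, hb⟩ := Ideal.quotientInfToPiQuotient_surj hcop y
      obtain ⟨b, rfl⟩ := Ideal.Quotient.mk_surjective b
      exact ⟨b, hb⟩
  refine ⟨_, fun i => B ⧸ m i, fun i => Ideal.Quotient.field (m i),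
    fun i => @imageSubfield B _ A _ _ _ (Ideal.Quotient.field (m i)) (Ideal.Quotient.mk (m i)),
    RingEquiv.ofBijective φ hφ, fun b => ⟨fun hb i => ⟨b, hb, rfl⟩, fun hb => ?_⟩⟩
  refine mem_of_forall_exists_mul_mem fun p hp => ?_
  obtain ⟨P, hP, rfl⟩ := exists_comap_subtype_eq p hp.isPrime
  have := h.krullDimLE
  obtain ⟨i, hi⟩ := σ.surjective ⟨P, hP.isMaximal'⟩
  have hPi : m i = P := congrArg MaximalSpectrum.asIdeal hi
  obtain ⟨a, ha, hab⟩ := hb i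
  have hmem : b - a ∈ P := by
    rw [← hPi]
    exact Ideal.Quotient.eq.1 (Eq.symm hab)
  obtain ⟨s, hs, hsb⟩ := h.2 P hP _ hmem
  refine ⟨s, hs, ?_⟩
  rw [mul_sub, sub_eq_zero] at hsb
  rw [hsb]
  exact mul_mem s.2 ha

theorem nonempty_ringEquiv_pi {n : ℕ} {L : Fin n → Type u} [∀ i, Field (L i)]
    {F : ∀ i, Subfield (L i)} (e : B ≃+* ∀ i, L i) (he : ∀ b : B, b ∈ A ↔ ∀ i, e b i ∈ F i) :
    Nonempty (A ≃+* ∀ i, F i) := by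
  let φ : A →+* ∀ i, F i := RingHom.pi fun i =>
    (((Pi.evalRingHom L i).comp (e : B →+* ∀ i, L i)).comp A.subtype).codRestrict (F i)
      fun a => (he a).1 a.2 i
  refine ⟨RingEquiv.ofBijective φ ⟨fun a b hab => ?_, fun y => ?_⟩⟩
  · refine Subtype.ext (e.injective (funext fun i => ?_))
    exact congrArg Subtype.val (congrFun hab i)
  · refine ⟨⟨e.symm fun i => y i, (he _).2 fun i => ?_⟩, funext fun i => Subtype.ext ?_⟩
    · rw [e.apply_symm_apply]
      exact (y i).2
    · change e (e.symm fun i => (y i : L i)) i = y i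
      rw [e.apply_symm_apply]

theorem card_primeSpectrum_of_ringEquiv_pi {R : Type*} [CommRing R] {n : ℕ} {L : Fin n → Type*}
    [∀ i, Field (L i)] (e : R ≃+* ∀ i, L i) :
    Finite (PrimeSpectrum R) ∧ Nat.card (PrimeSpectrum R) = n := by
  let e₁ := (PrimeSpectrum.comapEquiv e).toEquiv
  let e₂ := Equiv.ofBijective _ (PrimeSpectrum.sigmaToPi_bijective L)
  let e₃ : (Σ i, PrimeSpectrum (L i)) ≃ Fin n := Equiv.sigmaUnique _ _
  let e₄ : PrimeSpectrum R ≃ Fin n := (e₁.trans e₂.symm).trans e₃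
  exact ⟨Finite.of_equiv _ e₄.symm, by rw [Nat.card_congr e₄, Nat.card_fin]⟩

/-- The isomorphisms need not be compatible: the contraction map is a surjection between two sets of
n primes, hence a bijection. -/
theorem isUnibranched_of_ringEquiv_pi {n : ℕ} {L F : Fin n → Type*} [∀ i, Field (L i)]
    [∀ i, Field (F i)] (eA : A ≃+* ∀ i, F i) (eB : B ≃+* ∀ i, L i) : IsUnibranched A := by
  obtain ⟨hfA, hA⟩ := card_primeSpectrum_of_ringEquiv_pi eA
  obtain ⟨hfB, hB⟩ := card_primeSpectrum_of_ringEquiv_pi eB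
  have hartA : IsArtinianRing A := eA.symm.surjective.isArtinianRing (f := eA.symm)
  have hsurj : Function.Surjective (PrimeSpectrum.comap A.subtype) := fun p => by
    obtain ⟨P, hP, hPp⟩ := exists_comap_subtype_eq p.asIdeal p.isPrime
    exact ⟨⟨P, hP⟩, PrimeSpectrum.ext hPp⟩
  have hbij := (Nat.bijective_iff_surjective_and_card _).2 ⟨hsurj, hB.trans hA.symm⟩
  intro P hP
  obtain ⟨Q, hQ⟩ := hsurj ⟨P, hP⟩
  refine ⟨Q.asIdeal, ⟨Q.isPrime, congrArg PrimeSpectrum.asIdeal hQ⟩, fun Q' ⟨hQ', hQP⟩ => ?_⟩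
  have : (⟨Q', hQ'⟩ : PrimeSpectrum B) = Q := hbij.1 ((PrimeSpectrum.ext hQP).trans hQ.symm)
  exact congrArg PrimeSpectrum.asIdeal this

end Semiquasilocal

/-! ### Factorization of ideals in finite products of rings -/

section ProductFactor

variable {ι : Type*} {R : ι → Type*} [∀ i, CommRing (R i)]

theorem ProperIdealsFactor.of_ringEquiv {S T : Type*} [CommRing S] [CommRing T]
    {p : Ideal T → Prop} {q : Ideal S → Prop} (h : ProperIdealsFactor T p) (e : S ≃+* T)
    (hpq : ∀ J, p J → q (J.comap (e : S →+* T))) : ProperIdealsFactor S q := by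
  intro I hI
  have hcomap : ∀ J : Ideal T, J.comap (e : S →+* T) = J.map (e.symm : T →+* S) :=
    fun J => (Ideal.map_symm e).symm
  obtain ⟨s, hs, hprod⟩ := h (I.comap (e.symm : T →+* S)) (Ideal.comap_ne_top _ hI)
  refine ⟨s.map (Ideal.comap (e : S →+* T)), fun J hJ => ?_, ?_⟩
  · obtain ⟨K, hK, rfl⟩ := Multiset.mem_map.1 hJ
    exact hpq K (hs K hK)
  · have h1 : (Ideal.comap (e : S →+* T)) = Ideal.mapHom (e.symm : T →+* S) := funext hcomap
    rw [h1, ← map_multiset_prod, hprod, ← h1]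
    ext x
    simp

open Classical in
theorem Pi.comap_evalRingHom_mul (i : ι) (J K : Ideal (R i)) :
    (J * K).comap (Pi.evalRingHom R i) =
      J.comap (Pi.evalRingHom R i) * K.comap (Pi.evalRingHom R i) := by
  refine le_antisymm (fun x hx => ?_) ?_
  · have hsingle : ∀ y ∈ J * K, (Pi.single i y : ∀ i, R i) ∈
        J.comap (Pi.evalRingHom R i) * K.comap (Pi.evalRingHom R i) := by
      intro y hy
      refine Submodule.mul_induction_on hy (fun j hj k hk => ?_) fun y z hy hz => ?_
      · rw [Pi.single_mul]
        exact Ideal.mul_mem_mul (by simpa [Ideal.mem_comap]) (by simpa [Ideal.mem_comap])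
      · rw [Pi.single_add]
        exact add_mem hy hz
    have hx' : x = Pi.single i (x i) + (1 - Pi.single i 1) * ((1 - Pi.single i 1) * x) := by
      funext j
      rcases eq_or_ne j i with rfl | hj
      · simp
      · simp [hj]
    rw [hx']
    refine add_mem (hsingle _ hx) (Ideal.mul_mem_mul ?_ ?_) <;> simp [Ideal.mem_comap]
  · rw [Ideal.mul_le]
    intro x hx y hy
    rw [Ideal.mem_comap, map_mul]
    exact Ideal.mul_mem_mul hx hy

theorem ProperIdealsFactor.pi [Finite ι] {p : ∀ i, Ideal (R i) → Prop} {q : Ideal (∀ i, R i) → Prop}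
    (h : ∀ i, ProperIdealsFactor (R i) (p i))
    (hpq : ∀ i J, p i J → q (J.comap (Pi.evalRingHom R i))) : ProperIdealsFactor (∀ i, R i) q := by
  classical
  have := Fintype.ofFinite ι
  intro I _
  have key : ∀ i (J : Ideal (R i)), ∃ s : Multiset (Ideal (∀ i, R i)), (∀ K ∈ s, q K) ∧
      s.prod = J.comap (Pi.evalRingHom R i) := by
    intro i J
    by_cases hJ : J = ⊤
    · exact ⟨0, by simp, by rw [hJ, Ideal.comap_top, Multiset.prod_zero, Ideal.one_eq_top]⟩
    obtain ⟨s, hs, rfl⟩ := h i J hJ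
    refine ⟨s.map (Ideal.comap (Pi.evalRingHom R i)), fun K hK => ?_, ?_⟩
    · obtain ⟨J, hJs, rfl⟩ := Multiset.mem_map.1 hK
      exact hpq i J (hs J hJs)
    · clear hs hJ
      induction s using Multiset.induction_on with
      | empty => simp [Ideal.one_eq_top]
      | cons a s ih =>
        rw [Multiset.map_cons, Multiset.prod_cons, Multiset.prod_cons, ih,
          Pi.comap_evalRingHom_mul]
  choose s hs hprod using fun i => key i (I.map (Pi.evalRingHom R i))
  have hsurj : ∀ i, Function.Surjective (Pi.evalRingHom R i) := fun i => Function.surjective_eval i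
  refine ⟨∑ i, s i, fun K hK => ?_, ?_⟩
  · obtain ⟨i, -, hi⟩ := Multiset.mem_sum.1 hK
    exact hs i K hi
  · rw [Multiset.prod_sum]
    simp only [hprod]
    rw [Ideal.prod_eq_iInf_of_pairwise_isCoprime]
    · refine le_antisymm (fun x hx => ?_) ?_
      · simp only [Submodule.mem_iInf, Finset.mem_univ, true_imp_iff, Ideal.mem_comap] at hx
        rw [← Finset.univ_sum_single x]
        refine sum_mem fun i _ => ?_
        obtain ⟨y, hy, hyx⟩ := (Ideal.mem_map_iff_of_surjective _ (hsurj i)).1 (hx i)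
        have : (Pi.single i (x i) : ∀ i, R i) = Pi.single i 1 * y := by
          rw [show x i = y i from hyx.symm]
          funext j
          rcases eq_or_ne j i with rfl | hj
          · simp
          · simp [hj]
        rw [this]
        exact I.mul_mem_left _ hy
      · exact le_iInf₂ fun i _ => Ideal.le_comap_map
    · intro i _ j _ hij
      refine Ideal.isCoprime_iff_exists.2 ⟨1 - Pi.single i 1, ?_, Pi.single i 1, ?_, by ring⟩
      · simp [Ideal.mem_comap]
      · simp [Ideal.mem_comap, hij.symm]

theorem Ideal.IsPrime.isNAbsorbing {R : Type*} [CommRing R] {P : Ideal R} (hP : P.IsPrime) {n : ℕ}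
    (hn : 0 < n) : IsNAbsorbing n P :=
  (IsPrimary.isNAbsorbing hP.isPrimary (by rw [hP.radical, pow_one])).mono hn

theorem isNAbsorbing_two_of_sq_le {R : Type*} [CommRing R] {M J : Ideal R} [hM : M.IsMaximal]
    (h1 : M ^ 2 ≤ J) (h2 : J ≤ M) : IsNAbsorbing 2 J := by
  have hrad : J.radical = M := le_antisymm (hM.isPrime.radical_le_iff.2 h2)
    fun x hx => ⟨2, h1 (Ideal.pow_mem_pow hx 2)⟩
  have hprim : J.IsPrimary := Ideal.isPrimary_of_isMaximal_radical (hrad ▸ hM)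
  exact IsPrimary.isNAbsorbing hprim (hrad ▸ h1)

theorem isGeneralZPI_of_isDedekindDomain {R : Type*} [CommRing R] [IsDedekindDomain R] : IsGeneralZPI R := by
  intro I hI
  by_cases h0 : I = ⊥
  · exact ⟨{⊥}, by simpa using Ideal.isPrime_bot, by simpa using h0.symm⟩
  · obtain ⟨s, hs, hprod⟩ := UniqueFactorizationMonoid.exists_prime_factors I h0
    exact ⟨s, fun J hJ => Ideal.isPrime_of_prime (hs J hJ), associated_iff_eq.1 hprod⟩

theorem exists_eq_span_singleton_mul {R : Type*} [CommRing R] {I : Ideal R} {h : R}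
    (hI : ∀ x ∈ I, h ∣ x) : ∃ J, I = Ideal.span {h} * J ∧ ∀ d, d ∈ J ↔ h * d ∈ I := by
  refine ⟨Submodule.comap (LinearMap.mulLeft R h) I, ?_, fun d => Iff.rfl⟩
  ext x
  rw [Ideal.mem_span_singleton_mul]
  constructor
  · intro hx
    obtain ⟨d, rfl⟩ := hI x hx
    exact ⟨d, hx, rfl⟩
  · rintro ⟨d, hd, rfl⟩
    exact hd

end ProductFactor

/-! ### Ideals of F + XL[X] for a field extension -/

section FieldExtension

variable {L : Type*} [Field L] {A : Subring L}

/-- The multiple of `f` with constant coefficient `1`, provided `f` does not vanish at `0`. -/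
noncomputable def normalizeAtZero (A : Subring L) (f : L[X]) : subringAddXMul A :=
  1 + mulX A (C (f.coeff 0)⁻¹ * f.divX)

theorem coe_normalizeAtZero {f : L[X]} (hf : f.coeff 0 ≠ 0) :
    (normalizeAtZero A f : L[X]) = C (f.coeff 0)⁻¹ * f := by
  nth_rw 3 [← X_mul_divX_add f]
  rw [mul_add, ← C_mul, inv_mul_cancel₀ hf]
  simp [normalizeAtZero]
  ring

theorem normalizeAtZero_mul {f g : L[X]} (hf : f.coeff 0 ≠ 0) (hg : g.coeff 0 ≠ 0) :
    normalizeAtZero A (f * g) = normalizeAtZero A f * normalizeAtZero A g := by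
  have hfg : (f * g).coeff 0 ≠ 0 := by
    rw [mul_coeff_zero]
    exact mul_ne_zero hf hg
  apply Subtype.ext
  rw [Subring.coe_mul, coe_normalizeAtZero hf, coe_normalizeAtZero hg, coe_normalizeAtZero hfg,
    mul_coeff_zero, mul_inv, C_mul]
  ring

/-- Constant coefficient 1 makes the quotient have the same constant coefficient as x, so division
in L[X] stays in R. -/
theorem exists_eq_mul_of_coe_dvd {f x : subringAddXMul A} (hf : (f : L[X]).coeff 0 = 1) {q : L[X]}
    (hx : (x : L[X]) = f * q) : ∃ d : subringAddXMul A, (d : L[X]) = q ∧ x = f * d := by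
  have hq : q.coeff 0 ∈ A := by
    have h1 := congrArg (fun g => coeff g 0) hx
    simp only [mul_coeff_zero, hf, one_mul] at h1
    rw [← h1]
    exact x.2
  exact ⟨⟨q, hq⟩, rfl, Subtype.ext hx⟩

theorem span_normalizeAtZero_isPrime {f : L[X]} (hf : Prime f) (hf0 : f.coeff 0 ≠ 0) :
    (Ideal.span {normalizeAtZero A f}).IsPrime := by
  have hp := (Ideal.span_singleton_prime hf.ne_zero).2 hf
  have heq : Ideal.span {normalizeAtZero A f} = (Ideal.span {f}).comap (subringAddXMul A).subtype := by
    ext x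
    rw [Ideal.mem_span_singleton, Ideal.mem_comap, Ideal.mem_span_singleton]
    constructor
    · rintro ⟨d, rfl⟩
      refine ⟨C (f.coeff 0)⁻¹ * d, ?_⟩
      change (normalizeAtZero A f : L[X]) * d = _
      rw [coe_normalizeAtZero hf0]
      ring
    · rintro ⟨q, hq⟩
      have h1 : (x : L[X]) = normalizeAtZero A f * (C (f.coeff 0) * q) := by
        rw [coe_normalizeAtZero hf0, mul_mul_mul_comm, ← C_mul, inv_mul_cancel₀ hf0, C_1, one_mul]
        exact hq
      obtain ⟨d, -, hd⟩ := exists_eq_mul_of_coe_dvd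
        (by rw [coe_normalizeAtZero hf0, coeff_C_mul, inv_mul_cancel₀ hf0]) h1
      exact ⟨d, hd⟩
  rw [heq]
  exact Ideal.comap_isPrime _ _

theorem exists_prod_eq_span_normalizeAtZero (f : L[X]) : f.coeff 0 ≠ 0 →
    ∃ s : Multiset (Ideal (subringAddXMul A)), (∀ J ∈ s, J.IsPrime) ∧
      s.prod = Ideal.span {normalizeAtZero A f} := by
  induction f using UniqueFactorizationMonoid.induction_on_prime with
  | h₁ => exact fun h => absurd (coeff_zero 0) h
  | h₂ f hf =>
    intro h0
    obtain ⟨u, hu, rfl⟩ := Polynomial.isUnit_iff.1 hf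
    refine ⟨0, by simp, ?_⟩
    have : normalizeAtZero A (C u) = 1 := Subtype.ext (by simp [normalizeAtZero])
    rw [this, Multiset.prod_zero, Ideal.span_singleton_one, Ideal.one_eq_top]
  | h₃ f p hf hp ih =>
    intro h0
    rw [mul_coeff_zero] at h0
    obtain ⟨s, hs, hprod⟩ := ih (right_ne_zero_of_mul h0)
    refine ⟨Ideal.span {normalizeAtZero A p} ::ₘ s, fun J hJ => ?_, ?_⟩
    · rcases Multiset.mem_cons.1 hJ with rfl | hJ
      exacts [span_normalizeAtZero_isPrime hp (left_ne_zero_of_mul h0), hs J hJ]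
    · rw [Multiset.prod_cons, hprod, normalizeAtZero_mul (left_ne_zero_of_mul h0)
        (right_ne_zero_of_mul h0), Ideal.span_singleton_mul_span_singleton]

theorem exists_map_eq_span_X_pow_mul {I : Ideal (subringAddXMul A)} (hI : I ≠ ⊥) :
    ∃ (k : ℕ) (f : L[X]), f.coeff 0 ≠ 0 ∧
      I.map (subringAddXMul A).subtype = Ideal.span {X ^ k * (normalizeAtZero A f : L[X])} := by
  obtain ⟨g, hg⟩ := (IsPrincipalIdealRing.principal (I.map (subringAddXMul A).subtype)).principal
  rw [Ideal.submodule_span_eq] at hg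
  have hg0 : g ≠ 0 := by
    rintro rfl
    refine hI ((Ideal.map_eq_bot_iff_of_injective
      (f := (subringAddXMul A).subtype) Subtype.val_injective).1 ?_)
    rw [hg, Ideal.span_singleton_eq_bot]
  obtain ⟨f, hf, hndvd⟩ :=
    (FiniteMultiplicity.of_prime_left prime_X hg0).exists_eq_pow_mul_and_not_dvd
  have hf0 : f.coeff 0 ≠ 0 := fun h => hndvd (X_dvd_iff.2 h)
  refine ⟨multiplicity X g, f, hf0, ?_⟩
  rw [hg, Ideal.span_singleton_eq_span_singleton, coe_normalizeAtZero hf0]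
  refine Associated.trans (Associated.of_eq hf) (Associated.mul_left _ ?_)
  exact (associated_unit_mul_right f _ (isUnit_C.2 (isUnit_iff_ne_zero.2 (inv_ne_zero hf0))))

/-- For I ≠ 0 the extension to L[X] is generated by X ^ k * h with h(0) = 1. Then h splits off and
is a product of primes of R. If k = j + 1, what remains is X ^ j * J with M² ⊆ J ⊆ M for M = XL[X];
both J and (X) are M-primary and 2-absorbing. -/
theorem isTAFRing_of_isMaximal_bot (hA : (⊥ : Ideal A).IsMaximal) :
    IsTAFRing (subringAddXMul A) := by
  intro I hItop
  by_cases hI : I = ⊥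
  · exact ⟨{⊥}, by simpa using Ideal.isPrime_bot.isNAbsorbing two_pos, by simpa using hI.symm⟩
  obtain ⟨k, f, hf0, hmap⟩ := exists_map_eq_span_X_pow_mul hI
  set h := normalizeAtZero A f
  have hh0 : (h : L[X]).coeff 0 = 1 := by
    rw [coe_normalizeAtZero hf0, coeff_C_mul, inv_mul_cancel₀ hf0]
  have hdvd : ∀ x ∈ I, ∃ q : L[X], (x : L[X]) = (h : L[X]) * (X ^ k * q) := by
    intro x hx
    have h1 := Ideal.mem_map_of_mem (subringAddXMul A).subtype hx
    rw [hmap, Ideal.mem_span_singleton] at h1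
    obtain ⟨q, hq⟩ := h1
    exact ⟨q, by rw [← mul_assoc, mul_comm (h : L[X])]; exact hq⟩
  have hmem : ∀ q : L[X], mulX A (X ^ k * ((h : L[X]) * q)) ∈ I := fun q => mulX_mem_of_mem_map (by
    rw [hmap, ← mul_assoc]
    exact Ideal.mul_mem_right _ _ (Ideal.mem_span_singleton_self _))
  obtain ⟨I', hII', hI'⟩ := exists_eq_span_singleton_mul (I := I) (h := h) fun x hx => by
    obtain ⟨q, hq⟩ := hdvd x hx
    obtain ⟨d, -, hd⟩ := exists_eq_mul_of_coe_dvd hh0 hq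
    exact ⟨d, hd⟩
  have hmem' : ∀ q : L[X], mulX A (X ^ k * q) ∈ I' := fun q => by
    rw [hI', mulX_coe_mul]
    have h1 := hmem q
    rwa [mul_left_comm] at h1
  have hdvd' : ∀ d ∈ I', X ^ k ∣ (d : L[X]) := fun d hd => by
    obtain ⟨q, hq⟩ := hdvd _ ((hI' d).1 hd)
    rw [Subring.coe_mul] at hq
    have hh : (h : L[X]) ≠ 0 := by
      intro h0
      rw [h0, coeff_zero] at hh0
      exact zero_ne_one hh0
    exact ⟨q, mul_left_cancel₀ hh hq⟩
  obtain ⟨s, hs, hsprod⟩ := exists_prod_eq_span_normalizeAtZero (A := A) f hf0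
  rcases k with _ | j
  · refine ⟨s, fun J hJ => (hs J hJ).isNAbsorbing two_pos, ?_⟩
    suffices hTop : I' = ⊤ by rw [hsprod, hII', hTop, Ideal.mul_top]
    have hM : (overIdeal A ⊥).IsMaximal := inferInstance
    have hle : overIdeal A ⊥ ≤ I' := fun d hd => by
      rw [← pow_one (overIdeal A ⊥)] at hd
      obtain ⟨g, hg⟩ := exists_coe_eq_X_pow_mul hd
      have : d = mulX A (X ^ 0 * g) := Subtype.ext (by simp [hg])
      rw [this]
      exact hmem' g
    by_contra hne
    -- For k = 0 the cofactor contains M. If it were M, the extension of I would lie in (X),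
    -- although it is generated by h with h(0) = 1.
    have heq := hM.eq_of_le hne hle
    have hIM : I.map (subringAddXMul A).subtype ≤ Ideal.span {X} := by
      rw [Ideal.map_le_iff_le_comap, hII', ← heq]
      refine Ideal.mul_le_right.trans fun d hd => ?_
      rw [Ideal.mem_comap, Ideal.mem_span_singleton, X_dvd_iff]
      exact congrArg Subtype.val ((Submodule.mem_bot A).1 hd)
    rw [hmap, Ideal.span_singleton_le_span_singleton, X_dvd_iff, pow_zero, one_mul, hh0] at hIM
    exact one_ne_zero hIM
  · obtain ⟨J, hJI', hJ⟩ := exists_eq_span_singleton_mul (I := I') (h := mulX A 1 ^ j) fun d hd => by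
      obtain ⟨q, hq⟩ := hdvd' d hd
      exact ⟨mulX A q, Subtype.ext (by simp [hq]; ring)⟩
    have hle : J ≤ overIdeal A ⊥ := fun d hd => by
      obtain ⟨q, hq⟩ := hdvd' _ ((hJ d).1 hd)
      have h1 : (d : L[X]) = X * q := by
        refine mul_left_cancel₀ (pow_ne_zero j X_ne_zero) ?_
        simp only [Subring.coe_mul, SubmonoidClass.coe_pow, coe_mulX, mul_one] at hq
        rw [hq]
        ring
      rw [mem_overIdeal, Submodule.mem_bot]
      exact Subtype.ext (by simp [h1])
    have hge : overIdeal A ⊥ ^ 2 ≤ J := fun d hd => by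
      obtain ⟨g, hg⟩ := exists_coe_eq_X_pow_mul hd
      rw [hJ]
      have : mulX A 1 ^ j * d = mulX A (X ^ (j + 1) * g) := Subtype.ext (by simp [hg]; ring)
      rw [this]
      exact hmem' g
    have hX : IsNAbsorbing 2 (Ideal.span {mulX A 1}) := by
      refine isNAbsorbing_two_of_sq_le (M := overIdeal A ⊥) (fun d hd => ?_) ?_
      · obtain ⟨g, hg⟩ := exists_coe_eq_X_pow_mul hd
        exact Ideal.mem_span_singleton.2 ⟨mulX A g, Subtype.ext (by simp [hg]; ring)⟩
      · rw [Ideal.span_singleton_le_iff_mem]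
        exact mulX_mem_overIdeal A ⊥ 1
    refine ⟨J ::ₘ (s + Multiset.replicate j (Ideal.span {mulX A 1})), fun K hK => ?_, ?_⟩
    · rcases Multiset.mem_cons.1 hK with rfl | hK
      · exact isNAbsorbing_two_of_sq_le hge hle
      rcases Multiset.mem_add.1 hK with hK | hK
      · exact (hs K hK).isNAbsorbing two_pos
      · rwa [Multiset.eq_of_mem_replicate hK]
    · rw [Multiset.prod_cons, Multiset.prod_add, hsprod, Multiset.prod_replicate, hII', hJI',
        Ideal.span_singleton_pow]
      ring

end FieldExtension

/-! ### TAF and general ZPI rings -/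

section Factorization

variable {B : Type u} [CommRing B] {A : Subring B}

theorem nonempty_subringAddXMul_ringEquiv_pi {n : ℕ} {L : Fin n → Type*} [∀ i, Field (L i)]
    {F : ∀ i, Subfield (L i)} (e : B ≃+* ∀ i, L i) (he : ∀ b : B, b ∈ A ↔ ∀ i, e b i ∈ F i) :
    Nonempty (subringAddXMul A ≃+* ∀ i, subringAddXMul (F i).toSubring) := by
  let ψ : B[X] ≃+* ∀ i, (L i)[X] := (Polynomial.mapEquiv e).trans (Polynomial.piEquiv L)
  have hψ : ∀ f i k, (ψ f i).coeff k = e (f.coeff k) i := fun f i k => by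
    change ((f.map (e : B →+* ∀ i, L i)).map (Pi.evalRingHom L i)).coeff k = _
    rw [coeff_map, coeff_map]
    rfl
  let φ : subringAddXMul A →+* ∀ i, subringAddXMul (F i).toSubring := RingHom.pi fun i =>
    (((Pi.evalRingHom (fun i => (L i)[X]) i).comp (ψ : B[X] →+* ∀ i, (L i)[X])).comp
      (subringAddXMul A).subtype).codRestrict (subringAddXMul (F i).toSubring) fun f => by
        change (ψ f i).coeff 0 ∈ F i
        rw [hψ]
        exact (he _).1 f.2 i
  refine ⟨RingEquiv.ofBijective φ ⟨fun a b hab => ?_, fun y => ?_⟩⟩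
  · refine Subtype.ext (ψ.injective (funext fun i => ?_))
    exact congrArg Subtype.val (congrFun hab i)
  · refine ⟨⟨ψ.symm fun i => y i, (he _).2 fun i => ?_⟩, funext fun i => Subtype.ext ?_⟩
    · change e ((ψ.symm fun i => (y i : (L i)[X])).coeff 0) i ∈ F i
      rw [← hψ, ψ.apply_symm_apply]
      exact (y i).2
    · change ψ (ψ.symm fun i => (y i : (L i)[X])) i = y i
      rw [ψ.apply_symm_apply]

theorem isTAFRing_of_ringEquiv_pi {n : ℕ} {L : Fin n → Type*} [∀ i, Field (L i)]
    {F : ∀ i, Subfield (L i)} (e : B ≃+* ∀ i, L i) (he : ∀ b : B, b ∈ A ↔ ∀ i, e b i ∈ F i) :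
    IsTAFRing (subringAddXMul A) := by
  obtain ⟨ψ⟩ := nonempty_subringAddXMul_ringEquiv_pi e he
  have h : ∀ i, ProperIdealsFactor (subringAddXMul (F i).toSubring) (IsNAbsorbing 2) := fun i =>
    isTAFRing_of_isMaximal_bot (@Ideal.bot_isMaximal (F i) _)
  exact (ProperIdealsFactor.pi h fun i J hJ => hJ.comap _).of_ringEquiv ψ fun J hJ => hJ.comap _

theorem isGeneralZPI_polynomial {n : ℕ} {L : Fin n → Type*} [∀ i, Field (L i)]
    (e : B ≃+* ∀ i, L i) : IsGeneralZPI B[X] := by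
  have h : ∀ i, ProperIdealsFactor (L i)[X] Ideal.IsPrime := fun i =>
    isGeneralZPI_of_isDedekindDomain
  have h2 : ProperIdealsFactor (∀ i, (L i)[X]) Ideal.IsPrime :=
    ProperIdealsFactor.pi h fun i J hJ => Ideal.comap_isPrime _ J
  exact h2.of_ringEquiv ((Polynomial.mapEquiv e).trans (Polynomial.piEquiv L))
    fun J hJ => Ideal.comap_isPrime _ J

theorem IsGeneralZPI.isTAFRing {R : Type*} [CommRing R] (h : IsGeneralZPI R) : IsTAFRing R :=
  fun I hI => by
    obtain ⟨s, hs, hprod⟩ := h I hI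
    exact ⟨s, fun J hJ => (hs J hJ).isNAbsorbing two_pos, hprod⟩

/-- The linear coefficients of the elements of `I` may be multiplied by elements of `B`. -/
def IsLinearCoeffStable (I : Ideal (subringAddXMul A)) : Prop :=
  ∀ f ∈ I, ∀ c : B, ∃ g ∈ I, (g : B[X]).coeff 0 = 0 ∧
    (g : B[X]).coeff 1 = c * (f : B[X]).coeff 1

theorem isLinearCoeffStable_of_mulX_mem {I : Ideal (subringAddXMul A)}
    (hI : ∀ g, mulX A g ∈ I) : IsLinearCoeffStable I := fun f _ c =>
  ⟨mulX A (C (c * (f : B[X]).coeff 1)), hI _, by simp, by simp⟩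

theorem IsLinearCoeffStable.mul {I J : Ideal (subringAddXMul A)} (hI : IsLinearCoeffStable I)
    (hJ : IsLinearCoeffStable J) : IsLinearCoeffStable (I * J) := by
  intro f hf c
  refine Submodule.mul_induction_on hf (fun x hx y hy => ?_) fun x y hx hy => ?_
  · obtain ⟨x', hx', hx0, hx1⟩ := hI x hx c
    obtain ⟨y', hy', hy0, hy1⟩ := hJ y hy c
    -- Linear coefficients obey the Leibniz rule, so multiplication by c is carried out in each
    -- summand separately.
    refine ⟨x * y' + x' * y, add_mem (Ideal.mul_mem_mul hx hy') (Ideal.mul_mem_mul hx' hy), ?_, ?_⟩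
    · simp [mul_coeff_zero, hx0, hy0]
    · simp only [Subring.coe_add, Subring.coe_mul, coeff_add, mul_coeff_one, hx0, hy0, hx1, hy1]
      ring
  · obtain ⟨x', hx', hx0, hx1⟩ := hx
    obtain ⟨y', hy', hy0, hy1⟩ := hy
    refine ⟨x' + y', add_mem hx' hy', by simp [hx0, hy0], ?_⟩
    simp only [Subring.coe_add, coeff_add, hx1, hy1, mul_add]

/-- All prime factors of (X) contain X, hence XB[X], so their product (X) has linear coefficients
stable under B. But the linear coefficients of elements of XR are exactly the elements of A. -/
theorem IsGeneralZPI.eq_top [Nontrivial B] (h : IsGeneralZPI (subringAddXMul A)) : A = ⊤ := by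
  have hne : Ideal.span {mulX A 1} ≠ ⊤ := fun htop => by
    have h1 : (1 : subringAddXMul A) ∈ Ideal.span {mulX A 1} := htop ▸ trivial
    obtain ⟨d, hd⟩ := Ideal.mem_span_singleton.1 h1
    have h2 := congrArg (fun f : subringAddXMul A => (f : B[X]).coeff 0) hd
    simp at h2
  obtain ⟨s, hs, hprod⟩ := h _ hne
  have hX : ∀ J ∈ s, mulX A 1 ∈ J := fun J hJ =>
    Ideal.le_of_dvd (Multiset.dvd_prod hJ) (hprod ▸ Ideal.mem_span_singleton_self _)
  have hstable : IsLinearCoeffStable (Ideal.span {mulX A 1}) := by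
    rw [← hprod]
    refine Multiset.prod_induction IsLinearCoeffStable s (fun _ _ => IsLinearCoeffStable.mul) ?_
      fun J hJ => isLinearCoeffStable_of_mulX_mem fun g =>
        mulX_mem_of_mulX_one_mem A (hs J hJ) (hX J hJ) g
    exact isLinearCoeffStable_of_mulX_mem fun g => by simp
  rw [eq_top_iff]
  intro c _
  obtain ⟨g, hg, -, hg1⟩ := hstable _ (Ideal.mem_span_singleton_self _) c
  obtain ⟨d, rfl⟩ := Ideal.mem_span_singleton.1 hg
  rw [mulX_one_mul] at hg1
  have h1 : (d : B[X]).coeff 0 = c := by simpa using hg1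
  rw [← h1]
  exact d.2

end Factorization

/-! ### Assembly of the equivalences -/

section Main

variable {B : Type u} [CommRing B] [Nontrivial B]

theorem IsLocallyFieldExtension.isSemiQuasilocal_and_isVNRegular {A : Subring B}
    (h : IsLocallyFieldExtension A) (hA : IsSemiQuasilocal A) :
    (IsSemiQuasilocal A ∧ IsVNRegular A) ∧ (IsSemiQuasilocal B ∧ IsVNRegular B) ∧
      IsUnibranched A := by
  obtain ⟨hA', hB', hU⟩ := isLocallyFieldExtension_iff.1 h
  exact ⟨⟨hA, hA'⟩, ⟨h.isSemiQuasilocal hA, hB'⟩, hU⟩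

theorem isArtinianRing_unibranched_tfae (A : Subring B) :
    List.TFAE [
      IsTAFRing (subringAddXMul A),
      IsFAFRing (subringAddXMul A),
      IsStronglyLaskerian (subringAddXMul A) ∧ IsLocallyDivided (subringAddXMul A),
      IsFiniteAbsorbing (subringAddXMul A) ∧ IsLocallyDivided (subringAddXMul A),
      (IsSemiQuasilocal A ∧ IsVNRegular A) ∧ (IsSemiQuasilocal B ∧ IsVNRegular B) ∧
        IsUnibranched A,
      (IsArtinianRing A ∧ IsReduced A) ∧ (IsArtinianRing B ∧ IsReduced B) ∧ IsUnibranched A,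
      ∃ (n : ℕ) (L : Fin n → Type u) (_ : ∀ i, Field (L i)) (F : ∀ i, Subfield (L i)),
        Nonempty (A ≃+* ∀ i, F i) ∧ Nonempty (B ≃+* ∀ i, L i),
      ∃ (n : ℕ) (L : Fin n → Type u) (_ : ∀ i, Field (L i)) (F : ∀ i, Subfield (L i))
        (e : B ≃+* ∀ i, L i), ∀ b : B, b ∈ A ↔ ∀ i, e b i ∈ F i] := by
  tfae_have 1 → 2 := fun h => ⟨2, two_pos, h⟩
  tfae_have 2 → 5 := fun h => by
    have hE := isLocallyFieldExtension_of_isFAFRing h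
    have := hE.1
    have := hE.isReduced
    have := isReduced_subring A
    exact hE.isSemiQuasilocal_and_isVNRegular (isSemiQuasilocal_of_isFAFRing h)
  tfae_have 3 → 4 := fun h => ⟨h.1.isFiniteAbsorbing, h.2⟩
  tfae_have 4 → 5 := fun h => by
    have hE := isLocallyFieldExtension_of_finiteAbsorbing h.1 h.2
    have := hE.1
    have := hE.isReduced
    have := isReduced_subring A
    exact hE.isSemiQuasilocal_and_isVNRegular (isSemiQuasilocal_of_isFiniteAbsorbing h.1)
  tfae_have 5 ↔ 6 := by
    rw [isSemiQuasilocal_and_isVNRegular_iff, isSemiQuasilocal_and_isVNRegular_iff]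
  tfae_have 5 → 3 := fun ⟨hA, hB, hU⟩ =>
    ⟨((ringKrullDim_eq_one_and_isStronglyLaskerian_and_isReduced_iff A).2 ⟨hA, hB⟩).2.1,
      (isLocallyFieldExtension_iff.2 ⟨hA.2, hB.2, hU⟩).isLocallyDivided⟩
  tfae_have 5 → 8 := fun ⟨hA, hB, hU⟩ => by
    have := (isSemiQuasilocal_and_isVNRegular_iff.1 hB).1
    exact (isLocallyFieldExtension_iff.2 ⟨hA.2, hB.2, hU⟩).exists_ringEquiv_pi
  tfae_have 8 → 7 := fun ⟨n, L, _, F, e, he⟩ => ⟨n, L, _, F, nonempty_ringEquiv_pi e he, ⟨e⟩⟩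
  tfae_have 8 → 1 := fun ⟨n, L, _, F, e, he⟩ => isTAFRing_of_ringEquiv_pi e he
  tfae_have 7 → 6 := fun ⟨n, L, _, F, ⟨eA⟩, ⟨eB⟩⟩ =>
    ⟨⟨eA.symm.surjective.isArtinianRing (f := eA.symm), isReduced_of_injective eA eA.injective⟩,
      ⟨eB.symm.surjective.isArtinianRing (f := eB.symm), isReduced_of_injective eB eB.injective⟩,
      isUnibranched_of_ringEquiv_pi eA eB⟩
  tfae_finish

theorem isGeneralZPI_tfae (A : Subring B) :
    List.TFAE [
      IsGeneralZPI (subringAddXMul A),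
      IsStronglyLaskerian (subringAddXMul A) ∧ IsBezout (subringAddXMul A),
      IsTAFRing (subringAddXMul A) ∧ A = ⊤,
      A = ⊤ ∧ IsSemiQuasilocal B ∧ IsVNRegular B] := by
  have h5 := isArtinianRing_unibranched_tfae A
  have hTAF : IsTAFRing (subringAddXMul A) ↔ (IsSemiQuasilocal A ∧ IsVNRegular A) ∧
      (IsSemiQuasilocal B ∧ IsVNRegular B) ∧ IsUnibranched A := h5.out 0 4
  have hSL : IsStronglyLaskerian (subringAddXMul A) ∧ IsLocallyDivided (subringAddXMul A) ↔
      (IsSemiQuasilocal A ∧ IsVNRegular A) ∧ (IsSemiQuasilocal B ∧ IsVNRegular B) ∧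
        IsUnibranched A := h5.out 2 4
  have hBez : ringKrullDim (subringAddXMul A) = 1 ∧ IsBezout (subringAddXMul A) ↔
      A = ⊤ ∧ IsVNRegular B := (isVNRegular_top_tfae A).out 0 3
  have key : A = ⊤ ∧ IsSemiQuasilocal B ∧ IsVNRegular B →
      (IsSemiQuasilocal A ∧ IsVNRegular A) ∧ (IsSemiQuasilocal B ∧ IsVNRegular B) ∧
        IsUnibranched A := by
    rintro ⟨rfl, hB⟩
    obtain ⟨hart, hred⟩ := isSemiQuasilocal_and_isVNRegular_iff.1 hB
    let e := Subring.topEquiv (R := B)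
    have hE := isLocallyFieldExtension_top hB.2
    exact hE.isSemiQuasilocal_and_isVNRegular (isSemiQuasilocal_and_isVNRegular_iff.2
      ⟨e.symm.surjective.isArtinianRing (f := e.symm), isReduced_of_injective e e.injective⟩).1
  tfae_have 1 → 3 := fun h => ⟨h.isTAFRing, h.eq_top⟩
  tfae_have 3 → 4 := fun ⟨h, hA⟩ => ⟨hA, (hTAF.1 h).2.1⟩
  tfae_have 4 → 2 := fun h =>
    ⟨(hSL.2 (key h)).1, (hBez.2 ⟨h.1, h.2.2⟩).2⟩
  tfae_have 2 → 4 := fun ⟨hL, hb⟩ => by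
    obtain ⟨hA, hB, hU⟩ := hSL.1 ⟨hL, isArithmeticalRing_of_isBezout.isLocallyDivided⟩
    have hE := isLocallyFieldExtension_iff.2 ⟨hA.2, hB.2, hU⟩
    exact ⟨(hBez.1 ⟨hE.ringKrullDim_eq_one, hb⟩).1, hB⟩
  tfae_have 4 → 1 := fun h => by
    obtain ⟨hA, hB, hU⟩ := key h
    have := (isSemiQuasilocal_and_isVNRegular_iff.1 hB).1
    obtain ⟨n, L, _, F, e, -⟩ :=
      (isLocallyFieldExtension_iff.2 ⟨hA.2, hB.2, hU⟩).exists_ringEquiv_pi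
    obtain ⟨rfl, -⟩ := h
    exact (isGeneralZPI_polynomial e).of_ringEquiv subringAddXMulTopEquiv
      fun J hJ => Ideal.comap_isPrime _ J
  tfae_finish

end Main

theorem proposition5p5 {B : Type u} [CommRing B] [Nontrivial B] (A : Subring B) :
    -- (1)
    ((ringKrullDim (subringAddXMul A) = 1 ∧ IsReduced (subringAddXMul A)) ↔
      (IsVNRegular A ∧ IsVNRegular B)) ∧
    -- (2)
    List.TFAE [
      ∀ (M : Ideal (subringAddXMul A)) [M.IsMaximal],
        IsMoriDomain (Localization.AtPrime M) ∧ IsPVD (Localization.AtPrime M),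
      ∀ (M : Ideal (subringAddXMul A)) [M.IsMaximal],
        IsDomain (Localization.AtPrime M) ∧ ringKrullDim (Localization.AtPrime M) = 1,
      SatisfiesStar (subringAddXMul A),
      ringKrullDim (subringAddXMul A) = 1 ∧ IsLPVR (subringAddXMul A),
      ringKrullDim (subringAddXMul A) = 1 ∧ IsLocallyDivided (subringAddXMul A),
      IsVNRegular A ∧ IsVNRegular B ∧ IsUnibranched A] ∧
    -- (3)
    ((ringKrullDim (subringAddXMul A) = 1 ∧ IsStronglyLaskerian (subringAddXMul A) ∧
        IsReduced (subringAddXMul A)) ↔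
      ((IsSemiQuasilocal A ∧ IsVNRegular A) ∧ (IsSemiQuasilocal B ∧ IsVNRegular B))) ∧
    -- (4)
    List.TFAE [
      ringKrullDim (subringAddXMul A) = 1 ∧ IsBezout (subringAddXMul A),
      ∀ (M : Ideal (subringAddXMul A)) [M.IsMaximal], IsDVR (Localization.AtPrime M),
      ringKrullDim (subringAddXMul A) = 1 ∧ IsArithmeticalRing (subringAddXMul A),
      A = ⊤ ∧ IsVNRegular B] ∧
    -- (5)
    List.TFAE [
      IsTAFRing (subringAddXMul A),
      IsFAFRing (subringAddXMul A),
      IsStronglyLaskerian (subringAddXMul A) ∧ IsLocallyDivided (subringAddXMul A),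
      IsFiniteAbsorbing (subringAddXMul A) ∧ IsLocallyDivided (subringAddXMul A),
      (IsSemiQuasilocal A ∧ IsVNRegular A) ∧ (IsSemiQuasilocal B ∧ IsVNRegular B) ∧
        IsUnibranched A,
      (IsArtinianRing A ∧ IsReduced A) ∧ (IsArtinianRing B ∧ IsReduced B) ∧ IsUnibranched A,
      -- `A ≅ ∏ Fᵢ` and `B ≅ ∏ Lᵢ` with `Fᵢ` a subfield of the field `Lᵢ`
      ∃ (n : ℕ) (L : Fin n → Type u) (_ : ∀ i, Field (L i)) (F : ∀ i, Subfield (L i)),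
        Nonempty (A ≃+* ∀ i, F i) ∧ Nonempty (B ≃+* ∀ i, L i),
      -- the same, by an isomorphism `B ≅ ∏ Lᵢ` that carries `A` onto `∏ Fᵢ`
      ∃ (n : ℕ) (L : Fin n → Type u) (_ : ∀ i, Field (L i)) (F : ∀ i, Subfield (L i))
        (e : B ≃+* ∀ i, L i), ∀ b : B, b ∈ A ↔ ∀ i, e b i ∈ F i] ∧
    -- (6)
    List.TFAE [
      IsGeneralZPI (subringAddXMul A),
      IsStronglyLaskerian (subringAddXMul A) ∧ IsBezout (subringAddXMul A),
      IsTAFRing (subringAddXMul A) ∧ A = ⊤,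
      A = ⊤ ∧ IsSemiQuasilocal B ∧ IsVNRegular B] :=
  ⟨ringKrullDim_eq_one_and_isReduced_iff A, isVNRegular_unibranched_tfae A,
    ringKrullDim_eq_one_and_isStronglyLaskerian_and_isReduced_iff A, isVNRegular_top_tfae A,
    isArtinianRing_unibranched_tfae A, isGeneralZPI_tfae A⟩
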